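/- **Theorem (4th-order Birkhoff Normal Form).** Let $m\ge -1/2$ and, for $j\in\mathbb N=\{1,2,\dots\}$, let $\omega_j:=\sqrt{j^4+mj^2}$. Put $\mu:=\min\{2\sqrt{1+m},\tfrac32\sqrt{4+m}\}$, and $\mathfrak c:=1$ if $m\ge0$, $\mathfrak c:=(1+m)^{-1/2}$ if $m<0$. Let $\mathtt w=(\mathtt w_j)_{j\ge1}$ be a real sequence with $\inf_j \mathtt w_j>0$, let $h_{\mathtt w}$ be the Hilbert space of complex sequences with $|z|_{\mathtt w}^2:=\sum_j \mathtt w_j^2|z_j|^2<\infty$, with the symplectic form $\mathrm i\sum_j dz_j\wedge d\bar z_j$, and let $B_r$ be its closed ball of radius $r$ centred at $0$. Let $$H=\Lambda+G,\qquad \Lambda(z)=\sum_j\omega_j|z_j|^2,\qquad G(z)=\frac1{32\pi}\Big(\sum_j\frac{j^2}{\omega_j}(z_j+\bar z_j)^2\Big)^2,$$ $$\bar G(z)=\sum_{i,j}A_{ij}|z_i|^2|z_j|^2,\qquad A_{ij}=\frac1{8\pi}\frac{i^2j^2}{\omega_i\omega_j}\ (i\ne j),\qquad A_{ii}=\frac{3}{16\pi}\frac{i^4}{\omega_i^2},$$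 $$\gamma_r:=\sup_{|z|_{\mathtt w}\le r}\Big(\sum_j\frac{j^2}{\omega_j}|z_j|^2\Big)^{1/2}.$$ For a power series $F=\sum_{\alpha,\beta}F_{\alpha,\beta}z^\alpha\bar z^\beta$ (finitely supported multi-indices, $F_{\alpha,\beta}=\overline{F_{\beta,\alpha}}$, $F_{0,0}=0$) with majorant $\underline F=\sum|F_{\alpha,\beta}|z^\alpha\bar z^\beta$, let $|F|_{r,\mathtt w}:=r^{-1}\sup_{|u|_{\mathtt w}\le r}\big|(\mathrm i\,\partial_{\bar z_j}\underline F(u))_j\big|_{\mathtt w}$; $\mathcal H_r$ is the set of those $F$ for which $F$ and $\underline F$ converge absolutely at every point of $B_r$ and $|F|_{r,\mathtt w}<\infty$. Let $r>0$ be such that $$0<\gamma_r\le\frac5{11}\sqrt{\frac{\pi\mu}{22e\mathfrak c}} .$$ Then there are two invertible symplectic transformations $\Psi,\Psi^{-1}:B_r\to h_{\mathtt w}$ (real analytic on a neighbourhood of $B_r$, injective on $B_r$, with invertible derivatives preserving the symplectic form) such that $$\sup_{|z|_{\mathtt w}\le r}|\Psi^{\pm1}(z)-z|_{\mathtt w}\le\frac{11^3\mathfrak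 c}{10^3\pi\mu}\gamma_r^2\,r\le\frac{r}{80e},\qquad \Psi(\Psi^{-1}(z))=\Psi^{-1}(\Psi(z))=z\quad\forall z\in B_{(1-\frac1{80e})r},$$ and there is $R\in\mathcal H_r$ such that, at every $z\in B_r$ with $\Lambda(z)<\infty$, also $\Lambda(\Psi(z))<\infty$ and $$H(\Psi(z))=\Lambda(z)+\bar G(z)+R(z),$$ with $$|R|_{r,\mathtt w}\le C_r:=\frac{3\mathfrak c}{2\pi e}\,\frac{\eta_r}{1-\eta_r}\Big(\frac{11\gamma_r}{10}\Big)^2,\qquad \eta_r:=\frac{44e\mathfrak c}{\pi\mu}\Big(\frac{11\gamma_r}{10}\Big)^2 .$$ Moreover $R=\sum_{n\ge3}R^{(2n)}$ on $B_r$ is a series of homogeneous polynomials of even degree $2n$, in whose monomials $z^\alpha\bar z^\beta$ all $\alpha_j+\beta_j$ are even, that is, with $z^+:=z$, $z^-:=\bar z$, $$R^{(2n)}(z)=\sum_{\ell\in\mathbb N^n,\ \sigma,\sigma'\in\{+,-\}^n}R^{\sigma,\sigma'}_\ell\, z_{\ell_1}^{\sigma_1}z_{\ell_1}^{\sigma_1'}\cdots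 z_{\ell_n}^{\sigma_n}z_{\ell_n}^{\sigma_n'} ,$$ and $R^{(\ge8)}:=R-R^{(6)}$ satisfies $$|R^{(\ge8)}|_{r,\mathtt w}\le\frac{16\cdot44^2}{3}\Big(\frac{11}{10}\Big)^6\frac{\mathfrak c^3}{\pi^3}\,\frac{\gamma_r^6}{\mu^2}.$$ -/

import Mathlib

open scoped ENNReal ComplexConjugate

/-! ### The phase space `h_w` -/

/-- A weight: a real sequence `(w_j)_{j ≥ 1}` with `inf_j w_j > 0`. -/
structure BeamWeight where
  val : ℕ+ → ℝ
  bdd : ∃ c : ℝ, 0 < c ∧ ∀ j, c ≤ val j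

theorem BeamWeight.pos (w : BeamWeight) (j : ℕ+) : 0 < w.val j := by
  obtain ⟨c, hc, h⟩ := w.bdd
  exact hc.trans_le (h j)

theorem beam_memlp_iff (w : BeamWeight) (z : ℕ+ → ℂ) :
    Memℓp (fun j => ((w.val j : ℝ) : ℂ) * z j) 2 ↔
      Summable (fun j => w.val j ^ 2 * ‖z j‖ ^ 2) := by
  rw [memℓp_gen_iff (by norm_num)]
  have h : (fun j => ‖((w.val j : ℝ) : ℂ) * z j‖ ^ (2 : ℝ≥0∞).toReal) =
      fun j => w.val j ^ 2 * ‖z j‖ ^ 2 := by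
    funext j
    simp [mul_pow]
  rw [h]

/-- The complex sequences with `∑ w_j² |z_j|² < ∞` (they are in `ℓ²` since `inf w > 0`). -/
def beamSubmodule (w : BeamWeight) : Submodule ℂ (ℕ+ → ℂ) where
  carrier := {z | Summable (fun j => w.val j ^ 2 * ‖z j‖ ^ 2)}
  zero_mem' := by simp [summable_zero]
  add_mem' := by
    intro a b ha hb
    have ha' := (beam_memlp_iff w a).2 ha
    have hb' := (beam_memlp_iff w b).2 hb
    refine (beam_memlp_iff w (a + b)).1 ?_
    have h := ha'.add hb'
    convert h using 1
    funext j
    simp [mul_add]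
  smul_mem' := by
    intro c a ha
    have ha' := (beam_memlp_iff w a).2 ha
    refine (beam_memlp_iff w (c • a)).1 ?_
    have h := ha'.const_smul c
    convert h using 1
    funext j
    simp only [Pi.smul_apply, smul_eq_mul]
    ring

/-- The space `h_w`, as a type of its own, so that it carries the topology of its norm
and not that of pointwise convergence. -/
def BeamSpace (w : BeamWeight) : Type := ↥(beamSubmodule w)

noncomputable instance (w : BeamWeight) : AddCommGroup (BeamSpace w) :=
  inferInstanceAs (AddCommGroup ↥(beamSubmodule w))

noncomputable instance (w : BeamWeight) : Module ℂ (BeamSpace w) :=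
  inferInstanceAs (Module ℂ ↥(beamSubmodule w))

/-- An element `z` of `h_w` is used as the sequence `j ↦ z j`. -/
instance (w : BeamWeight) : CoeFun (BeamSpace w) (fun _ => ℕ+ → ℂ) := ⟨fun z => z.1⟩

/-- The linear map `z ↦ (w_j z_j)_j` from `h_w` to `ℓ²`; the norm of `h_w` is pulled back
along it. -/
noncomputable def BeamSpace.toL2 (w : BeamWeight) :
    BeamSpace w →ₗ[ℂ] lp (fun _ : ℕ+ => ℂ) 2 where
  toFun z := ⟨fun j => ((w.val j : ℝ) : ℂ) * z j, (beam_memlp_iff w z).2 z.2⟩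
  map_add' a b := by
    ext j
    exact mul_add _ (a j) (b j)
  map_smul' c a := by
    ext j
    exact mul_left_comm _ c (a j)

theorem BeamSpace.toL2_injective (w : BeamWeight) : Function.Injective (BeamSpace.toL2 w) := by
  intro a b h
  refine Subtype.ext (funext fun j => ?_)
  have hj : ((w.val j : ℝ) : ℂ) * a j = ((w.val j : ℝ) : ℂ) * b j :=
    congrFun (congrArg Subtype.val h) j
  exact mul_left_cancel₀ (Complex.ofReal_ne_zero.2 (w.pos j).ne') hj

noncomputable instance (w : BeamWeight) : NormedAddCommGroup (BeamSpace w) :=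
  NormedAddCommGroup.induced (BeamSpace w) (lp (fun _ : ℕ+ => ℂ) 2) (BeamSpace.toL2 w)
    (BeamSpace.toL2_injective w)

noncomputable instance (w : BeamWeight) : NormedSpace ℂ (BeamSpace w) :=
  NormedSpace.induced ℂ (BeamSpace w) (lp (fun _ : ℕ+ => ℂ) 2) (BeamSpace.toL2 w)

/-- The norm of `h_w` is `|z|_w² = ∑ w_j² |z_j|²`. -/
theorem BeamSpace.norm_sq (w : BeamWeight) (z : BeamSpace w) :
    ‖z‖ ^ 2 = ∑' j : ℕ+, w.val j ^ 2 * ‖z j‖ ^ 2 := by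
  have h := lp.norm_rpow_eq_tsum (p := 2) (by norm_num) (BeamSpace.toL2 w z)
  have h2 : ‖BeamSpace.toL2 w z‖ ^ 2 = ∑' j : ℕ+, ‖((w.val j : ℝ) : ℂ) * z j‖ ^ 2 := by
    simpa [BeamSpace.toL2] using h
  change ‖BeamSpace.toL2 w z‖ ^ 2 = _
  rw [h2]
  refine tsum_congr fun j => ?_
  simp [mul_pow]

/-! ### The beam Hamiltonian -/

/-- `ω_j = √(j⁴ + m j²)`. -/
noncomputable def beamOmega (m : ℝ) (j : ℕ+) : ℝ := √((j : ℝ) ^ 4 + m * (j : ℝ) ^ 2)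

/-- `μ = min {2 √(1+m), (3/2) √(4+m)}`. -/
noncomputable def beamMu (m : ℝ) : ℝ := min (2 * √(1 + m)) (3 / 2 * √(4 + m))

/-- `𝔠 = 1` if `m ≥ 0` and `𝔠 = (1+m)^{-1/2}` if `m < 0`. -/
noncomputable def beamC (m : ℝ) : ℝ := if 0 ≤ m then 1 else 1 / √(1 + m)

/-- `|z|_{w⁰} = (∑ (j²/ω_j) |z_j|²)^{1/2}`. -/
noncomputable def normW0 (m : ℝ) {w : BeamWeight} (z : BeamSpace w) : ℝ :=
  √(∑' j : ℕ+, (j : ℝ) ^ 2 / beamOmega m j * ‖z j‖ ^ 2)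

/-- `γ_r = sup_{|z|_w ≤ r} |z|_{w⁰}`. -/
noncomputable def beamGamma (m : ℝ) (w : BeamWeight) (r : ℝ) : ℝ :=
  sSup ((fun z : BeamSpace w => normW0 m z) '' Metric.closedBall 0 r)

/-- `Λ(z) = ∑ ω_j |z_j|²`, meaningful at the `z` with `LambdaFinite m z`. -/
noncomputable def beamLambda (m : ℝ) {w : BeamWeight} (z : BeamSpace w) : ℝ :=
  ∑' j : ℕ+, beamOmega m j * ‖z j‖ ^ 2

/-- `∑ ω_j |z_j|² < ∞`. -/
def LambdaFinite (m : ℝ) {w : BeamWeight} (z : BeamSpace w) : Prop :=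
  Summable fun j : ℕ+ => beamOmega m j * ‖z j‖ ^ 2

/-- `G(z) = (1/32π) (∑ (j²/ω_j) (z_j + z̄_j)²)²`, where `z_j + z̄_j = 2 Re z_j`. -/
noncomputable def beamG (m : ℝ) {w : BeamWeight} (z : BeamSpace w) : ℝ :=
  1 / (32 * Real.pi) *
    (∑' j : ℕ+, (j : ℝ) ^ 2 / beamOmega m j * (2 * (z j).re) ^ 2) ^ 2

/-- `H = Λ + G`. -/
noncomputable def beamH (m : ℝ) {w : BeamWeight} (z : BeamSpace w) : ℝ :=
  beamLambda m z + beamG m z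

/-- The coefficients `A_ij` of the integrable quartic part. -/
noncomputable def beamA (m : ℝ) (i j : ℕ+) : ℝ :=
  if i = j then 3 / (16 * Real.pi) * ((i : ℝ) ^ 4 / beamOmega m i ^ 2)
  else 1 / (8 * Real.pi) * ((i : ℝ) ^ 2 * (j : ℝ) ^ 2 / (beamOmega m i * beamOmega m j))

/-- `Ḡ(z) = ∑_{i,j} A_ij |z_i|² |z_j|²`. -/
noncomputable def beamGbar (m : ℝ) {w : BeamWeight} (z : BeamSpace w) : ℝ :=
  ∑' p : ℕ+ × ℕ+, beamA m p.1 p.2 * ‖z p.1‖ ^ 2 * ‖z p.2‖ ^ 2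

/-! ### Power series Hamiltonians -/

/-- Finitely supported multi-indices with entries in `{0, 1, 2, …}`. -/
abbrev MIdx := ℕ+ →₀ ℕ

/-- Coefficients `H_{α,β}` of a formal power series `∑ H_{α,β} z^α z̄^β`. -/
abbrev HamSeries := MIdx × MIdx → ℂ

/-- `z^α z̄^β`. -/
noncomputable def hamMonomial (z : ℕ+ → ℂ) (α β : MIdx) : ℂ :=
  (α.prod fun j k => z j ^ k) * (β.prod fun j k => conj (z j) ^ k)

/-- `|α| + |β|`. -/
def hamDegree (p : MIdx × MIdx) : ℕ := (p.1.sum fun _ k => k) + (p.2.sum fun _ k => k)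

/-- The value of the series at `z`. -/
noncomputable def hamEval (F : HamSeries) (z : ℕ+ → ℂ) : ℂ :=
  ∑' p : MIdx × MIdx, F p * hamMonomial z p.1 p.2

/-- `∑ |H_{α,β}| β_j |u^α ū^{β - e_j}|`: the modulus of the `j`-th entry
`i ∂/∂z̄_j` of the Hamiltonian vector field of the majorant, at the point `(|u_k|)_k`. -/
noncomputable def majorantField (F : HamSeries) (u : ℕ+ → ℂ) (j : ℕ+) : ℝ≥0∞ :=
  ∑' p : MIdx × MIdx,
    ‖F p‖ₑ * (p.2 j : ℝ≥0∞) * ‖hamMonomial u p.1 (p.2 - Finsupp.single j 1)‖ₑ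

/-- `|H|_{r,w} = r⁻¹ sup_{|u|_w ≤ r} |X_{H̲}(u)|_w`, with values in `[0, ∞]`.
Since the majorant has non-negative coefficients and `(|u_k|)_k` has the same norm as `u`,
the supremum over the ball is the supremum over the points `(|u_k|)_k`. -/
noncomputable def hamNorm (w : BeamWeight) (r : ℝ) (F : HamSeries) : ℝ≥0∞ :=
  (⨆ u ∈ Metric.closedBall (0 : BeamSpace w) r,
    (∑' j : ℕ+, ENNReal.ofReal (w.val j) ^ 2 * majorantField F u j ^ 2) ^ (1 / 2 : ℝ)) /
      ENNReal.ofReal r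

/-- Membership in `𝓗_r(h_w)`: real, vanishing at the origin, the series and its majorant
converge absolutely on the closed ball of radius `r`, finite norm. -/
structure MemHam (w : BeamWeight) (r : ℝ) (F : HamSeries) : Prop where
  real : ∀ α β, F (α, β) = conj (F (β, α))
  zero : F (0, 0) = 0
  summable : ∀ z ∈ Metric.closedBall (0 : BeamSpace w) r,
    Summable fun p : MIdx × MIdx => ‖F p * hamMonomial z p.1 p.2‖
  finite : hamNorm w r F < ∞

/-- The homogeneous part of degree `d`. -/
noncomputable def homPart (d : ℕ) (F : HamSeries) : HamSeries :=
  fun p => if hamDegree p = d then F p else 0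

/-- `z^+ = z` and `z^- = z̄`. -/
noncomputable def zSign (s : Bool) (x : ℂ) : ℂ := if s then x else conj x

/-! ### Symplectic transformations -/

/-- The symplectic form `i ∑ dz_j ∧ dz̄_j`. -/
noncomputable def symplForm {w : BeamWeight} (u v : BeamSpace w) : ℂ :=
  Complex.I * ∑' j : ℕ+, (u j * conj (v j) - v j * conj (u j))

/-- An invertible symplectic transformation of `U ⊆ h_w` into `h_w`: real analytic on a
neighbourhood of `U`, injective on `U`, with invertible derivatives at the points of `U`,
which preserve the symplectic form. -/
structure IsSymplTransf {w : BeamWeight} (U : Set (BeamSpace w)) (Ψ : BeamSpace w → BeamSpace w) :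
    Prop where
  analytic : AnalyticOnNhd ℝ Ψ U
  injOn : Set.InjOn Ψ U
  invertible : ∀ z ∈ U, (fderiv ℝ Ψ z).IsInvertible
  symplectic : ∀ z ∈ U, ∀ u v : BeamSpace w,
    symplForm (fderiv ℝ Ψ z u) (fderiv ℝ Ψ z v) = symplForm u v

/-! ### The constants of the normal form -/

/-- `η_r = (44 e 𝔠 / (π μ)) (11 γ_r / 10)²`. -/
noncomputable def beamEta (m : ℝ) (w : BeamWeight) (r : ℝ) : ℝ :=
  44 * Real.exp 1 * beamC m / (Real.pi * beamMu m) * (11 * beamGamma m w r / 10) ^ 2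

/-- `C_r = (3 𝔠 / (2 π e)) (η_r / (1 - η_r)) (11 γ_r / 10)²`. -/
noncomputable def beamCr (m : ℝ) (w : BeamWeight) (r : ℝ) : ℝ :=
  3 * beamC m / (2 * Real.pi * Real.exp 1) * (beamEta m w r / (1 - beamEta m w r)) *
    (11 * beamGamma m w r / 10) ^ 2

/-! The normal form comes from a single Lie transform. Monomials are grouped into pairs `z_i^σ
z_i^σ'` with frequency `(ε_σ + ε_σ') ω_i`, so that `G = ∑ q(a, b) z_a z_b`. The sum of the two
frequencies vanishes exactly on the terms that make up `Ḡ`, and elsewhere it is at least `μ` in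
modulus (`beamMu_le_abs_pairFreq_add`). Dividing the remaining coefficients by it gives a generating
function whose Hamiltonian field `X` solves the homological equation: along `X`, `Λ` has derivative
`-N`, where `N = G - Ḡ` (`hasSum_lambda_deriv`). With `L` the derivative along `X` and `Ψ` the
time-one map, Taylor expansion in time gives `H ∘ Ψ = Λ + Ḡ + ∑_{k ≥ 1} (L^k G / k! - L^k N /
(k+1)!)`, and the last sum is `R` (`hasSum_tensEval_remTens`).

The field is cubic and respects modes: `|X_j(z)| ≤ K ‖z‖² |z_j|` with `K = (𝔠/(πμ)) (γ_r/r)²`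
(`norm_genField_le`). It is therefore bounded on `h_w` for every weight, and Grönwall in each mode
gives `|z_j(t)| ≤ C |z_j(0)|` with `C` independent of `j`. This preserves the finiteness of `Λ` and
justifies differentiating all series term by term.

The flow is studied for any bounded trilinear `T` on a Banach space. `flowMap` is the sum of the Lie
series, hence analytic; Picard–Lindelöf provides trajectories, and Taylor summation identifies their
endpoints with values of `flowMap` (`IsFlowCurve.flowMap_eq`). Inverses come from time reversal.
Symplecticity (`flowMap_symplectic`) comes from homogeneity: Euler's relation `DΨ(z) z = Ψ(z) + 2
X(Ψ(z))` makes the pulled-back form constant along rays from the origin, where `DΨ = id`.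

For the estimates, `L` turns a coefficient bound `M ∏ j²/ω_j` on a polynomial in `n` pairs into the
same bound with `n (𝔠/(πμ)) M` (`TensBound.lieTens`). The factorials of the Lie series absorb the
products of these `n`, and the norm of `R` is dominated by a geometric series of ratio `8 𝔠
γ_r²/(πμ)` (`remTerm_le`). Since different families of pairs may give the same monomial `z^α z̄^β`,
`gather` collects their coefficients into a power series. -/

/-! ### Lie series of a bounded cubic field, and summation of Taylor series -/

section Flow

set_option maxSynthPendingDepth 3

variable {E : Type*} [NormedAddCommGroup E] [NormedSpace ℝ E]

/-- The linear map `A ↦ ∑ i, M ∘ (id, …, A, …, id)` with `A` in the `i`-th slot. -/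
noncomputable def slotSum {n : ℕ} (M : E [×n]→L[ℝ] E) : (E →L[ℝ] E) →L[ℝ] (E [×n]→L[ℝ] E) :=
  ∑ i, ((ContinuousMultilinearMap.compContinuousLinearMapContinuousMultilinear ℝ
    (fun _ : Fin n => E) (fun _ : Fin n => E) E).toContinuousLinearMap
      (fun _ => ContinuousLinearMap.id ℝ E) i).flip M

theorem slotSum_apply {n : ℕ} (M : E [×n]→L[ℝ] E) (A : E →L[ℝ] E) (v : Fin n → E) :
    slotSum M A v = ∑ i, M (Function.update v i (A (v i))) := by
  simp only [slotSum, sum_apply]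
  refine Finset.sum_congr rfl fun i _ => ?_
  simp only [ContinuousLinearMap.flip_apply, ContinuousMultilinearMap.toContinuousLinearMap_apply]
  change M (fun j => (Function.update (fun _ => ContinuousLinearMap.id ℝ E) i A j) (v j)) = _
  congr 1
  funext j
  by_cases h : j = i
  · subst h; simp
  · simp [h]

theorem norm_slotSum_apply_le {n : ℕ} (M : E [×n]→L[ℝ] E) (A : E →L[ℝ] E) :
    ‖slotSum M A‖ ≤ n * ‖M‖ * ‖A‖ := by
  refine ContinuousMultilinearMap.opNorm_le_bound (by positivity) fun v => ?_
  rw [slotSum_apply]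
  refine (norm_sum_le _ _).trans ?_
  have : ∀ i ∈ (Finset.univ : Finset (Fin n)), ‖M (Function.update v i (A (v i)))‖ ≤
      ‖M‖ * ‖A‖ * ∏ j, ‖v j‖ := by
    intro i _
    refine (M.le_opNorm _).trans ?_
    rw [mul_assoc]
    gcongr
    rw [← Finset.mul_prod_erase _ _ (Finset.mem_univ i), ← Finset.mul_prod_erase _ (fun j => ‖v j‖) (Finset.mem_univ i)]
    rw [Function.update_self, ← mul_assoc]
    refine mul_le_mul (A.le_opNorm _) (le_of_eq ?_) (by positivity) (by positivity)
    refine Finset.prod_congr rfl fun j hj => ?_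
    rw [Function.update_of_ne (Finset.ne_of_mem_erase hj)]
  refine (Finset.sum_le_card_nsmul _ _ _ this).trans (le_of_eq ?_)
  simp [mul_assoc]

/-- The multilinear form of the Lie derivative along the cubic field `z ↦ T z z z`. -/
noncomputable def lieStep (T : E →L[ℝ] E →L[ℝ] E →L[ℝ] E) {n : ℕ} (M : E [×n]→L[ℝ] E) :
    E [×(n + 2)]→L[ℝ] E :=
  (continuousMultilinearCurryLeftEquiv ℝ (fun _ : Fin (n + 2) => E) E).symm
    (((continuousMultilinearCurryLeftEquiv ℝ
        (fun _ : Fin (n + 1) => E) E).symm.toContinuousLinearEquiv : _ →L[ℝ] _).comp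
      ((ContinuousLinearMap.compL ℝ E _ _ (slotSum M)).comp T))

theorem lieStep_diag (T : E →L[ℝ] E →L[ℝ] E →L[ℝ] E) {n : ℕ} (M : E [×n]→L[ℝ] E) (z : E) :
    lieStep T M (fun _ => z) = ∑ i, M (Function.update (fun _ => z) i (T z z z)) := by
  simp only [lieStep]
  exact slotSum_apply M (T z z) (fun _ => z)

theorem norm_lieStep_le (T : E →L[ℝ] E →L[ℝ] E →L[ℝ] E) {n : ℕ} (M : E [×n]→L[ℝ] E) :
    ‖lieStep T M‖ ≤ n * ‖T‖ * ‖M‖ := by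
  rw [lieStep, LinearIsometryEquiv.norm_map]
  refine ContinuousLinearMap.opNorm_le_bound _ (by positivity) fun x => ?_
  rw [ContinuousLinearMap.comp_apply]
  erw [LinearIsometryEquiv.norm_map]
  refine ContinuousLinearMap.opNorm_le_bound _ (by positivity) fun y => ?_
  change ‖slotSum M (T x y)‖ ≤ _
  refine (norm_slotSum_apply_le M _).trans ?_
  have := T.le_opNorm₂ x y
  calc (n : ℝ) * ‖M‖ * ‖T x y‖ ≤ n * ‖M‖ * (‖T‖ * ‖x‖ * ‖y‖) := by gcongr
    _ = _ := by ring

/-- The Lie series of the time-one flow of `z' = T z z z`. -/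
noncomputable def flowSeries (T : E →L[ℝ] E →L[ℝ] E →L[ℝ] E) : FormalMultilinearSeries ℝ E E
  | 0 => 0
  | 1 => (continuousMultilinearCurryFin1 ℝ E E).symm (ContinuousLinearMap.id ℝ E)
  -- For `n = 2k + 1` the factor is `1 / (k + 1)`, so the term of degree `2k + 1` is `L^k id / k!`.
  -- The even terms vanish because the term of degree 0 does.
  | n + 2 => (2 / ((n : ℝ) + 1)) • lieStep T (flowSeries T n)

/-- The time-one flow of `z' = T z z z`, as the sum of its Lie series. -/
noncomputable def flowMap (T : E →L[ℝ] E →L[ℝ] E →L[ℝ] E) : E → E := (flowSeries T).sum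

theorem flowSeries_even (T : E →L[ℝ] E →L[ℝ] E →L[ℝ] E) (k : ℕ) :
    flowSeries T (2 * k) = 0 := by
  induction k with
  | zero => rfl
  | succ k ih =>
    change (2 / (((2 * k : ℕ) : ℝ) + 1)) • lieStep T (flowSeries T (2 * k)) = 0
    rw [ih, norm_le_zero_iff.1 ((norm_lieStep_le T (0 : E [×(2 * k)]→L[ℝ] E)).trans (by simp)),
      smul_zero]

/-- The factor `2 / (n + 1)` absorbs the `n` slots of `lieStep`, so the norms grow only
geometrically. -/
theorem norm_flowSeries_add_two_le (T : E →L[ℝ] E →L[ℝ] E →L[ℝ] E) (n : ℕ) :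
    ‖flowSeries T (n + 2)‖ ≤ 2 * ‖T‖ * ‖flowSeries T n‖ := by
  have : flowSeries T (n + 2) = (2 / ((n : ℝ) + 1)) • lieStep T (flowSeries T n) := rfl
  rw [this, norm_smul]
  have h1 := norm_lieStep_le T (flowSeries T n)
  have h2 : ‖(2 / ((n : ℝ) + 1))‖ = 2 / ((n : ℝ) + 1) := Real.norm_of_nonneg (by positivity)
  rw [h2, div_mul_eq_mul_div, div_le_iff₀ (by positivity)]
  have : 0 ≤ ‖T‖ * ‖flowSeries T n‖ := by positivity
  nlinarith

theorem norm_flowSeries_mul_pow_le (T : E →L[ℝ] E →L[ℝ] E →L[ℝ] E) {ρ : ℝ} (hρ : 0 ≤ ρ)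
    (h : 2 * ‖T‖ * ρ ^ 2 ≤ 1) (n : ℕ) : ‖flowSeries T n‖ * ρ ^ n ≤ ρ := by
  induction n using Nat.twoStepInduction with
  | zero => simpa [flowSeries] using hρ
  | one =>
    have : ‖flowSeries T 1‖ ≤ 1 := by
      rw [flowSeries, LinearIsometryEquiv.norm_map]
      exact ContinuousLinearMap.norm_id_le
    nlinarith
  | more n ih _ =>
    have := norm_flowSeries_add_two_le T n
    calc ‖flowSeries T (n + 2)‖ * ρ ^ (n + 2)
        ≤ (2 * ‖T‖ * ‖flowSeries T n‖) * ρ ^ (n + 2) := by gcongr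
      _ = (2 * ‖T‖ * ρ ^ 2) * (‖flowSeries T n‖ * ρ ^ n) := by ring
      _ ≤ 1 * ρ := by gcongr
      _ = ρ := one_mul ρ

theorem hasFPowerSeriesOnBall_flowMap [CompleteSpace E] (T : E →L[ℝ] E →L[ℝ] E →L[ℝ] E) {ρ : ℝ}
    (hρ : 0 < ρ) (h : 2 * ‖T‖ * ρ ^ 2 ≤ 1) :
    HasFPowerSeriesOnBall (flowMap T) (flowSeries T) 0 (ENNReal.ofReal ρ) := by
  have hr : ENNReal.ofReal ρ ≤ (flowSeries T).radius := by
    refine (flowSeries T).le_radius_of_bound ρ (r := ρ.toNNReal) fun n => ?_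
    rw [Real.coe_toNNReal _ hρ.le]
    exact norm_flowSeries_mul_pow_le T hρ.le h n
  have hpos : 0 < ENNReal.ofReal ρ := by simpa using hρ
  exact ((flowSeries T).hasFPowerSeriesOnBall (hpos.trans_le hr)).mono hpos hr

/-- A solution of `z' = T z z z` in the ball of radius `ρ`, on the time interval `(-1, 2)`. -/
def IsFlowCurve (T : E →L[ℝ] E →L[ℝ] E →L[ℝ] E) (ρ : ℝ) (c : ℝ → E) : Prop :=
  -- The interval contains `[0, 1]` in its interior and is symmetric about `1/2`, as time reversal
  -- `t ↦ 1 - t` requires.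
  ∀ t ∈ Set.Ioo (-1 : ℝ) 2, HasDerivAt c (T (c t) (c t) (c t)) t ∧ ‖c t‖ ≤ ρ

/-- Summation of the Taylor series of a function from the bounds of its derivatives. -/
theorem hasSum_taylor_of_bound {F : Type*} [NormedAddCommGroup F] [NormedSpace ℝ F]
    [CompleteSpace F] {f : ℕ → ℝ → F} {B ρ : ℝ} (hρ0 : 0 ≤ ρ) (hρ : ρ < 1)
    (hf : ∀ k, ∀ t ∈ Set.Icc (0 : ℝ) 1, HasDerivAt (f k) (f (k + 1) t) t)
    (hb : ∀ k, ∀ t ∈ Set.Icc (0 : ℝ) 1, ‖f k t‖ ≤ B * k.factorial * ρ ^ k) :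
    HasSum (fun k => ((k.factorial : ℝ)⁻¹) • f k 0) (f 0 1) := by
  have hB : 0 ≤ B := by
    have := hb 0 0 (by simp)
    simpa using (norm_nonneg _).trans this
  -- The Taylor polynomial based at `t`, evaluated at time 1. Its derivative telescopes to the
  -- single term of order `n + 1`; it runs from the Taylor sum at `t = 0` to `f 0 1` at `t = 1`.
  set u : ℕ → ℝ → F := fun n t =>
    ∑ k ∈ Finset.range (n + 1), (((k.factorial : ℝ)⁻¹) * (1 - t) ^ k) • f k t with hu
  have hder : ∀ n, ∀ t ∈ Set.Icc (0 : ℝ) 1,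
      HasDerivAt (u n) ((((n.factorial : ℝ)⁻¹) * (1 - t) ^ n) • f (n + 1) t) t := by
    intro n t ht
    induction n with
    | zero => simpa [hu] using hf 0 t ht
    | succ n ih =>
      have h1 : u (n + 1) = fun t => u n t +
          ((((n + 1).factorial : ℝ)⁻¹) * (1 - t) ^ (n + 1)) • f (n + 1) t := by
        funext t; simp only [hu]; rw [Finset.sum_range_succ]
      rw [h1]
      have h2 : HasDerivAt (fun t : ℝ => (((n + 1).factorial : ℝ)⁻¹) * (1 - t) ^ (n + 1))
          (-((n.factorial : ℝ)⁻¹ * (1 - t) ^ n)) t := by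
        have := ((((hasDerivAt_id t).const_sub 1).pow (n + 1)).const_mul
          (((n + 1).factorial : ℝ)⁻¹))
        convert! this using 1
        simp only [Nat.factorial_succ, id, Nat.add_sub_cancel]
        push_cast
        field_simp
      convert! ih.add (h2.smul (hf (n + 1) t ht)) using 1
      module
  have hbd : ∀ n, ‖f 0 1 - ∑ k ∈ Finset.range (n + 1), ((k.factorial : ℝ)⁻¹) • f k 0‖
      ≤ B * (((n + 1 : ℕ) : ℝ) * ρ ^ (n + 1)) := by
    intro n
    have h := norm_image_sub_le_of_norm_deriv_le_segment_01' (f := u n)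
      (f' := fun t => (((n.factorial : ℝ)⁻¹) * (1 - t) ^ n) • f (n + 1) t)
      (C := B * (((n + 1 : ℕ) : ℝ) * ρ ^ (n + 1)))
      (fun t ht => (hder n t ht).hasDerivWithinAt) ?_
    · have e1 : u n 1 = f 0 1 := by
        simp only [hu]
        rw [Finset.sum_range_succ']
        simp
      have e0 : u n 0 = ∑ k ∈ Finset.range (n + 1), ((k.factorial : ℝ)⁻¹) • f k 0 := by
        simp [hu]
      rwa [e1, e0] at h
    · intro t ht
      rw [norm_smul]
      have h1 := hb (n + 1) t ⟨ht.1, ht.2.le⟩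
      have h2 : ‖((n.factorial : ℝ)⁻¹) * (1 - t) ^ n‖ ≤ (n.factorial : ℝ)⁻¹ := by
        have h0 : 0 ≤ 1 - t := by linarith [ht.2]
        rw [Real.norm_of_nonneg (by positivity)]
        have : (1 - t) ^ n ≤ 1 := pow_le_one₀ h0 (by linarith [ht.1])
        exact mul_le_of_le_one_right (by positivity) this
      calc _ ≤ (n.factorial : ℝ)⁻¹ * (B * (n + 1).factorial * ρ ^ (n + 1)) := by gcongr
        _ = _ := by
          rw [Nat.factorial_succ]; push_cast; field_simp
  have hsum : Summable (fun k => ((k.factorial : ℝ)⁻¹) • f k 0) := by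
    refine Summable.of_norm_bounded (g := fun k => B * ρ ^ k)
      ((summable_geometric_of_lt_one hρ0 hρ).mul_left B) fun k => ?_
    rw [norm_smul, norm_inv, Real.norm_natCast]
    have := hb k 0 (by simp)
    calc _ ≤ (k.factorial : ℝ)⁻¹ * (B * k.factorial * ρ ^ k) := by gcongr
      _ = _ := by field_simp
  have ht : Filter.Tendsto (fun n => B * (((n + 1 : ℕ) : ℝ) * ρ ^ (n + 1))) Filter.atTop (nhds 0) := by
    have := (tendsto_self_mul_const_pow_of_lt_one hρ0 hρ).comp (Filter.tendsto_add_atTop_nat 1)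
    simpa using this.const_mul B
  have h1 := squeeze_zero_norm hbd ht
  have h2 := (hsum.hasSum.tendsto_sum_nat).comp (Filter.tendsto_add_atTop_nat 1)
  have h3 : Filter.Tendsto (fun n => ∑ k ∈ Finset.range (n + 1), ((k.factorial : ℝ)⁻¹) • f k 0)
      Filter.atTop (nhds (f 0 1)) := by
    have := h1.const_sub (f 0 1)
    simpa using this
  rw [tendsto_nhds_unique h3 h2]
  exact hsum.hasSum

end Flow

/-! ### Trajectories of a cubic field -/

section FlowCurves

set_option maxSynthPendingDepth 3

variable {E : Type*} [NormedAddCommGroup E] [NormedSpace ℝ E]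

theorem norm_flowSeries_odd_le (T : E →L[ℝ] E →L[ℝ] E →L[ℝ] E) (k : ℕ) :
    ‖flowSeries T (2 * k + 1)‖ ≤ (2 * ‖T‖) ^ k := by
  induction k with
  | zero =>
    change ‖(continuousMultilinearCurryFin1 ℝ E E).symm (ContinuousLinearMap.id ℝ E)‖ ≤ _
    rw [LinearIsometryEquiv.norm_map, pow_zero]
    exact ContinuousLinearMap.norm_id_le
  | succ k ih =>
    calc _ ≤ 2 * ‖T‖ * ‖flowSeries T (2 * k + 1)‖ := norm_flowSeries_add_two_le T (2 * k + 1)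
      _ ≤ 2 * ‖T‖ * (2 * ‖T‖) ^ k := by gcongr
      _ = _ := by ring

/-- Along a trajectory, the derivative of `L^k id / k!` is `L^(k+1) id / k!`, which is `k + 1` times
the next term of the series. -/
theorem hasDerivAt_flowSeries_odd (T : E →L[ℝ] E →L[ℝ] E →L[ℝ] E) {c : ℝ → E} {t : ℝ}
    (hc : HasDerivAt c (T (c t) (c t) (c t)) t) (k : ℕ) :
    HasDerivAt (fun t => flowSeries T (2 * k + 1) fun _ => c t)
      (((k : ℝ) + 1) • flowSeries T (2 * (k + 1) + 1) fun _ => c t) t := by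
  have h1 := ((flowSeries T (2 * k + 1)).hasFDerivAt (fun _ => c t)).comp_hasDerivAt t
    (hasDerivAt_pi.2 fun _ => hc : HasDerivAt (fun s (_ : Fin (2 * k + 1)) => c s)
      (fun _ => T (c t) (c t) (c t)) t)
  have h2 : flowSeries T (2 * (k + 1) + 1) =
    (2 / (((2 * k + 1 : ℕ) : ℝ) + 1)) • lieStep T (flowSeries T (2 * k + 1)) := rfl
  convert! h1 using 1
  rw [h2]
  change ((k : ℝ) + 1) • ((2 / (((2 * k + 1 : ℕ) : ℝ) + 1)) •
    lieStep T (flowSeries T (2 * k + 1)) (fun _ => c t)) = _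
  rw [lieStep_diag, smul_smul, ContinuousMultilinearMap.linearDeriv_apply]
  have : ((k : ℝ) + 1) * (2 / (((2 * k + 1 : ℕ) : ℝ) + 1)) = 1 := by
    push_cast; field_simp; ring
  rw [this, one_smul]

theorem flowSeries_one_apply (T : E →L[ℝ] E →L[ℝ] E →L[ℝ] E) (z : E) :
    flowSeries T 1 (fun _ => z) = z := rfl

/-- The functions `k! • flowSeries T (2k+1)` along `c` are the successive derivatives of `c`, so the
Taylor series of `c` from time 0 to time 1 is the flow series at `c 0`. In particular the endpoint
depends on `c 0` only. -/
theorem IsFlowCurve.flowMap_eq [CompleteSpace E] {T : E →L[ℝ] E →L[ℝ] E →L[ℝ] E} {ρ : ℝ}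
    {c : ℝ → E} (hc : IsFlowCurve T ρ c) (h : 2 * ‖T‖ * ρ ^ 2 < 1) :
    flowMap T (c 0) = c 1 := by
  have hρ : 0 ≤ ρ := (norm_nonneg _).trans (hc 0 (by norm_num)).2
  have hI : ∀ t ∈ Set.Icc (0 : ℝ) 1, t ∈ Set.Ioo (-1 : ℝ) 2 := fun t ht =>
    ⟨by linarith [ht.1], by linarith [ht.2]⟩
  set f : ℕ → ℝ → E := fun k t => (k.factorial : ℝ) • flowSeries T (2 * k + 1) fun _ => c t
    with hf
  have hder : ∀ k, ∀ t ∈ Set.Icc (0 : ℝ) 1, HasDerivAt (f k) (f (k + 1) t) t := by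
    intro k t ht
    have := (hasDerivAt_flowSeries_odd T (hc t (hI t ht)).1 k).const_smul (k.factorial : ℝ)
    rw [smul_smul] at this
    have e : f (k + 1) t = ((k.factorial : ℝ) * ((k : ℝ) + 1)) •
        flowSeries T (2 * (k + 1) + 1) fun _ => c t := by
      simp only [hf]
      rw [Nat.factorial_succ, Nat.cast_mul, Nat.cast_succ, mul_comm]
    rw [e]
    exact this
  have hbound : ∀ k, ∀ t ∈ Set.Icc (0 : ℝ) 1,
      ‖f k t‖ ≤ ρ * k.factorial * (2 * ‖T‖ * ρ ^ 2) ^ k := by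
    intro k t ht
    simp only [hf]
    rw [norm_smul, Real.norm_natCast]
    have h1 := (flowSeries T (2 * k + 1)).le_opNorm (fun _ => c t)
    rw [Finset.prod_const, Finset.card_univ, Fintype.card_fin] at h1
    have h2 := norm_flowSeries_odd_le T k
    have h3 := (hc t (hI t ht)).2
    calc _ ≤ (k.factorial : ℝ) * ((2 * ‖T‖) ^ k * ρ ^ (2 * k + 1)) := by
          gcongr
          exact h1.trans (by gcongr)
      _ = _ := by ring
  have hs := hasSum_taylor_of_bound (by positivity) h hder hbound
  have h1 : HasSum (fun k => flowSeries T (2 * k + 1) fun _ => c 0) (c 1) := by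
    have e1 : f 0 1 = c 1 := by
      simp only [hf, Nat.factorial_zero, Nat.cast_one, one_smul]
      exact flowSeries_one_apply T (c 1)
    have e2 : (fun k => ((k.factorial : ℝ)⁻¹) • f k 0) =
        fun k => flowSeries T (2 * k + 1) fun _ => c 0 := by
      funext k
      simp only [hf]
      rw [smul_smul, inv_mul_cancel₀ (by positivity), one_smul]
    rwa [e1, e2] at hs
  have h0 : HasSum (fun k => flowSeries T (2 * k) fun _ => c 0) 0 := by
    have : (fun k => flowSeries T (2 * k) fun _ => c 0) = fun _ => 0 := by
      funext k
      rw [flowSeries_even]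
      rfl
    rw [this]
    exact hasSum_zero
  have := HasSum.even_add_odd (f := fun n => flowSeries T n fun _ => c 0) h0 h1
  rw [zero_add] at this
  exact this.tsum_eq

theorem IsFlowCurve.reverse {T : E →L[ℝ] E →L[ℝ] E →L[ℝ] E} {ρ : ℝ} {c : ℝ → E}
    (hc : IsFlowCurve T ρ c) : IsFlowCurve (-T) ρ (fun t => c (1 - t)) := by
  intro t ht
  obtain ⟨h1, h2⟩ := hc (1 - t) ⟨by linarith [ht.2], by linarith [ht.1]⟩
  refine ⟨?_, h2⟩
  have := h1.scomp t ((hasDerivAt_id t).const_sub 1)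
  convert! this using 1
  simp

/-- Homogeneity of degree three: scaling space by `a` amounts to scaling time by `a²`. The
restriction to `[0, 1]` keeps the time interval and the ball. -/
theorem IsFlowCurve.scale {T : E →L[ℝ] E →L[ℝ] E →L[ℝ] E} {ρ : ℝ} {c : ℝ → E}
    (hc : IsFlowCurve T ρ c) {a : ℝ} (ha : a ∈ Set.Icc (0 : ℝ) 1) :
    IsFlowCurve T ρ (fun t => a • c (a ^ 2 * t)) := by
  intro t ht
  have ha2 : a ^ 2 ≤ 1 := pow_le_one₀ ha.1 ha.2
  have ha3 : 0 ≤ a ^ 2 := sq_nonneg a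
  obtain ⟨h1, h2⟩ := hc (a ^ 2 * t) ⟨by nlinarith [ht.1, ht.2], by nlinarith [ht.1, ht.2]⟩
  constructor
  · have := (h1.scomp t ((hasDerivAt_id t).const_mul (a ^ 2))).const_smul a
    convert! this using 1
    simp [smul_smul]
    ring_nf
  · rw [norm_smul, Real.norm_of_nonneg ha.1]
    have := norm_nonneg (c (a ^ 2 * t))
    nlinarith [ha.2]

theorem norm_cubic_le (T : E →L[ℝ] E →L[ℝ] E →L[ℝ] E) {x : E} {ρ : ℝ} (hx : ‖x‖ ≤ ρ) :
    ‖T x x x‖ ≤ ‖T‖ * ρ ^ 3 := by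
  have hρ : 0 ≤ ρ := (norm_nonneg _).trans hx
  have h1 := (T x x).le_opNorm x
  have h2 := T.le_opNorm₂ x x
  calc ‖T x x x‖ ≤ ‖T‖ * ‖x‖ * ‖x‖ * ‖x‖ := h1.trans (by gcongr)
    _ ≤ ‖T‖ * ρ * ρ * ρ := by gcongr
    _ = _ := by ring

theorem lipschitzOnWith_cubic (T : E →L[ℝ] E →L[ℝ] E →L[ℝ] E) {s : Set E} {ρ : ℝ}
    (hs : ∀ x ∈ s, ‖x‖ ≤ ρ) :
    LipschitzOnWith (3 * ‖T‖ * ρ ^ 2).toNNReal (fun x => T x x x) s := by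
  refine LipschitzOnWith.of_dist_le_mul fun x hx y hy => ?_
  rw [Real.coe_toNNReal _ (by positivity), dist_eq_norm, dist_eq_norm]
  have e : T x x x - T y y y = T (x - y) x x + T y (x - y) x + T y y (x - y) := by
    simp
  have tri : ∀ a b d : E, ‖T a b d‖ ≤ ‖T‖ * ‖a‖ * ‖b‖ * ‖d‖ := fun a b d =>
    ((T a b).le_opNorm d).trans (by gcongr; exact T.le_opNorm₂ a b)
  have hx' := hs x hx
  have hy' := hs y hy
  have hρ : 0 ≤ ρ := (norm_nonneg _).trans hx'
  rw [e]
  calc _ ≤ ‖T (x - y) x x‖ + ‖T y (x - y) x‖ + ‖T y y (x - y)‖ := norm_add₃_le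
    _ ≤ ‖T‖ * ‖x - y‖ * ‖x‖ * ‖x‖ + ‖T‖ * ‖y‖ * ‖x - y‖ * ‖x‖ + ‖T‖ * ‖y‖ * ‖y‖ * ‖x - y‖ := by
      gcongr <;> exact tri _ _ _
    _ ≤ ‖T‖ * ‖x - y‖ * ρ * ρ + ‖T‖ * ρ * ‖x - y‖ * ρ + ‖T‖ * ρ * ρ * ‖x - y‖ := by gcongr
    _ = _ := by ring

/-- During a time of at most 2, at speed at most `‖T‖ (11ρ/10)³`, a point moves by at most `2.662
‖T‖ ρ³`. This is below `ρ/10` when `26.62 ‖T‖ ρ² ≤ 1`, whence the constants 27 and `11/10`. -/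
theorem exists_isFlowCurve [CompleteSpace E] (T : E →L[ℝ] E →L[ℝ] E →L[ℝ] E) {ρ : ℝ}
    (hρ : 0 < ρ) (h : 27 * ‖T‖ * ρ ^ 2 ≤ 1) {z : E} (hz : ‖z‖ ≤ ρ) :
    ∃ c : ℝ → E, c 0 = z ∧ IsFlowCurve T (11 / 10 * ρ) c := by
  have hball : ∀ x ∈ Metric.closedBall z (ρ / 10), ‖x‖ ≤ 11 / 10 * ρ := by
    intro x hx
    rw [mem_closedBall_iff_norm] at hx
    have := norm_add_le (x - z) z
    rw [sub_add_cancel] at this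
    linarith
  have hpl : IsPicardLindelof (fun _ x => T x x x) (tmin := -1) (tmax := 2)
      ⟨0, by norm_num⟩ z (ρ / 10).toNNReal 0 (‖T‖ * (11 / 10 * ρ) ^ 3).toNNReal
      (3 * ‖T‖ * (11 / 10 * ρ) ^ 2).toNNReal := by
    refine IsPicardLindelof.of_time_independent ?_ ?_ ?_
    · intro x hx
      rw [Real.coe_toNNReal _ (by positivity)] at hx ⊢
      exact norm_cubic_le T (hball x hx)
    · rw [Real.coe_toNNReal _ (by positivity)]
      exact lipschitzOnWith_cubic T hball
    · rw [Real.coe_toNNReal _ (by positivity), Real.coe_toNNReal _ (by positivity)]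
      have : max ((2 : ℝ) - 0) (0 - -1) = 2 := by norm_num
      simp only [this, NNReal.coe_zero]
      nlinarith
  -- The fixed point of the Picard operator itself is kept, because its membership in the space of
  -- curves confines it to the ball at all times.
  obtain ⟨α, hα⟩ := ODE.FunSpace.exists_isFixedPt_next hpl (Metric.mem_closedBall_self le_rfl)
  have hmem : ∀ t, α.compProj t ∈ Metric.closedBall z (ρ / 10) := by
    intro t
    have := α.compProj_mem_closedBall hpl.mul_max_le (t := t)
    rwa [Real.coe_toNNReal _ (by positivity)] at this
  refine ⟨α.compProj, ?_, fun t ht => ⟨?_, hball _ (hmem t)⟩⟩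
  · have := ODE.FunSpace.compProj_val (α := α) (t := ⟨0, by norm_num⟩)
    nth_rw 2 [← hα] at this
    rwa [ODE.FunSpace.next_apply₀] at this
  · have hw : HasDerivWithinAt α.compProj
        (T (α.compProj t) (α.compProj t) (α.compProj t)) (Set.Icc (-1) 2) t := by
      refine (ODE.hasDerivWithinAt_picard_Icc (by norm_num : (0 : ℝ) ∈ Set.Icc (-1 : ℝ) 2)
        hpl.continuousOn_uncurry α.continuous_compProj.continuousOn
        (fun _ _ => α.compProj_mem_closedBall hpl.mul_max_le) z
        (Set.Ioo_subset_Icc_self ht)).congr_of_mem ?_ (Set.Ioo_subset_Icc_self ht)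
      intro t' ht'
      nth_rw 1 [← hα]
      rw [ODE.FunSpace.compProj_of_mem ht', ODE.FunSpace.next_apply]
    exact hw.hasDerivAt (Icc_mem_nhds ht.1 ht.2)

/-- The derivative of the cubic field `z ↦ T z z z` in the direction `u`. -/
theorem hasFDerivAt_cubic (T : E →L[ℝ] E →L[ℝ] E →L[ℝ] E) (z : E) :
    ∃ D : E →L[ℝ] E, HasFDerivAt (fun x => T x x x) D z ∧
      ∀ u, D u = T u z z + T z u z + T z z u := by
  have h1 : HasFDerivAt (fun x => T x) T z := T.hasFDerivAt
  have h2 := (h1.clm_apply (hasFDerivAt_id z)).clm_apply (hasFDerivAt_id z)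
  refine ⟨_, h2, fun u => ?_⟩
  simp
  abel

/-! ### The time-one map on a ball: closeness to the identity, inverse, Euler's relation, invariance
of a form -/

section Ball

variable [CompleteSpace E] {T : E →L[ℝ] E →L[ℝ] E →L[ℝ] E} {ρ : ℝ}

theorem exists_isFlowCurve_flowMap (hρ : 0 < ρ) (h : 27 * ‖T‖ * ρ ^ 2 ≤ 1) {z : E}
    (hz : ‖z‖ ≤ ρ) :
    ∃ c : ℝ → E, c 0 = z ∧ c 1 = flowMap T z ∧ IsFlowCurve T (11 / 10 * ρ) c := by
  obtain ⟨c, h0, hc⟩ := exists_isFlowCurve T hρ h hz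
  refine ⟨c, h0, ?_, hc⟩
  have := hc.flowMap_eq (by nlinarith [mul_nonneg (norm_nonneg T) (sq_nonneg ρ)])
  rw [← this, h0]

theorem norm_flowMap_sub_le (hρ : 0 < ρ) (h : 27 * ‖T‖ * ρ ^ 2 ≤ 1) {z : E} (hz : ‖z‖ ≤ ρ) :
    ‖flowMap T z - z‖ ≤ ‖T‖ * (11 / 10 * ρ) ^ 3 := by
  obtain ⟨c, h0, h1, hc⟩ := exists_isFlowCurve_flowMap hρ h hz
  rw [← h1, ← h0]
  have hI : ∀ t ∈ Set.Icc (0 : ℝ) 1, t ∈ Set.Ioo (-1 : ℝ) 2 := fun t ht =>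
    ⟨by linarith [ht.1], by linarith [ht.2]⟩
  exact norm_image_sub_le_of_norm_deriv_le_segment_01'
    (fun t ht => (hc t (hI t ht)).1.hasDerivWithinAt)
    (fun t ht => norm_cubic_le T (hc t (hI t ⟨ht.1, ht.2.le⟩)).2)

/-- The reversed trajectory leads from `flowMap T z` to `z` under `-T`. Only the bound `11/10 * ρ`
along the curve is needed, so `flowMap T z` may lie outside the ball of radius `ρ`. -/
theorem flowMap_neg_flowMap (hρ : 0 < ρ) (h : 27 * ‖T‖ * ρ ^ 2 ≤ 1) {z : E} (hz : ‖z‖ ≤ ρ) :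
    flowMap (-T) (flowMap T z) = z := by
  obtain ⟨c, h0, h1, hc⟩ := exists_isFlowCurve_flowMap hρ h hz
  have := hc.reverse.flowMap_eq (by
    rw [norm_neg]; nlinarith [mul_nonneg (norm_nonneg T) (sq_nonneg ρ)])
  simp only [sub_zero, sub_self, h0, h1] at this
  exact this

/-- Since `2 · 3² ≤ 27`, the series converges well beyond radius `ρ`, which gives analyticity on a
neighbourhood of the closed ball. -/
theorem hasFPowerSeriesOnBall_flowMap_three (hρ : 0 < ρ) (h : 27 * ‖T‖ * ρ ^ 2 ≤ 1) :
    HasFPowerSeriesOnBall (flowMap T) (flowSeries T) 0 (ENNReal.ofReal (3 * ρ)) :=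
  hasFPowerSeriesOnBall_flowMap T (by positivity)
    (by nlinarith [mul_nonneg (norm_nonneg T) (sq_nonneg ρ)])

theorem analyticAt_flowMap (hρ : 0 < ρ) (h : 27 * ‖T‖ * ρ ^ 2 ≤ 1) {z : E} (hz : ‖z‖ ≤ ρ) :
    AnalyticAt ℝ (flowMap T) z := by
  refine (hasFPowerSeriesOnBall_flowMap_three hρ h).analyticAt_of_mem ?_
  rw [Metric.mem_eball, edist_zero_right, ← ofReal_norm, ENNReal.ofReal_lt_ofReal_iff (by positivity)]
  linarith

theorem fderiv_flowMap_zero (hρ : 0 < ρ) (h : 27 * ‖T‖ * ρ ^ 2 ≤ 1) :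
    fderiv ℝ (flowMap T) 0 = ContinuousLinearMap.id ℝ E := by
  rw [(hasFPowerSeriesOnBall_flowMap_three hρ h).hasFPowerSeriesAt.fderiv_eq]
  exact (continuousMultilinearCurryFin1 ℝ E E).apply_symm_apply _

/-- Euler's relation for the flow of a cubic field. -/
theorem fderiv_flowMap_self (hρ : 0 < ρ) (h : 27 * ‖T‖ * ρ ^ 2 ≤ 1) {z : E} (hz : ‖z‖ ≤ ρ) :
    fderiv ℝ (flowMap T) z z =
      flowMap T z + (2 : ℝ) • T (flowMap T z) (flowMap T z) (flowMap T z) := by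
  obtain ⟨c, h0, h1, hc⟩ := exists_isFlowCurve_flowMap hρ h hz
  have hlt : 2 * ‖T‖ * (11 / 10 * ρ) ^ 2 < 1 := by
    nlinarith [mul_nonneg (norm_nonneg T) (sq_nonneg ρ)]
  -- Euler's relation is the derivative of this identity at `a = 1`, taken within `[0, 1]` because
  -- the scaling is available only there.
  have heq : ∀ a ∈ Set.Icc (0 : ℝ) 1, flowMap T (a • z) = a • c (a ^ 2) := by
    intro a ha
    have := (hc.scale ha).flowMap_eq hlt
    simpa [h0] using this
  have hL : HasDerivAt (fun a : ℝ => flowMap T (a • z)) (fderiv ℝ (flowMap T) z z) 1 := by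
    have hd : HasDerivAt (fun a : ℝ => a • z) z 1 := by
      simpa using (hasDerivAt_id (1 : ℝ)).smul_const z
    have hf : HasFDerivAt (flowMap T) (fderiv ℝ (flowMap T) z) ((1 : ℝ) • z) := by
      rw [one_smul]
      exact (analyticAt_flowMap hρ h hz).differentiableAt.hasFDerivAt
    exact hf.comp_hasDerivAt 1 hd
  have hR : HasDerivAt (fun a : ℝ => a • c (a ^ 2))
      (c 1 + (2 : ℝ) • T (c 1) (c 1) (c 1)) 1 := by
    have h2 : HasDerivAt (fun a : ℝ => a ^ 2) (2 : ℝ) (1 : ℝ) := by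
      simpa using hasDerivAt_pow 2 (1 : ℝ)
    have h3 : HasDerivAt c (T (c 1) (c 1) (c 1)) ((1 : ℝ) ^ 2) := by
      rw [one_pow]
      exact (hc 1 (by norm_num)).1
    have := (hasDerivAt_id (1 : ℝ)).smul (HasDerivAt.scomp (h := fun a : ℝ => a ^ 2) 1 h3 h2)
    convert! this using 1
    simp [add_comm]
  have hU : UniqueDiffWithinAt ℝ (Set.Icc (0 : ℝ) 1) 1 :=
    uniqueDiffOn_Icc zero_lt_one 1 (by norm_num)
  have := hU.eq_deriv _ (hL.hasDerivWithinAt)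
    (hR.hasDerivWithinAt.congr heq (heq 1 (by norm_num)))
  rw [this, h1]

/-- Write `X` for the cubic field and `Ψ` for its time-one map. Differentiating Euler's relation
gives `D²Ψ(y)(y, x) = 2 DX(Ψ y) (DΨ(y) x)`. Hence the derivative in `s` of the pulled-back form at
`s • z` is `2/s` times the expression that `hΩ` annihilates, and at `s = 0` the form is the original
one. -/
theorem flowMap_symplectic {F : Type*} [NormedAddCommGroup F] [NormedSpace ℝ F]
    (Ω : E →L[ℝ] E →L[ℝ] F)
    (hΩ : ∀ z u v : E, Ω (T u z z + T z u z + T z z u) v +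
      Ω u (T v z z + T z v z + T z z v) = 0)
    (hρ : 0 < ρ) (h : 27 * ‖T‖ * ρ ^ 2 ≤ 1) {z : E} (hz : ‖z‖ < ρ) (u v : E) :
    Ω (fderiv ℝ (flowMap T) z u) (fderiv ℝ (flowMap T) z v) = Ω u v := by
  set Ψ := flowMap T with hΨ
  have han : ∀ y : E, ‖y‖ < ρ → AnalyticAt ℝ Ψ y := fun y hy => analyticAt_flowMap hρ h hy.le
  have hnhds : ∀ y : E, ‖y‖ < ρ → ∀ᶠ x in nhds y, ‖x‖ < ρ := fun y hy =>
    (isOpen_lt continuous_norm continuous_const).mem_nhds hy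
  -- the derivative of Euler's relation
  have hvar : ∀ y : E, ‖y‖ < ρ → ∀ x : E, fderiv ℝ (fderiv ℝ Ψ) y y x =
      (2 : ℝ) • (T (fderiv ℝ Ψ y x) (Ψ y) (Ψ y) + T (Ψ y) (fderiv ℝ Ψ y x) (Ψ y) +
        T (Ψ y) (Ψ y) (fderiv ℝ Ψ y x)) := by
    intro y hy x
    have hΨy := (han y hy).differentiableAt.hasFDerivAt
    have hD := (han y hy).fderiv.differentiableAt.hasFDerivAt
    have hl := hD.clm_apply (hasFDerivAt_id y)
    obtain ⟨D, hD1, hD2⟩ := hasFDerivAt_cubic T (Ψ y)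
    have hr := hΨy.add ((hD1.comp y hΨy).const_smul (2 : ℝ))
    have heq : (fun x => fderiv ℝ Ψ x (id x)) =ᶠ[nhds y]
        (Ψ + (2 : ℝ) • ((fun x => T x x x) ∘ Ψ)) := by
      filter_upwards [hnhds y hy] with x hx
      exact fderiv_flowMap_self hρ h hx.le
    have := hl.unique (hr.congr_of_eventuallyEq heq)
    have hx := DFunLike.congr_fun this x
    have hsym : IsSymmSndFDerivAt ℝ Ψ y :=
      ((han y hy).contDiffAt (n := ⊤)).isSymmSndFDerivAt (by simp)
    simp [hD2] at hx
    rw [hsym y x]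
    simpa using hx
  set g : ℝ → F := fun s => Ω (fderiv ℝ Ψ (s • z) u) (fderiv ℝ Ψ (s • z) v) with hg
  have hsz : ∀ s ∈ Set.Icc (0 : ℝ) 1, ‖s • z‖ < ρ := by
    intro s hs
    rw [norm_smul, Real.norm_of_nonneg hs.1]
    nlinarith [hs.2, norm_nonneg z]
  have hd : ∀ s ∈ Set.Icc (0 : ℝ) 1, HasDerivAt g
      (Ω (fderiv ℝ Ψ (s • z) u) (fderiv ℝ (fderiv ℝ Ψ) (s • z) z v) +
        Ω (fderiv ℝ (fderiv ℝ Ψ) (s • z) z u) (fderiv ℝ Ψ (s • z) v)) s := by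
    intro s hs
    have h1 : HasDerivAt (fun a : ℝ => a • z) z s := by
      simpa using (hasDerivAt_id s).smul_const z
    have h2 := ((han _ (hsz s hs)).fderiv.differentiableAt.hasFDerivAt).comp_hasDerivAt s h1
    have hu := h2.clm_apply (hasDerivAt_const s u)
    have hv := h2.clm_apply (hasDerivAt_const s v)
    have h3 := (Ω.hasFDerivAt.comp_hasDerivAt s hu).clm_apply hv
    convert! h3 using 1
    simp [add_comm]
  -- The division by `s` excludes the origin; constancy on `(0, 1]` is carried to `s = 0` by
  -- continuity of `g`.
  have hzero : ∀ s ∈ Set.Ioc (0 : ℝ) 1, HasDerivAt g 0 s := by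
    intro s hs
    have hs' : s ∈ Set.Icc (0 : ℝ) 1 := ⟨hs.1.le, hs.2⟩
    convert! hd s hs' using 1
    have hvar' : ∀ x, fderiv ℝ (fderiv ℝ Ψ) (s • z) z x = s⁻¹ • (2 : ℝ) •
        (T (fderiv ℝ Ψ (s • z) x) (Ψ (s • z)) (Ψ (s • z)) +
          T (Ψ (s • z)) (fderiv ℝ Ψ (s • z) x) (Ψ (s • z)) +
          T (Ψ (s • z)) (Ψ (s • z)) (fderiv ℝ Ψ (s • z) x)) := by
      intro x
      rw [← hvar (s • z) (hsz s hs') x, map_smul, smul_apply, smul_smul,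
        inv_mul_cancel₀ hs.1.ne', one_smul]
    rw [hvar', hvar']
    have := hΩ (Ψ (s • z)) (fderiv ℝ Ψ (s • z) u) (fderiv ℝ Ψ (s • z) v)
    simp only [map_smul, smul_apply]
    rw [← smul_add, ← smul_add, add_comm, this, smul_zero, smul_zero]
  have hconst : ∀ ε ∈ Set.Ioc (0 : ℝ) 1, g 1 = g ε := by
    intro ε hε
    have hmem : ∀ s ∈ Set.Icc ε 1, s ∈ Set.Ioc (0 : ℝ) 1 := fun s hs => ⟨hε.1.trans_le hs.1, hs.2⟩
    exact constant_of_has_deriv_right_zero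
      (fun s hs => (hzero s (hmem s hs)).continuousAt.continuousWithinAt)
      (fun s hs => (hzero s (hmem s ⟨hs.1, hs.2.le⟩)).hasDerivWithinAt) 1 ⟨hε.2, le_rfl⟩
  have hlim : Filter.Tendsto g (nhdsWithin 0 (Set.Ioi 0)) (nhds (g 0)) :=
    (hd 0 (by norm_num)).continuousAt.tendsto.mono_left nhdsWithin_le_nhds
  have hlim' : Filter.Tendsto g (nhdsWithin 0 (Set.Ioi 0)) (nhds (g 1)) := by
    refine tendsto_const_nhds.congr' ?_
    filter_upwards [Ioc_mem_nhdsGT (zero_lt_one' ℝ)] with ε hε using hconst ε hε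
  have h01 := tendsto_nhds_unique hlim' hlim
  simp only [hg, one_smul, zero_smul, hΨ] at h01
  rw [h01, fderiv_flowMap_zero hρ h]
  rfl

end Ball

end FlowCurves

/-! ### The space `h_w` -/

section Space

variable {w : BeamWeight}

theorem BeamSpace.ext {x y : BeamSpace w} (h : ∀ j, x j = y j) : x = y :=
  Subtype.ext (funext h)

theorem BeamSpace.summable (z : BeamSpace w) :
    Summable fun j : ℕ+ => w.val j ^ 2 * ‖z j‖ ^ 2 := z.2

theorem BeamSpace.add_apply (x y : BeamSpace w) (j : ℕ+) : (x + y) j = x j + y j := rfl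

theorem BeamSpace.real_smul_apply (c : ℝ) (x : BeamSpace w) (j : ℕ+) :
    (c • x) j = (c : ℂ) * x j := rfl

theorem BeamSpace.norm_toL2 (z : BeamSpace w) : ‖BeamSpace.toL2 w z‖ = ‖z‖ := rfl

theorem BeamSpace.weight_mul_norm_apply_le (z : BeamSpace w) (j : ℕ+) :
    w.val j * ‖z j‖ ≤ ‖z‖ := by
  have h : (w.val j * ‖z j‖) ^ 2 ≤ ‖z‖ ^ 2 := by
    rw [BeamSpace.norm_sq, mul_pow]
    exact z.summable.le_tsum j fun i _ => by positivity
  exact le_of_sq_le_sq h (norm_nonneg _)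
where
  le_of_sq_le_sq {a b : ℝ} (h : a ^ 2 ≤ b ^ 2) (hb : 0 ≤ b) : a ≤ b :=
    (abs_le_of_sq_le_sq' h hb).2

instance : CompleteSpace (BeamSpace w) := by
  have hi : Isometry (BeamSpace.toL2 w) :=
    AddMonoidHomClass.isometry_of_norm (BeamSpace.toL2 w) BeamSpace.norm_toL2
  have hs : Function.Surjective (BeamSpace.toL2 w) := by
    intro y
    have hw : ∀ j, ((w.val j : ℝ) : ℂ) ≠ 0 := fun j => Complex.ofReal_ne_zero.2 (w.pos j).ne'
    have he : (fun j => ((w.val j : ℝ) : ℂ) * (((w.val j : ℝ) : ℂ)⁻¹ * y j)) = fun j => y j := by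
      funext j
      rw [mul_inv_cancel_left₀ (hw j)]
    refine ⟨⟨fun j => ((w.val j : ℝ) : ℂ)⁻¹ * y j, ?_⟩, ?_⟩
    · refine (beam_memlp_iff w _).1 ?_
      rw [he]
      exact lp.memℓp y
    · ext j
      exact congrFun he j
  exact (IsometryEquiv.mk (Equiv.ofBijective _ ⟨BeamSpace.toL2_injective w, hs⟩) hi).completeSpace

/-- The sequence `u`, as a point of `h_w`, when it is dominated by a point of `h_w`. -/
def BeamSpace.ofBound (u : ℕ+ → ℂ) (C : ℝ) (v : BeamSpace w) (h : ∀ j, ‖u j‖ ≤ C * ‖v j‖) :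
    BeamSpace w :=
  ⟨u, by
    refine Summable.of_nonneg_of_le (fun j => by positivity) (fun j => ?_) (v.summable.mul_left (C ^ 2))
    calc w.val j ^ 2 * ‖u j‖ ^ 2 ≤ w.val j ^ 2 * (C * ‖v j‖) ^ 2 := by gcongr; exact h j
      _ = _ := by ring⟩

theorem BeamSpace.norm_le_of_bound {u v : BeamSpace w} {C : ℝ} (hC : 0 ≤ C)
    (h : ∀ j, ‖u j‖ ≤ C * ‖v j‖) : ‖u‖ ≤ C * ‖v‖ := by
  refine (abs_le_of_sq_le_sq' ?_ (by positivity)).2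
  rw [mul_pow, BeamSpace.norm_sq, BeamSpace.norm_sq, ← tsum_mul_left]
  refine u.summable.tsum_le_tsum (fun j => ?_) (v.summable.mul_left _)
  calc w.val j ^ 2 * ‖u j‖ ^ 2 ≤ w.val j ^ 2 * (C * ‖v j‖) ^ 2 := by gcongr; exact h j
    _ = _ := by ring

/-- The `j`-th coordinate, as a continuous real-linear functional. -/
noncomputable def BeamSpace.coord (j : ℕ+) : BeamSpace w →L[ℝ] ℂ :=
  LinearMap.mkContinuous
    { toFun := fun z => z j
      map_add' := fun _ _ => rfl
      map_smul' := fun _ _ => rfl } (w.val j)⁻¹ fun z => by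
    rw [inv_mul_eq_div, le_div_iff₀ (w.pos j), mul_comm]
    exact z.weight_mul_norm_apply_le j

end Space

/-! ### Frequencies -/

section Frequencies

variable {m : ℝ}

theorem PNat.one_le_cast_real (j : ℕ+) : (1 : ℝ) ≤ j := by
  exact_mod_cast (one_le : 1 ≤ j)

theorem beamOmega_eq (j : ℕ+) :
    beamOmega m j = j * √((j : ℝ) ^ 2 + m) := by
  have hj := PNat.one_le_cast_real j
  have : (j : ℝ) ^ 4 + m * (j : ℝ) ^ 2 = (j : ℝ) ^ 2 * ((j : ℝ) ^ 2 + m) := by ring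
  rw [beamOmega, this, Real.sqrt_mul (by positivity), Real.sqrt_sq (by positivity)]

theorem beamOmega_pos (hm : -1 / 2 ≤ m) (j : ℕ+) : 0 < beamOmega m j := by
  have hj := PNat.one_le_cast_real j
  rw [beamOmega_eq]
  have : 0 < (j : ℝ) ^ 2 + m := by nlinarith
  positivity

theorem beamMu_pos (hm : -1 / 2 ≤ m) : 0 < beamMu m := by
  have h1 : 0 < √(1 + m) := Real.sqrt_pos.2 (by linarith)
  have h2 : 0 < √(4 + m) := Real.sqrt_pos.2 (by linarith)
  exact lt_min (by positivity) (by positivity)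

theorem beamC_pos (hm : -1 / 2 ≤ m) : 0 < beamC m := by
  unfold beamC
  split_ifs
  · norm_num
  · have h1 : 0 < √(1 + m) := Real.sqrt_pos.2 (by linarith)
    positivity

theorem beamMu_le_two_mul_beamOmega (hm : -1 / 2 ≤ m) (j : ℕ+) :
    beamMu m ≤ 2 * beamOmega m j := by
  have hj := PNat.one_le_cast_real j
  refine (min_le_left _ _).trans ?_
  have hj2 : (1 : ℝ) ≤ (j : ℝ) ^ 2 := one_le_pow₀ hj
  have : 0 ≤ ((j : ℝ) ^ 2 - 1) * ((j : ℝ) ^ 2 + 1 + m) :=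
    mul_nonneg (by linarith) (by linarith)
  rw [beamOmega]
  refine mul_le_mul_of_nonneg_left (Real.sqrt_le_sqrt ?_) zero_le_two
  nlinarith

/-- As `√(n² + m)` increases with `n` and `j ≥ 2`, the gap `ω_j - ω_i` is at least `(j - i) √(j² +
m) ≥ √(4 + m)`. -/
theorem beamMu_le_two_mul_sub {i j : ℕ+} (h : i < j) :
    beamMu m ≤ 2 * (beamOmega m j - beamOmega m i) := by
  have hi := PNat.one_le_cast_real i
  have hij : (i : ℝ) + 1 ≤ j := by exact_mod_cast h
  rw [beamOmega_eq, beamOmega_eq]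
  have h1 : √(4 + m) ≤ √((j : ℝ) ^ 2 + m) := Real.sqrt_le_sqrt (by nlinarith)
  have h2 : √((i : ℝ) ^ 2 + m) ≤ √((j : ℝ) ^ 2 + m) := Real.sqrt_le_sqrt (by nlinarith)
  have h3 : 0 ≤ √(4 + m) := Real.sqrt_nonneg _
  have h4 : beamMu m ≤ 3 / 2 * √(4 + m) := min_le_right _ _
  nlinarith [mul_le_mul_of_nonneg_left h2 (by positivity : (0 : ℝ) ≤ i),
    mul_le_mul_of_nonneg_right hij (h3.trans h1)]

theorem beamOmega_injective (hm : -1 / 2 ≤ m) : Function.Injective (beamOmega m) := by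
  intro i j hij
  by_contra hne
  have := beamMu_pos hm
  rcases lt_or_gt_of_ne hne with h | h
  · have := beamMu_le_two_mul_sub (m := m) h; linarith
  · have := beamMu_le_two_mul_sub (m := m) h; linarith

/-- `j² / ω_j`. -/
noncomputable def beamRatio (m : ℝ) (j : ℕ+) : ℝ := (j : ℝ) ^ 2 / beamOmega m j

theorem beamRatio_pos (hm : -1 / 2 ≤ m) (j : ℕ+) : 0 < beamRatio m j := by
  have := beamOmega_pos hm j
  have hj := PNat.one_le_cast_real j
  unfold beamRatio
  positivity

/-- The ratio is `(1 + m/j²)^(-1/2)`: at most 1 for `m ≥ 0`, and largest at `j = 1` for `m < 0`. -/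
theorem beamRatio_le (hm : -1 / 2 ≤ m) (j : ℕ+) : beamRatio m j ≤ beamC m := by
  have hω := beamOmega_pos hm j
  have hj := PNat.one_le_cast_real j
  have hj2 : (1 : ℝ) ≤ (j : ℝ) ^ 2 := one_le_pow₀ hj
  rw [beamRatio, div_le_iff₀ hω, beamC]
  split_ifs with h
  · rw [one_mul, beamOmega]
    refine Real.le_sqrt_of_sq_le ?_
    nlinarith
  · have h1 : 0 < √(1 + m) := Real.sqrt_pos.2 (by linarith)
    rw [one_div, inv_mul_eq_div, le_div_iff₀ h1, beamOmega]
    refine Real.le_sqrt_of_sq_le ?_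
    rw [mul_pow, Real.sq_sqrt (by linarith)]
    push Not at h
    nlinarith [mul_nonneg (sub_nonneg.2 hj2) (sq_nonneg (j : ℝ))]

end Frequencies

/-! ### The norm `|·|_{w⁰}` -/

section Gamma

variable {m : ℝ} {w : BeamWeight}

theorem exists_beamRatio_le_weight (hm : -1 / 2 ≤ m) (w : BeamWeight) :
    ∃ C : ℝ, 0 ≤ C ∧ ∀ j, beamRatio m j ≤ C * w.val j ^ 2 := by
  obtain ⟨c, hc, h⟩ := w.bdd
  have hC := beamC_pos hm
  refine ⟨beamC m / c ^ 2, by positivity, fun j => (beamRatio_le hm j).trans ?_⟩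
  rw [div_mul_eq_mul_div, le_div_iff₀ (by positivity)]
  have := h j
  gcongr

theorem summable_beamRatio_mul_sq (hm : -1 / 2 ≤ m) (z : BeamSpace w) :
    Summable fun j : ℕ+ => beamRatio m j * ‖z j‖ ^ 2 := by
  obtain ⟨C, hC, h⟩ := exists_beamRatio_le_weight hm w
  refine Summable.of_nonneg_of_le (fun j => ?_) (fun j => ?_) (z.summable.mul_left C)
  · have := beamRatio_pos hm j
    positivity
  · rw [← mul_assoc]
    gcongr
    exact h j

theorem normW0_sq (hm : -1 / 2 ≤ m) (z : BeamSpace w) :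
    normW0 m z ^ 2 = ∑' j : ℕ+, beamRatio m j * ‖z j‖ ^ 2 :=
  Real.sq_sqrt (tsum_nonneg fun j => by have := beamRatio_pos hm j; unfold beamRatio at this; positivity)

theorem normW0_nonneg (z : BeamSpace w) : 0 ≤ normW0 m z := Real.sqrt_nonneg _

/-- Needed because `sSup` of an unbounded set is 0 by default; the bound comes from `inf w > 0`. -/
theorem bddAbove_normW0 (hm : -1 / 2 ≤ m) (r : ℝ) :
    BddAbove ((fun z : BeamSpace w => normW0 m z) '' Metric.closedBall 0 r) := by
  obtain ⟨C, hC, h⟩ := exists_beamRatio_le_weight hm w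
  refine ⟨√(C * r ^ 2), ?_⟩
  rintro _ ⟨z, hz, rfl⟩
  rw [mem_closedBall_zero_iff] at hz
  refine Real.le_sqrt_of_sq_le ?_
  rw [normW0_sq hm]
  calc _ ≤ ∑' j, C * (w.val j ^ 2 * ‖z j‖ ^ 2) := by
        refine (summable_beamRatio_mul_sq hm z).tsum_le_tsum (fun j => ?_) (z.summable.mul_left C)
        rw [← mul_assoc]
        gcongr
        exact h j
    _ = C * ‖z‖ ^ 2 := by rw [tsum_mul_left, BeamSpace.norm_sq]
    _ ≤ C * r ^ 2 := by gcongr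

theorem beamGamma_nonneg (hm : -1 / 2 ≤ m) {r : ℝ} (hr : 0 < r) : 0 ≤ beamGamma m w r :=
  (normW0_nonneg (m := m) (0 : BeamSpace w)).trans
    (le_csSup (bddAbove_normW0 hm r) ⟨0, by simp [hr.le], rfl⟩)

theorem normW0_sq_smul (hm : -1 / 2 ≤ m) (t : ℝ) (z : BeamSpace w) :
    normW0 m (t • z) ^ 2 = t ^ 2 * normW0 m z ^ 2 := by
  rw [normW0_sq hm, normW0_sq hm, ← tsum_mul_left]
  refine tsum_congr fun j => ?_
  rw [BeamSpace.real_smul_apply, norm_mul, Complex.norm_real, mul_pow, Real.norm_eq_abs, sq_abs]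
  ring

/-- Homogeneity turns the supremum over the ball into an inequality at every vector. -/
theorem normW0_sq_le (hm : -1 / 2 ≤ m) {r : ℝ} (hr : 0 < r) (z : BeamSpace w) :
    normW0 m z ^ 2 ≤ (beamGamma m w r / r) ^ 2 * ‖z‖ ^ 2 := by
  have hγ := beamGamma_nonneg (m := m) (w := w) hm hr
  rcases eq_or_ne z 0 with rfl | hz
  · have := normW0_sq_smul hm 0 (0 : BeamSpace w)
    rw [zero_smul] at this
    rw [this]
    simp
  have hz' : 0 < ‖z‖ := norm_pos_iff.2 hz
  have hb : normW0 m ((r / ‖z‖) • z) ≤ beamGamma m w r := by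
    refine le_csSup (bddAbove_normW0 hm r) ⟨_, ?_, rfl⟩
    rw [mem_closedBall_zero_iff, norm_smul, Real.norm_of_nonneg (by positivity),
      div_mul_cancel₀ _ hz'.ne']
  have h2 : normW0 m ((r / ‖z‖) • z) ^ 2 ≤ beamGamma m w r ^ 2 := by
    have := normW0_nonneg (m := m) ((r / ‖z‖) • z)
    gcongr
  rw [normW0_sq_smul hm, div_pow, div_mul_eq_mul_div, div_le_iff₀ (by positivity)] at h2
  rw [div_pow, div_mul_eq_mul_div, le_div_iff₀ (by positivity)]
  linarith

theorem summable_beamRatio_mul_mul (hm : -1 / 2 ≤ m) (x y : BeamSpace w) :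
    Summable fun j : ℕ+ => beamRatio m j * (‖x j‖ * ‖y j‖) := by
  refine Summable.of_nonneg_of_le (fun j => ?_) (fun j => ?_)
    ((summable_beamRatio_mul_sq hm x).add (summable_beamRatio_mul_sq hm y))
  · have := beamRatio_pos hm j
    positivity
  · have := beamRatio_pos hm j
    rw [← mul_add]
    gcongr
    nlinarith [sq_nonneg (‖x j‖ - ‖y j‖), sq_nonneg (‖x j‖), sq_nonneg (‖y j‖)]

/-- Cauchy–Schwarz for the weights `j²/ω_j`. -/
theorem tsum_beamRatio_mul_mul_le (hm : -1 / 2 ≤ m) {r : ℝ} (hr : 0 < r) (x y : BeamSpace w) :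
    ∑' j : ℕ+, beamRatio m j * (‖x j‖ * ‖y j‖) ≤ (beamGamma m w r / r) ^ 2 * (‖x‖ * ‖y‖) := by
  have hγ := beamGamma_nonneg (m := m) (w := w) hm hr
  have hcs : (∑' j : ℕ+, beamRatio m j * (‖x j‖ * ‖y j‖)) ≤ normW0 m x * normW0 m y := by
    refine (summable_beamRatio_mul_mul hm x y).tsum_le_of_sum_le fun s => ?_
    refine (abs_le_of_sq_le_sq' ?_ (mul_nonneg (normW0_nonneg x) (normW0_nonneg y))).2
    rw [mul_pow, normW0_sq hm, normW0_sq hm]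
    have h1 := Finset.sum_mul_sq_le_sq_mul_sq s (fun j => √(beamRatio m j) * ‖x j‖)
      (fun j => √(beamRatio m j) * ‖y j‖)
    have e : ∀ j, √(beamRatio m j) ^ 2 = beamRatio m j := fun j =>
      Real.sq_sqrt (beamRatio_pos hm j).le
    have e' : ∀ j, √(beamRatio m j) * ‖x j‖ * (√(beamRatio m j) * ‖y j‖) =
        beamRatio m j * (‖x j‖ * ‖y j‖) := fun j => by
      rw [← e j, Real.sqrt_sq (Real.sqrt_nonneg _)]; ring
    simp only [mul_pow, e, e'] at h1
    refine h1.trans (mul_le_mul ?_ ?_ ?_ ?_)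
    · exact (summable_beamRatio_mul_sq hm x).sum_le_tsum s fun j _ => by
        have := beamRatio_pos hm j; positivity
    · exact (summable_beamRatio_mul_sq hm y).sum_le_tsum s fun j _ => by
        have := beamRatio_pos hm j; positivity
    · exact Finset.sum_nonneg fun j _ => by have := beamRatio_pos hm j; positivity
    · exact tsum_nonneg fun j => by have := beamRatio_pos hm j; positivity
  refine hcs.trans ((abs_le_of_sq_le_sq' ?_ (by positivity)).2)
  calc (normW0 m x * normW0 m y) ^ 2 = normW0 m x ^ 2 * normW0 m y ^ 2 := by ring
    _ ≤ ((beamGamma m w r / r) ^ 2 * ‖x‖ ^ 2) * ((beamGamma m w r / r) ^ 2 * ‖y‖ ^ 2) :=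
      mul_le_mul (normW0_sq_le hm hr x) (normW0_sq_le hm hr y) (sq_nonneg _) (by positivity)
    _ = _ := by ring

end Gamma

/-! ### Quadratic monomials in one mode -/

section Sign

theorem norm_zSign (s : Bool) (x : ℂ) : ‖zSign s x‖ = ‖x‖ := by
  cases s <;> simp [zSign]

theorem zSign_add (s : Bool) (x y : ℂ) : zSign s (x + y) = zSign s x + zSign s y := by
  cases s <;> simp [zSign]

theorem zSign_real_mul (s : Bool) (t : ℝ) (x : ℂ) : zSign s (t * x) = t * zSign s x := by
  cases s <;> simp [zSign]

theorem conj_zSign (s : Bool) (x : ℂ) : conj (zSign s x) = zSign (!s) x := by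
  cases s <;> simp [zSign]

/-- The indices of the monomials `z_i^σ z_i^σ'`. -/
abbrev PairIdx := ℕ+ × Bool × Bool

/-- The bilinear form `x_i^σ y_i^σ'`. -/
noncomputable def pairMon (x y : ℕ+ → ℂ) (a : PairIdx) : ℂ :=
  zSign a.2.1 (x a.1) * zSign a.2.2 (y a.1)

theorem norm_pairMon (x y : ℕ+ → ℂ) (a : PairIdx) : ‖pairMon x y a‖ = ‖x a.1‖ * ‖y a.1‖ := by
  rw [pairMon, norm_mul, norm_zSign, norm_zSign]

/-- The exchange of the two signs. -/
def PairIdx.swap : PairIdx ≃ PairIdx where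
  toFun a := (a.1, a.2.2, a.2.1)
  invFun a := (a.1, a.2.2, a.2.1)
  left_inv _ := rfl
  right_inv _ := rfl

/-- The index of the conjugate monomial. -/
def PairIdx.bar : PairIdx ≃ PairIdx where
  toFun a := (a.1, !a.2.1, !a.2.2)
  invFun a := (a.1, !a.2.1, !a.2.2)
  left_inv a := by simp
  right_inv a := by simp

theorem pairMon_swap (x y : ℕ+ → ℂ) (a : PairIdx) : pairMon x y a.swap = pairMon y x a :=
  mul_comm _ _

theorem pairMon_bar (x y : ℕ+ → ℂ) (a : PairIdx) : pairMon x y a.bar = conj (pairMon x y a) := by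
  rw [pairMon, pairMon, map_mul, conj_zSign, conj_zSign]
  rfl

theorem hasSum_pairIdx {f : ℕ+ → ℝ} (hf : Summable f) :
    HasSum (fun a : PairIdx => f a.1) (4 * ∑' i, f i) := by
  have h : HasSum (fun b : (Bool × Bool) => (1 : ℝ)) 4 := by
    have := hasSum_fintype (fun b : (Bool × Bool) => (1 : ℝ))
    simpa using this
  have hs : Summable fun a : PairIdx => f a.1 * (1 : ℝ) := by
    have := summable_mul_of_summable_norm (f := f) (g := fun b : (Bool × Bool) => (1 : ℝ))
      hf.norm (by simpa using h.summable)
    exact this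
  have := hf.hasSum.mul h hs
  simpa [mul_comm] using this

theorem hasSum_pairIdx_of_hasSum {f : PairIdx → ℂ} (hf : Summable f) :
    HasSum (fun j : ℕ+ => ∑ b : Bool × Bool, f (j, b)) (∑' a, f a) := by
  have := hf.hasSum.prod_fiberwise (fun j => hasSum_fintype fun b : Bool × Bool => f (j, b))
  exact this

end Sign

/-! ### The generating function -/

section Kernel

variable {m : ℝ}

/-- `ε_σ = ±1`. -/
def signVal (s : Bool) : ℝ := if s then 1 else -1

/-- The frequency `(ε_σ + ε_σ') ω_i` of `z_i^σ z_i^σ'`. -/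
noncomputable def pairFreq (m : ℝ) (a : PairIdx) : ℝ :=
  (signVal a.2.1 + signVal a.2.2) * beamOmega m a.1

/-- The coefficients `(i²/ω_i)(j²/ω_j)/(32π)` of the quartic Hamiltonian. -/
noncomputable def quarticCoef (m : ℝ) (a b : PairIdx) : ℝ :=
  beamRatio m a.1 * beamRatio m b.1 / (32 * Real.pi)

/-- The coefficients of the generating function. -/
noncomputable def genCoef (m : ℝ) (a b : PairIdx) : ℂ :=
  -- Resonant terms are left out, since they stay in the normal form. The factor `-I` below is the
  -- one for which `Λ` decreases at the rate `G - Ḡ` along the field.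
  if pairFreq m a + pairFreq m b = 0 then 0
  else -Complex.I * quarticCoef m a b / ((pairFreq m a + pairFreq m b : ℝ) : ℂ)

theorem pairFreq_swap (a : PairIdx) : pairFreq m a.swap = pairFreq m a := by
  simp only [pairFreq, PairIdx.swap, Equiv.coe_fn_mk]
  rw [add_comm]

theorem pairFreq_bar (a : PairIdx) : pairFreq m a.bar = -pairFreq m a := by
  obtain ⟨i, s, s'⟩ := a
  cases s <;> cases s' <;> simp [pairFreq, PairIdx.bar, signVal] <;> ring

theorem genCoef_symm (a b : PairIdx) : genCoef m a b = genCoef m b a := by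
  rw [genCoef, genCoef, add_comm (pairFreq m a), quarticCoef, quarticCoef,
    mul_comm (beamRatio m a.1)]

theorem genCoef_swap_right (a b : PairIdx) : genCoef m a b.swap = genCoef m a b := by
  rw [genCoef, genCoef, pairFreq_swap]
  rfl

theorem genCoef_swap_left (a b : PairIdx) : genCoef m a.swap b = genCoef m a b := by
  rw [genCoef_symm, genCoef_swap_right, genCoef_symm]

theorem genCoef_bar (a b : PairIdx) : genCoef m a.bar b.bar = conj (genCoef m a b) := by
  have e : quarticCoef m a.bar b.bar = quarticCoef m a b := rfl
  rw [genCoef, genCoef, pairFreq_bar, pairFreq_bar, e]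
  by_cases h : pairFreq m a + pairFreq m b = 0
  · rw [if_pos h, if_pos (by linarith), map_zero]
  · rw [if_neg h, if_neg (fun h' => h (by linarith))]
    have e2 : -pairFreq m a + -pairFreq m b = -(pairFreq m a + pairFreq m b) := by ring
    simp only [e2, map_div₀, map_mul, map_neg, Complex.conj_I, Complex.conj_ofReal]
    push_cast
    rw [div_neg]
    ring

/-- The sum is `0`, `±2ω_i`, `±2ω_j` or `±2ω_i ± 2ω_j`. Without opposite signs, a nonzero value is
bounded through `2ω ≥ μ`; with opposite signs it vanishes only for `i = j`, and otherwise the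
frequency gap applies. -/
theorem beamMu_le_abs_pairFreq_add (hm : -1 / 2 ≤ m) (a b : PairIdx)
    (h : pairFreq m a + pairFreq m b ≠ 0) : beamMu m ≤ |pairFreq m a + pairFreq m b| := by
  obtain ⟨i, s, s'⟩ := a
  obtain ⟨j, t, t'⟩ := b
  have hμ := beamMu_pos hm
  have hi := beamMu_le_two_mul_beamOmega hm i
  have hj := beamMu_le_two_mul_beamOmega hm j
  have hij : i ≠ j → beamMu m ≤ |2 * beamOmega m i - 2 * beamOmega m j| := by
    intro hne
    rcases lt_or_gt_of_ne hne with h | h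
    · have := beamMu_le_two_mul_sub (m := m) h
      rw [le_abs]; right; linarith
    · have := beamMu_le_two_mul_sub (m := m) h
      rw [le_abs]; left; linarith
  rw [le_abs]
  rw [le_abs] at hij
  cases s <;> cases s' <;> cases t <;> cases t' <;>
    simp only [pairFreq, signVal, if_true, if_false, Bool.false_eq_true] at h ⊢ <;>
    first
    | (left; linarith)
    | (right; linarith)
    | (exfalso; apply h; ring1)
    | (have hne : i ≠ j := by
         intro he
         apply h
         rw [he]
         ring
       rcases hij hne with h1 | h1
       · first | (left; linarith) | (right; linarith)
       · first | (left; linarith) | (right; linarith))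

theorem quarticCoef_nonneg (hm : -1 / 2 ≤ m) (a b : PairIdx) : 0 ≤ quarticCoef m a b := by
  have h1 := beamRatio_pos hm a.1
  have h2 := beamRatio_pos hm b.1
  have := Real.pi_pos
  unfold quarticCoef
  positivity

theorem norm_genCoef_le (hm : -1 / 2 ≤ m) (a b : PairIdx) :
    ‖genCoef m a b‖ ≤ beamRatio m a.1 * beamRatio m b.1 / (32 * Real.pi * beamMu m) := by
  have hμ := beamMu_pos hm
  have h1 := beamRatio_pos hm a.1
  have h2 := beamRatio_pos hm b.1
  have hπ := Real.pi_pos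
  have hq := quarticCoef_nonneg hm a b
  rw [genCoef]
  split_ifs with h
  · rw [norm_zero]; positivity
  · rw [norm_div, norm_mul, norm_neg, Complex.norm_I, Complex.norm_real, Complex.norm_real,
      Real.norm_of_nonneg hq, one_mul, Real.norm_eq_abs, ← div_div]
    exact div_le_div_of_nonneg_left hq hμ (beamMu_le_abs_pairFreq_add hm a b h)

theorem genCoef_mul_freq (a b : PairIdx) :
    genCoef m a b * ((pairFreq m a + pairFreq m b : ℝ) : ℂ) =
      -Complex.I * (if pairFreq m a + pairFreq m b = 0 then 0 else (quarticCoef m a b : ℂ)) := by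
  rw [genCoef]
  split_ifs with h
  · simp
  · rw [div_mul_cancel₀]
    exact Complex.ofReal_ne_zero.2 h

end Kernel

/-! ### The Hamiltonian vector field of the generating function -/

section Field

variable {m : ℝ} {w : BeamWeight}

/-- `∑_a s(a, b) x_i^σ y_i^σ'`, the coefficient of the monomial `b`. -/
noncomputable def genRow (m : ℝ) (x y : ℕ+ → ℂ) (b : PairIdx) : ℂ :=
  ∑' a : PairIdx, genCoef m a b * pairMon x y a

theorem norm_genCoef_mul_pairMon_le (hm : -1 / 2 ≤ m) (x y : ℕ+ → ℂ) (a b : PairIdx) :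
    ‖genCoef m a b * pairMon x y a‖ ≤ beamRatio m b.1 / (32 * Real.pi * beamMu m) *
      (beamRatio m a.1 * (‖x a.1‖ * ‖y a.1‖)) := by
  rw [norm_mul, norm_pairMon]
  calc _ ≤ beamRatio m a.1 * beamRatio m b.1 / (32 * Real.pi * beamMu m) *
        (‖x a.1‖ * ‖y a.1‖) := by gcongr; exact norm_genCoef_le hm a b
    _ = _ := by ring

theorem summable_genRow (hm : -1 / 2 ≤ m) (x y : BeamSpace w) (b : PairIdx) :
    Summable fun a : PairIdx => genCoef m a b * pairMon x y a :=
  Summable.of_norm_bounded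
    ((hasSum_pairIdx (summable_beamRatio_mul_mul hm x y)).summable.mul_left _)
    fun a => norm_genCoef_mul_pairMon_le hm x y a b

theorem norm_genRow_le (hm : -1 / 2 ≤ m) {r : ℝ} (hr : 0 < r) (x y : BeamSpace w) (b : PairIdx) :
    ‖genRow m x y b‖ ≤ beamRatio m b.1 / (8 * Real.pi * beamMu m) *
      ((beamGamma m w r / r) ^ 2 * (‖x‖ * ‖y‖)) := by
  have hs := hasSum_pairIdx (summable_beamRatio_mul_mul hm x y)
  have h1 := beamRatio_pos hm b.1
  have hμ := beamMu_pos hm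
  have hπ := Real.pi_pos
  refine (tsum_of_norm_bounded (hs.mul_left _)
    fun a => norm_genCoef_mul_pairMon_le hm x y a b).trans ?_
  have := tsum_beamRatio_mul_mul_le hm hr x y
  calc _ = beamRatio m b.1 / (8 * Real.pi * beamMu m) *
        ∑' j : ℕ+, beamRatio m j * (‖x j‖ * ‖y j‖) := by field_simp; ring
    _ ≤ _ := by gcongr

theorem genRow_add_left (hm : -1 / 2 ≤ m) (x x' y : BeamSpace w) (b : PairIdx) :
    genRow m (x + x' : BeamSpace w) y b = genRow m x y b + genRow m x' y b := by
  rw [genRow, genRow, genRow, ← (summable_genRow hm x y b).tsum_add (summable_genRow hm x' y b)]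
  refine tsum_congr fun a => ?_
  rw [pairMon, BeamSpace.add_apply, zSign_add, pairMon, pairMon]
  ring

theorem genRow_smul_left (t : ℝ) (x y : BeamSpace w) (b : PairIdx) :
    genRow m (t • x : BeamSpace w) y b = t * genRow m x y b := by
  rw [genRow, genRow, ← tsum_mul_left]
  refine tsum_congr fun a => ?_
  rw [pairMon, BeamSpace.real_smul_apply, zSign_real_mul, pairMon]
  ring

theorem genRow_comm (x y : ℕ+ → ℂ) (b : PairIdx) : genRow m x y b = genRow m y x b := by
  rw [genRow, ← PairIdx.swap.tsum_eq]
  simp only [genCoef_swap_left, pairMon_swap]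
  rfl

theorem genRow_swap (x y : ℕ+ → ℂ) (b : PairIdx) : genRow m x y b.swap = genRow m x y b := by
  simp only [genRow, genCoef_swap_right]

theorem conj_genRow (x y : ℕ+ → ℂ) (b : PairIdx) :
    conj (genRow m x y b) = genRow m x y b.bar := by
  rw [genRow, Complex.conj_tsum, genRow,
    ← PairIdx.bar.tsum_eq fun a => genCoef m a b.bar * pairMon x y a]
  refine tsum_congr fun a => ?_
  rw [map_mul, genCoef_bar, pairMon_bar]

/-- The trilinear form of the vector field `i ∂_{z̄_j} S`. -/
noncomputable def genField (m : ℝ) (x y v : ℕ+ → ℂ) (j : ℕ+) : ℂ :=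
  -- The factor 4 is 2 for the symmetry of `genCoef` in its two pairs times 2 for the exchange of
  -- signs within a pair; `false` is the factor `z̄_j` that is differentiated.
  ∑ t : Bool, 4 * Complex.I * genRow m x y (j, false, t) * zSign t (v j)

/-- The constant `(𝔠/(πμ)) (γ_r/r)²`. -/
noncomputable def fieldConst (m : ℝ) (w : BeamWeight) (r : ℝ) : ℝ :=
  beamC m / (Real.pi * beamMu m) * (beamGamma m w r / r) ^ 2

theorem fieldConst_nonneg (hm : -1 / 2 ≤ m) (r : ℝ) : 0 ≤ fieldConst m w r := by
  have := beamMu_pos hm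
  have := beamC_pos hm
  have := Real.pi_pos
  unfold fieldConst
  positivity

/-- Differentiation in `z̄_j` leaves one factor of the same mode, hence the bound by `‖v j‖`. The
four sign pairs in the row, the factor 4 and the two values of `t` cancel the 32 of the
coefficients. -/
theorem norm_genField_le (hm : -1 / 2 ≤ m) {r : ℝ} (hr : 0 < r) (x y v : BeamSpace w) (j : ℕ+) :
    ‖genField m x y v j‖ ≤ fieldConst m w r * ‖x‖ * ‖y‖ * ‖v j‖ := by
  have hμ := beamMu_pos hm
  have hπ := Real.pi_pos
  have h : ∀ t : Bool, ‖4 * Complex.I * genRow m x y (j, false, t) * zSign t (v j)‖ ≤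
      fieldConst m w r * ‖x‖ * ‖y‖ * ‖v j‖ / 2 := by
    intro t
    rw [norm_mul, norm_mul, norm_mul, norm_zSign, Complex.norm_I, mul_one]
    have h1 := norm_genRow_le hm hr x y (j, false, t)
    have h2 := beamRatio_le hm j
    have h3 : ‖(4 : ℂ)‖ = 4 := by simp
    rw [h3]
    calc 4 * ‖genRow m x y (j, false, t)‖ * ‖v j‖
        ≤ 4 * (beamC m / (8 * Real.pi * beamMu m) *
          ((beamGamma m w r / r) ^ 2 * (‖x‖ * ‖y‖))) * ‖v j‖ := by
          gcongr
          exact h1.trans (by gcongr)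
      _ = _ := by unfold fieldConst; field_simp; ring
  rw [genField, Fintype.sum_bool]
  refine (norm_add_le _ _).trans ?_
  linarith [h true, h false]

/-- The vector field form `genField m x y`, as a bounded operator of `h_w`. -/
noncomputable def genFieldOp (hm : -1 / 2 ≤ m) {r : ℝ} (hr : 0 < r) (x y : BeamSpace w) :
    BeamSpace w →L[ℝ] BeamSpace w :=
  LinearMap.mkContinuous
    { toFun := fun v => BeamSpace.ofBound (genField m x y v) (fieldConst m w r * ‖x‖ * ‖y‖) v
        fun j => norm_genField_le hm hr x y v j
      map_add' := fun v v' => BeamSpace.ext fun j => by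
        change genField m x y (v + v' : BeamSpace w) j = genField m x y v j + genField m x y v' j
        simp only [genField, Fintype.sum_bool, BeamSpace.add_apply, zSign_add]
        ring
      map_smul' := fun t v => BeamSpace.ext fun j => by
        change genField m x y (t • v : BeamSpace w) j = (t : ℂ) * genField m x y v j
        simp only [genField, Fintype.sum_bool, BeamSpace.real_smul_apply, zSign_real_mul]
        ring }
    (fieldConst m w r * ‖x‖ * ‖y‖) fun v => BeamSpace.norm_le_of_bound
      (by have := fieldConst_nonneg (w := w) hm r; positivity)
      fun j => norm_genField_le hm hr x y v j

theorem norm_genFieldOp_le (hm : -1 / 2 ≤ m) {r : ℝ} (hr : 0 < r) (x y : BeamSpace w) :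
    ‖genFieldOp hm hr x y‖ ≤ fieldConst m w r * ‖x‖ * ‖y‖ :=
  LinearMap.mkContinuous_norm_le _
    (by have := fieldConst_nonneg (w := w) hm r; positivity) _

/-- The trilinear form of the vector field, as a bilinear map into the bounded operators. -/
noncomputable def genFieldLin (w : BeamWeight) (hm : -1 / 2 ≤ m) {r : ℝ} (hr : 0 < r) :
    BeamSpace w →ₗ[ℝ] BeamSpace w →ₗ[ℝ] BeamSpace w →L[ℝ] BeamSpace w :=
  LinearMap.mk₂ ℝ (genFieldOp hm hr)
    (fun x x' y => ContinuousLinearMap.ext fun v => BeamSpace.ext fun j => by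
      change genField m (x + x' : BeamSpace w) y v j = genField m x y v j + genField m x' y v j
      simp only [genField, Fintype.sum_bool, genRow_add_left hm]
      ring)
    (fun t x y => ContinuousLinearMap.ext fun v => BeamSpace.ext fun j => by
      change genField m (t • x : BeamSpace w) y v j = (t : ℂ) * genField m x y v j
      simp only [genField, Fintype.sum_bool, genRow_smul_left]
      ring)
    (fun x y y' => ContinuousLinearMap.ext fun v => BeamSpace.ext fun j => by
      change genField m x (y + y' : BeamSpace w) v j = genField m x y v j + genField m x y' v j
      simp only [genField, Fintype.sum_bool, genRow_comm x.1, genRow_add_left hm]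
      ring)
    (fun t x y => ContinuousLinearMap.ext fun v => BeamSpace.ext fun j => by
      change genField m x (t • y : BeamSpace w) v j = (t : ℂ) * genField m x y v j
      simp only [genField, Fintype.sum_bool, genRow_comm x.1, genRow_smul_left]
      ring)

theorem norm_genFieldLin_le (hm : -1 / 2 ≤ m) {r : ℝ} (hr : 0 < r) (x y : BeamSpace w) :
    ‖genFieldLin w hm hr x y‖ ≤ fieldConst m w r * ‖x‖ * ‖y‖ :=
  norm_genFieldOp_le hm hr x y

set_option maxSynthPendingDepth 3 in
/-- The trilinear form of the vector field, as a bounded trilinear map of `h_w`. -/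
noncomputable def genFieldCLM (w : BeamWeight) (hm : -1 / 2 ≤ m) {r : ℝ} (hr : 0 < r) :
    BeamSpace w →L[ℝ] BeamSpace w →L[ℝ] BeamSpace w →L[ℝ] BeamSpace w :=
  LinearMap.mkContinuous₂ (genFieldLin w hm hr) (fieldConst m w r) (norm_genFieldLin_le hm hr)

theorem genFieldCLM_apply (hm : -1 / 2 ≤ m) {r : ℝ} (hr : 0 < r) (x y v : BeamSpace w) (j : ℕ+) :
    genFieldCLM w hm hr x y v j = genField m x y v j := by
  rw [genFieldCLM, LinearMap.mkContinuous₂_apply]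
  rfl

set_option maxSynthPendingDepth 3 in
theorem norm_genFieldCLM_le (hm : -1 / 2 ≤ m) {r : ℝ} (hr : 0 < r) :
    ‖genFieldCLM w hm hr‖ ≤ fieldConst m w r :=
  LinearMap.mkContinuous₂_norm_le (genFieldLin w hm hr) (fieldConst_nonneg hm r)
    (norm_genFieldLin_le hm hr)

end Field

/-! ### The symplectic form -/

section Symplectic

variable {m : ℝ} {w : BeamWeight}

theorem exists_tsum_norm_mul_norm_le (w : BeamWeight) : ∃ C : ℝ, 0 ≤ C ∧ ∀ u v : BeamSpace w,
    (Summable fun j : ℕ+ => ‖u j‖ * ‖v j‖) ∧ ∑' j : ℕ+, ‖u j‖ * ‖v j‖ ≤ C * (‖u‖ * ‖v‖) := by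
  obtain ⟨c, hc, h⟩ := w.bdd
  refine ⟨(c ^ 2)⁻¹, by positivity, fun u v => ?_⟩
  have hfin : ∀ s : Finset ℕ+, ∑ j ∈ s, ‖u j‖ * ‖v j‖ ≤ (c ^ 2)⁻¹ * (‖u‖ * ‖v‖) := by
    intro s
    rw [inv_mul_eq_div, le_div_iff₀ (by positivity), Finset.sum_mul]
    have h1 : ∑ j ∈ s, ‖u j‖ * ‖v j‖ * c ^ 2 ≤ ∑ j ∈ s, (w.val j * ‖u j‖) * (w.val j * ‖v j‖) := by
      refine Finset.sum_le_sum fun j _ => ?_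
      calc ‖u j‖ * ‖v j‖ * c ^ 2 ≤ ‖u j‖ * ‖v j‖ * w.val j ^ 2 := by gcongr; exact h j
        _ = _ := by ring
    refine h1.trans ((abs_le_of_sq_le_sq' ?_ (by positivity)).2)
    refine (Finset.sum_mul_sq_le_sq_mul_sq s _ _).trans ?_
    rw [mul_pow, BeamSpace.norm_sq, BeamSpace.norm_sq]
    simp only [mul_pow]
    refine mul_le_mul ?_ ?_ ?_ ?_
    · exact u.summable.sum_le_tsum s fun j _ => by positivity
    · exact v.summable.sum_le_tsum s fun j _ => by positivity
    · exact Finset.sum_nonneg fun j _ => by positivity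
    · exact tsum_nonneg fun j => by positivity
  have hs : Summable fun j : ℕ+ => ‖u j‖ * ‖v j‖ :=
    summable_of_sum_le (fun j => by positivity) hfin
  exact ⟨hs, hs.tsum_le_of_sum_le hfin⟩

theorem norm_symplTerm_le (u v : ℕ+ → ℂ) (j : ℕ+) :
    ‖u j * conj (v j) - v j * conj (u j)‖ ≤ 2 * (‖u j‖ * ‖v j‖) := by
  refine (norm_sub_le _ _).trans ?_
  simp only [norm_mul, RCLike.norm_conj]
  linarith [mul_comm ‖u j‖ ‖v j‖]

theorem summable_symplTerm (u v : BeamSpace w) :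
    Summable fun j : ℕ+ => u j * conj (v j) - v j * conj (u j) := by
  obtain ⟨C, -, h⟩ := exists_tsum_norm_mul_norm_le w
  exact Summable.of_norm_bounded ((h u v).1.mul_left 2) fun j => norm_symplTerm_le u v j

theorem symplForm_swap (u v : BeamSpace w) : symplForm v u = -symplForm u v := by
  rw [symplForm, symplForm, ← mul_neg, ← tsum_neg]
  congr 2
  funext j
  ring

theorem symplForm_add_left (u u' v : BeamSpace w) :
    symplForm (u + u') v = symplForm u v + symplForm u' v := by
  rw [symplForm, symplForm, symplForm, ← mul_add,
    ← (summable_symplTerm u v).tsum_add (summable_symplTerm u' v)]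
  congr 2
  funext j
  rw [BeamSpace.add_apply, map_add]
  ring

theorem symplForm_smul_left (t : ℝ) (u v : BeamSpace w) :
    symplForm (t • u) v = t • symplForm u v := by
  rw [symplForm, symplForm, Complex.real_smul, mul_left_comm]
  congr 1
  rw [← tsum_mul_left]
  refine tsum_congr fun j => ?_
  rw [BeamSpace.real_smul_apply, map_mul, Complex.conj_ofReal]
  ring

/-- The symplectic form as a bounded bilinear form. -/
theorem exists_symplForm_clm (w : BeamWeight) :
    ∃ Ω : BeamSpace w →L[ℝ] BeamSpace w →L[ℝ] ℂ, ∀ u v, Ω u v = symplForm u v := by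
  obtain ⟨C, hC, h⟩ := exists_tsum_norm_mul_norm_le w
  refine ⟨LinearMap.mkContinuous₂ (LinearMap.mk₂ ℝ symplForm symplForm_add_left
    symplForm_smul_left (fun u v v' => ?_) (fun t u v => ?_)) (2 * C) fun u v => ?_, fun u v => ?_⟩
  · rw [symplForm_swap (v + v') u, symplForm_add_left, symplForm_swap v u, symplForm_swap v' u,
      neg_add]
  · rw [symplForm_swap (t • v) u, symplForm_smul_left, symplForm_swap v u, smul_neg]
  · rw [LinearMap.mk₂_apply, symplForm, norm_mul, Complex.norm_I, one_mul]
    refine (tsum_of_norm_bounded (((h u v).1.mul_left 2).hasSum)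
      fun j => norm_symplTerm_le u v j).trans ?_
    rw [tsum_mul_left]
    linarith [(h u v).2]
  · rw [LinearMap.mkContinuous₂_apply, LinearMap.mk₂_apply]

/-! ### The quartic form of the generating function -/

/-- `∑_{a,b} s(a, b) x_i^σ y_i^σ' u_j^τ v_j^τ'`. -/
noncomputable def genQuad (m : ℝ) (x y u v : ℕ+ → ℂ) : ℂ :=
  ∑' b : PairIdx, genRow m x y b * pairMon u v b

theorem summable_genCoef_mul (hm : -1 / 2 ≤ m) (x y u v : BeamSpace w) :
    Summable fun p : PairIdx × PairIdx =>
      genCoef m p.1 p.2 * pairMon x y p.1 * pairMon u v p.2 := by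
  have h1 := (hasSum_pairIdx (summable_beamRatio_mul_mul hm x y)).summable
  have h2 := (hasSum_pairIdx (summable_beamRatio_mul_mul hm u v)).summable
  have h3 : Summable fun p : PairIdx × PairIdx =>
      (beamRatio m p.1.1 * (‖x p.1.1‖ * ‖y p.1.1‖)) *
        (beamRatio m p.2.1 * (‖u p.2.1‖ * ‖v p.2.1‖)) :=
    h1.mul_of_nonneg h2
      (fun a => by have := beamRatio_pos hm a.1; positivity)
      (fun a => by have := beamRatio_pos hm a.1; positivity)
  refine Summable.of_norm_bounded (h3.mul_left (1 / (32 * Real.pi * beamMu m))) fun p => ?_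
  rw [norm_mul _ (pairMon u v p.2), norm_pairMon u]
  refine (mul_le_mul_of_nonneg_right (norm_genCoef_mul_pairMon_le hm x y p.1 p.2)
    (by positivity)).trans (le_of_eq ?_)
  ring

theorem genQuad_eq_tsum_prod (hm : -1 / 2 ≤ m) (x y u v : BeamSpace w) :
    genQuad m x y u v = ∑' p : PairIdx × PairIdx,
      genCoef m p.1 p.2 * pairMon x y p.1 * pairMon u v p.2 := by
  have hs := summable_genCoef_mul hm x y u v
  have hs' := (Equiv.prodComm PairIdx PairIdx).summable_iff.2 hs
  rw [← (Equiv.prodComm PairIdx PairIdx).tsum_eq]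
  refine Eq.trans ?_ hs'.tsum_prod.symm
  refine tsum_congr fun b => ?_
  rw [genRow, ← tsum_mul_right]
  rfl

theorem genQuad_comm_left (x y u v : ℕ+ → ℂ) : genQuad m x y u v = genQuad m y x u v := by
  simp only [genQuad, genRow_comm x y]

theorem genQuad_symm (hm : -1 / 2 ≤ m) (x y u v : BeamSpace w) :
    genQuad m x y u v = genQuad m u v x y := by
  rw [genQuad_eq_tsum_prod hm, genQuad_eq_tsum_prod hm,
    ← (Equiv.prodComm PairIdx PairIdx).tsum_eq]
  refine tsum_congr fun p => ?_
  simp only [Equiv.prodComm_apply, Prod.fst_swap, Prod.snd_swap]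
  rw [genCoef_symm]
  ring

theorem genQuad_comm_right (hm : -1 / 2 ≤ m) (x y u v : BeamSpace w) :
    genQuad m x y u v = genQuad m x y v u := by
  rw [genQuad_symm hm, genQuad_comm_left, genQuad_symm hm]

theorem summable_genRow_mul (hm : -1 / 2 ≤ m) (x y u v : BeamSpace w) :
    Summable fun b : PairIdx => genRow m x y b * pairMon u v b := by
  have hs' := (Equiv.prodComm PairIdx PairIdx).summable_iff.2 (summable_genCoef_mul hm x y u v)
  refine hs'.prod.congr fun b => ?_
  rw [genRow, ← tsum_mul_right]
  rfl

theorem conj_genField (x y v : ℕ+ → ℂ) (j : ℕ+) :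
    conj (genField m x y v j) =
      ∑ t : Bool, -(4 * Complex.I) * genRow m x y (j, true, t) * zSign t (v j) := by
  simp only [genField, Fintype.sum_bool, map_add, map_mul, conj_genRow, conj_zSign,
    Complex.conj_I, PairIdx.bar, Equiv.coe_fn_mk, Bool.not_true, Bool.not_false, map_ofNat]
  ring

/-- The field is the symplectic gradient of a quartic form, with `-4 = i · 4i`. The Hamiltonian
property is thereby reduced to symmetries of `genQuad`. -/
theorem symplForm_genField (hm : -1 / 2 ≤ m) {r : ℝ} (hr : 0 < r) (x y u v : BeamSpace w) :
    symplForm (genFieldCLM w hm hr x y u) v = -4 * genQuad m x y u v := by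
  rw [symplForm, genQuad, ← (hasSum_pairIdx_of_hasSum (summable_genRow_mul hm x y u v)).tsum_eq,
    ← tsum_mul_left, ← tsum_mul_left]
  refine tsum_congr fun j => ?_
  rw [genFieldCLM_apply, conj_genField, genField]
  have hsw : genRow m x y (j, false, true) = genRow m x y (j, true, false) :=
    genRow_swap x.1 y.1 (j, true, false)
  simp only [Fintype.sum_bool, Fintype.sum_prod_type, pairMon, zSign, hsw, if_true,
    Bool.false_eq_true, if_false]
  linear_combination (4 * (genRow m x y (j, true, false) * u j * conj (v j) +
    genRow m x y (j, false, false) * conj (u j) * conj (v j) +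
    genRow m x y (j, true, true) * u j * v j +
    genRow m x y (j, true, false) * conj (u j) * v j)) * Complex.I_sq

/-- The vector field is Hamiltonian. -/
theorem symplForm_fderiv_genField (hm : -1 / 2 ≤ m) {r : ℝ} (hr : 0 < r) (z u v : BeamSpace w) :
    symplForm (genFieldCLM w hm hr u z z + genFieldCLM w hm hr z u z + genFieldCLM w hm hr z z u) v +
      symplForm u (genFieldCLM w hm hr v z z + genFieldCLM w hm hr z v z +
        genFieldCLM w hm hr z z v) = 0 := by
  -- What remains is the symmetry of `Ω(DX u, v)` in `u` and `v`, which the symmetries of the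
  -- quartic form give for each of the three terms.
  rw [symplForm_swap _ u]
  simp only [symplForm_add_left, symplForm_genField]
  have h1 : genQuad m u z z v = genQuad m v z z u := by
    rw [genQuad_symm hm u z z v, genQuad_comm_left, genQuad_comm_right hm]
  have h2 : genQuad m z u z v = genQuad m z v z u := by
    rw [genQuad_symm hm z u z v]
  have h3 : genQuad m z z u v = genQuad m z z v u := genQuad_comm_right hm z z u v
  rw [h1, h2, h3]
  ring

-- The flow estimates are used on the ball of radius `2r`, whence `108 = 27 · 4`; this leaves room
-- for neighbourhoods of the points and for their images. The derivatives are invertible by the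
-- chain rule, since `flowMap (-T)` is a two-sided local inverse.
set_option maxSynthPendingDepth 3 in
theorem isSymplTransf_flowMap {T : BeamSpace w →L[ℝ] BeamSpace w →L[ℝ] BeamSpace w →L[ℝ] BeamSpace w}
    (hT : ∀ z u v : BeamSpace w, symplForm (T u z z + T z u z + T z z u) v +
      symplForm u (T v z z + T z v z + T z z v) = 0) {r : ℝ} (hr : 0 < r)
    (h : 108 * ‖T‖ * r ^ 2 ≤ 1) : IsSymplTransf (Metric.closedBall 0 r) (flowMap T) := by
  have hρ : 0 < 2 * r := by positivity
  have hT2 : 27 * ‖T‖ * (2 * r) ^ 2 ≤ 1 := by linarith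
  have hTn : 27 * ‖-T‖ * (2 * r) ^ 2 ≤ 1 := by rwa [norm_neg]
  have hball : ∀ z : BeamSpace w, z ∈ Metric.closedBall (0 : BeamSpace w) r → ‖z‖ ≤ r := fun z hz =>
    mem_closedBall_zero_iff.1 hz
  refine ⟨fun z hz => analyticAt_flowMap hρ hT2 (by linarith [hball z hz]), ?_, ?_, ?_⟩
  · intro x hx y hy hxy
    rw [← flowMap_neg_flowMap hρ hT2 (by linarith [hball x hx] : ‖x‖ ≤ 2 * r), hxy,
      flowMap_neg_flowMap hρ hT2 (by linarith [hball y hy] : ‖y‖ ≤ 2 * r)]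
  · intro z hz
    have hz' := hball z hz
    have hzn : ∀ᶠ x in nhds z, ‖x‖ < 2 * r :=
      (isOpen_lt continuous_norm continuous_const).mem_nhds (by
        change ‖z‖ < 2 * r; linarith)
    have hΨz : ‖flowMap T z‖ < 2 * r := by
      have h1 := norm_flowMap_sub_le hr (by nlinarith [norm_nonneg T, sq_nonneg r]) hz' (T := T)
      have h2 := norm_add_le (flowMap T z - z) z
      rw [sub_add_cancel] at h2
      nlinarith [mul_nonneg (norm_nonneg T) (sq_nonneg r)]
    have hΨn : ∀ᶠ x in nhds (flowMap T z), ‖x‖ < 2 * r :=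
      (isOpen_lt continuous_norm continuous_const).mem_nhds hΨz
    have d1 := (analyticAt_flowMap hρ hT2 (by linarith : ‖z‖ ≤ 2 * r)).differentiableAt.hasFDerivAt
    have d2 := (analyticAt_flowMap hρ hTn hΨz.le).differentiableAt.hasFDerivAt
    have e1 := (d2.comp z d1).unique ((hasFDerivAt_id z).congr_of_eventuallyEq (by
      filter_upwards [hzn] with x hx using flowMap_neg_flowMap hρ hT2 hx.le))
    have hback : flowMap (-T) (flowMap T z) = z := flowMap_neg_flowMap hρ hT2 (by linarith)
    have d3 : HasFDerivAt (flowMap T) (fderiv ℝ (flowMap T) z) (flowMap (-T) (flowMap T z)) := by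
      rw [hback]; exact d1
    have e2 := (d3.comp (flowMap T z) d2).unique
      ((hasFDerivAt_id (flowMap T z)).congr_of_eventuallyEq (by
        filter_upwards [hΨn] with x hx
        have := flowMap_neg_flowMap hρ hTn hx.le
        rwa [neg_neg] at this))
    exact ContinuousLinearMap.IsInvertible.of_inverse e2 e1
  · intro z hz u v
    obtain ⟨Ω, hΩ⟩ := exists_symplForm_clm w
    have := flowMap_symplectic Ω (T := T) (fun z u v => by rw [hΩ, hΩ]; exact hT z u v) hρ hT2
      (by linarith [hball z hz] : ‖z‖ < 2 * r) u v
    rwa [hΩ, hΩ] at this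

end Symplectic

/-! ### Homogeneous polynomials in the quadratic monomials -/

section Tensors

theorem hasSum_prod_pi {ι : Type*} {n : ℕ} (g : Fin n → ι → ℝ) (h0 : ∀ k a, 0 ≤ g k a)
    (hs : ∀ k, Summable (g k)) :
    HasSum (fun q : Fin n → ι => ∏ k, g k (q k)) (∏ k, ∑' a, g k a) := by
  induction n with
  | zero => simp
  | succ n ih =>
    have ih' := ih (fun k => g k.succ) (fun k => h0 _) (fun k => hs _)
    obtain ⟨G, hG⟩ : ∃ G : (Fin n → ι) → ℝ, G = fun q => ∏ k, g k.succ (q k) := ⟨_, rfl⟩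
    rw [← hG] at ih'
    have := (hs 0).hasSum.mul ih' (summable_mul_of_summable_norm (hs 0).norm ih'.summable.norm)
    rw [← (Fin.consEquiv fun _ : Fin (n + 1) => ι).hasSum_iff, Fin.prod_univ_succ]
    refine this.congr_fun fun p => ?_
    simp only [Function.comp_apply, Fin.consEquiv, Equiv.coe_fn_mk, Fin.prod_univ_succ,
      Fin.cons_zero, Fin.cons_succ, hG]

variable {m : ℝ} {w : BeamWeight} {n : ℕ}

/-- The monomial `∏_k z_{ℓ_k}^{σ_k} z_{ℓ_k}^{σ'_k}`. -/
noncomputable def tensMon (z : ℕ+ → ℂ) (q : Fin n → PairIdx) : ℂ := ∏ k, pairMon z z (q k)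

theorem norm_tensMon (z : ℕ+ → ℂ) (q : Fin n → PairIdx) :
    ‖tensMon z q‖ = ∏ k, ‖z (q k).1‖ ^ 2 := by
  simp only [tensMon, norm_prod, norm_pairMon, sq]

/-- The value of the polynomial with coefficients `c`. -/
noncomputable def tensEval (c : (Fin n → PairIdx) → ℂ) (z : ℕ+ → ℂ) : ℂ := ∑' q, c q * tensMon z q

/-- The coefficients `c` are dominated by those of `M (∑_a (i²/ω_i) z_i^σ z_i^σ')^n`. -/
def TensBound (m M : ℝ) (c : (Fin n → PairIdx) → ℂ) : Prop :=
  ∀ q, ‖c q‖ ≤ M * ∏ k, beamRatio m (q k).1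

theorem hasSum_prod_ratio (hm : -1 / 2 ≤ m) (z : BeamSpace w) (n : ℕ) :
    HasSum (fun q : Fin n → PairIdx => ∏ k, beamRatio m (q k).1 * ‖z (q k).1‖ ^ 2)
      ((4 * normW0 m z ^ 2) ^ n) := by
  have h1 := hasSum_pairIdx (summable_beamRatio_mul_sq hm z)
  rw [← normW0_sq hm] at h1
  have := hasSum_prod_pi (fun (_ : Fin n) (a : PairIdx) => beamRatio m a.1 * ‖z a.1‖ ^ 2)
    (fun _ a => by have := beamRatio_pos hm a.1; positivity) (fun _ => h1.summable)
  rw [h1.tsum_eq] at this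
  simpa using this

theorem TensBound.norm_mul_tensMon_le {M : ℝ} {c : (Fin n → PairIdx) → ℂ} (hc : TensBound m M c)
    (z : ℕ+ → ℂ) (q : Fin n → PairIdx) :
    ‖c q * tensMon z q‖ ≤ M * ∏ k, beamRatio m (q k).1 * ‖z (q k).1‖ ^ 2 := by
  rw [norm_mul, norm_tensMon, Finset.prod_mul_distrib, ← mul_assoc]
  gcongr
  exact hc q

theorem TensBound.summable (hm : -1 / 2 ≤ m) {M : ℝ} {c : (Fin n → PairIdx) → ℂ}
    (hc : TensBound m M c) (z : BeamSpace w) : Summable fun q => c q * tensMon z q :=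
  Summable.of_norm_bounded ((hasSum_prod_ratio hm z n).summable.mul_left M)
    fun q => hc.norm_mul_tensMon_le z q

theorem TensBound.norm_tensEval_le (hm : -1 / 2 ≤ m) {M : ℝ} {c : (Fin n → PairIdx) → ℂ}
    (hc : TensBound m M c) (z : BeamSpace w) :
    ‖tensEval c z‖ ≤ M * (4 * normW0 m z ^ 2) ^ n :=
  tsum_of_norm_bounded ((hasSum_prod_ratio hm z n).mul_left M)
    fun q => hc.norm_mul_tensMon_le z q

/-! ### The Lie derivative -/

/-- The derivative of `z_j^{b.1} z_j^{b.2}` along the field is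
`∑_a ∑_{b'} lieCoef a j b b' (z_i^σ z_i^σ') (z_j^{b'.1} z_j^{b'.2})`. -/
noncomputable def lieCoef (m : ℝ) (a : PairIdx) (j : ℕ+) (b b' : Bool × Bool) : ℂ :=
  -- Leibniz' rule: one factor keeps its sign, and the other is replaced by a component of the
  -- field.
  (if b'.2 = b.2 then 4 * Complex.I * signVal b.1 * genCoef m a (j, !b.1, b'.1) else 0) +
  (if b'.1 = b.1 then 4 * Complex.I * signVal b.2 * genCoef m a (j, !b.2, b'.2) else 0)

theorem norm_lieCoef_le (hm : -1 / 2 ≤ m) (a : PairIdx) (j : ℕ+) (b b' : Bool × Bool) :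
    ‖lieCoef m a j b b'‖ ≤ beamRatio m a.1 * (beamC m / (4 * Real.pi * beamMu m)) := by
  have hμ := beamMu_pos hm
  have hπ := Real.pi_pos
  have ha := beamRatio_pos hm a.1
  have hj := beamRatio_pos hm j
  have hC := beamC_pos hm
  have hs : ∀ s, ‖((signVal s : ℝ) : ℂ)‖ = 1 := by
    intro s; cases s <;> simp [signVal]
  have key : ∀ (P : Prop) [Decidable P] (s t : Bool),
      ‖(if P then 4 * Complex.I * signVal s * genCoef m a (j, !s, t) else 0 : ℂ)‖ ≤
        beamRatio m a.1 * (beamC m / (8 * Real.pi * beamMu m)) := by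
    intro P _ s t
    split_ifs
    · rw [norm_mul, norm_mul, norm_mul, hs, Complex.norm_I, mul_one, mul_one]
      have h1 := norm_genCoef_le hm a (j, !s, t)
      have h2 := beamRatio_le hm j
      have h4 : ‖(4 : ℂ)‖ = 4 := by simp
      rw [h4]
      calc 4 * ‖genCoef m a (j, !s, t)‖
          ≤ 4 * (beamRatio m a.1 * beamRatio m j / (32 * Real.pi * beamMu m)) := by gcongr
        _ ≤ 4 * (beamRatio m a.1 * beamC m / (32 * Real.pi * beamMu m)) := by gcongr
        _ = _ := by field_simp; ring
    · rw [norm_zero]; positivity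
  refine (norm_add_le _ _).trans ((add_le_add (key _ _ _) (key _ _ _)).trans (le_of_eq ?_))
  field_simp
  norm_num

theorem lieCoef_bar (a : PairIdx) (j : ℕ+) (b b' : Bool × Bool) :
    lieCoef m a.bar j (!b.1, !b.2) (!b'.1, !b'.2) = conj (lieCoef m a j b b') := by
  have hs : ∀ s, signVal (!s) = -signVal s := by
    intro s; cases s <;> simp [signVal]
  have hg : ∀ s t, genCoef m a.bar (j, !!s, !t) = conj (genCoef m a (j, !s, t)) := fun s t =>
    genCoef_bar a (j, !s, t)
  simp only [lieCoef, hs, hg, map_add, apply_ite conj, map_mul, map_zero, Complex.conj_I,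
    Complex.conj_ofReal, map_ofNat, Bool.not_inj_iff]
  push_cast
  congr 1 <;> (congr 1; ring)

/-- The coefficients of the Lie derivative of the polynomial with coefficients `c`. -/
noncomputable def lieTens (m : ℝ) (c : (Fin n → PairIdx) → ℂ) (q : Fin (n + 1) → PairIdx) : ℂ :=
  -- The pair `q 0` is the one brought in by the field; `b` is the sign pair that slot `k` carried
  -- before the derivative.
  ∑ k : Fin n, ∑ b : Bool × Bool, lieCoef m (q 0) (Fin.tail q k).1 b (Fin.tail q k).2 *
    c (Function.update (Fin.tail q) k ((Fin.tail q k).1, b))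

/-- There are `n` slots and four former sign pairs for each, every one costing `𝔠/(4πμ)`. The
derivative keeps the mode of the slot, and the new pair supplies its own ratio. -/
theorem TensBound.lieTens (hm : -1 / 2 ≤ m) {M : ℝ} {c : (Fin n → PairIdx) → ℂ}
    (hc : TensBound m M c) :
    TensBound m (n * (beamC m / (Real.pi * beamMu m)) * M) (lieTens m c) := by
  have hμ := beamMu_pos hm
  have hπ := Real.pi_pos
  have hC := beamC_pos hm
  intro q
  have hq := beamRatio_pos hm (q 0).1
  have hterm : ∀ k ∈ (Finset.univ : Finset (Fin n)), ∀ b ∈ (Finset.univ : Finset (Bool × Bool)),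
      ‖lieCoef m (q 0) (Fin.tail q k).1 b (Fin.tail q k).2 *
        c (Function.update (Fin.tail q) k ((Fin.tail q k).1, b))‖ ≤
      beamRatio m (q 0).1 * (beamC m / (4 * Real.pi * beamMu m)) *
        (M * ∏ k, beamRatio m (Fin.tail q k).1) := by
    intro k _ b _
    rw [norm_mul]
    refine mul_le_mul (norm_lieCoef_le hm _ _ _ _) ((hc _).trans (le_of_eq ?_)) (norm_nonneg _)
      (by positivity)
    congr 1
    refine Finset.prod_congr rfl fun i _ => ?_
    by_cases h : i = k
    · subst h; simp
    · simp [h]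
  refine (norm_sum_le_of_le _ fun k hk => norm_sum_le_of_le _ (hterm k hk)).trans (le_of_eq ?_)
  rw [Fin.prod_univ_succ]
  simp only [Finset.sum_const, Finset.card_univ, Fintype.card_fin, Fintype.card_prod,
    Fintype.card_bool, nsmul_eq_mul, Fin.tail]
  push_cast
  field_simp

theorem TensBound.nonneg (hm : -1 / 2 ≤ m) {M : ℝ} {c : (Fin n → PairIdx) → ℂ}
    (hc : TensBound m M c) : 0 ≤ M := by
  have h := (norm_nonneg _).trans (hc fun _ => (1, true, true))
  refine nonneg_of_mul_nonneg_left h (Finset.prod_pos fun k _ => beamRatio_pos hm _)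

/-- The transfer of a sign pair in the `k`-th slot. -/
def slotEquiv {ι κ β : Type*} (k : Fin n) :
    (Fin n → ι × β) × (κ × β) ≃ (κ × (Fin n → ι × β)) × β where
  toFun p := ((p.2.1, Function.update p.1 k ((p.1 k).1, p.2.2)), (p.1 k).2)
  invFun p := (Function.update p.1.2 k ((p.1.2 k).1, p.2), (p.1.1, (p.1.2 k).2))
  left_inv p := by simp
  right_inv p := by simp

/-- The derivative of `z_j^σ z_j^σ'` along the field. -/
noncomputable def pairDeriv (m : ℝ) (z : ℕ+ → ℂ) (a : PairIdx) : ℂ :=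
  zSign a.2.1 (genField m z z z a.1) * zSign a.2.2 (z a.1) +
    zSign a.2.1 (z a.1) * zSign a.2.2 (genField m z z z a.1)

theorem zSign_genField (x y v : ℕ+ → ℂ) (j : ℕ+) (s : Bool) :
    zSign s (genField m x y v j) = ∑ t : Bool,
      4 * Complex.I * signVal s * genRow m x y (j, !s, t) * zSign t (v j) := by
  cases s
  · rw [zSign, if_neg (by simp), conj_genField]
    simp [signVal]
  · rw [zSign, if_pos rfl, genField]
    simp [signVal]

theorem summable_lieCoef (hm : -1 / 2 ≤ m) (z : BeamSpace w) (j : ℕ+) (b : Bool × Bool) :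
    Summable fun p : PairIdx × (Bool × Bool) =>
      lieCoef m p.1 j b p.2 * pairMon z z p.1 * pairMon z z (j, p.2) := by
  have h1 := (hasSum_pairIdx (summable_beamRatio_mul_sq hm z)).summable
  have h2 := summable_mul_of_summable_norm (f := fun a : PairIdx => beamRatio m a.1 * ‖z a.1‖ ^ 2)
    (g := fun _ : Bool × Bool => (1 : ℝ)) h1.norm (Summable.of_finite)
  refine Summable.of_norm_bounded
    (h2.mul_left (beamC m / (4 * Real.pi * beamMu m) * ‖z j‖ ^ 2)) fun p => ?_
  rw [norm_mul, norm_mul, norm_pairMon, norm_pairMon]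
  have := norm_lieCoef_le hm p.1 j b p.2
  calc _ ≤ beamRatio m p.1.1 * (beamC m / (4 * Real.pi * beamMu m)) *
        (‖z p.1.1‖ * ‖z p.1.1‖) * (‖z j‖ * ‖z j‖) := by gcongr
    _ = _ := by ring

theorem hasSum_pairDeriv (hm : -1 / 2 ≤ m) (z : BeamSpace w) (j : ℕ+) (b : Bool × Bool) :
    HasSum (fun p : PairIdx × (Bool × Bool) =>
      lieCoef m p.1 j b p.2 * pairMon z z p.1 * pairMon z z (j, p.2)) (pairDeriv m z (j, b)) := by
  have hs := summable_lieCoef hm z j b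
  have hr : ∀ s t : Bool, HasSum (fun a => genCoef m a (j, s, t) * pairMon z z a)
      (genRow m z z (j, s, t)) := fun s t => (summable_genRow hm z z (j, s, t)).hasSum
  have h1 := hs.hasSum.prod_fiberwise fun a => hasSum_fintype _
  have h2 : HasSum (fun a : PairIdx => ∑ b' : Bool × Bool,
      lieCoef m a j b b' * pairMon z z a * pairMon z z (j, b')) (pairDeriv m z (j, b)) := by
    have := ((((hr (!b.1) true).mul_right (zSign true (z j))).add
        ((hr (!b.1) false).mul_right (zSign false (z j)))).mul_right
          (4 * Complex.I * signVal b.1 * zSign b.2 (z j))).add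
      ((((hr (!b.2) true).mul_right (zSign true (z j))).add
        ((hr (!b.2) false).mul_right (zSign false (z j)))).mul_right
          (4 * Complex.I * signVal b.2 * zSign b.1 (z j)))
    convert! this using 1
    · funext a
      obtain ⟨s, t⟩ := b
      cases s <;> cases t <;>
      · simp only [lieCoef, Fintype.sum_prod_type, Fintype.sum_bool, pairMon]
        simp
        ring
    · simp only [pairDeriv, zSign_genField, Fintype.sum_bool]
      ring
  rw [h2.unique h1] 
  exact hs.hasSum

theorem tensMon_update (z : ℕ+ → ℂ) (q : Fin n → PairIdx) (k : Fin n) (a : PairIdx) :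
    tensMon z (Function.update q k a) =
      (∏ i ∈ Finset.univ.erase k, pairMon z z (q i)) * pairMon z z a := by
  rw [tensMon, ← Finset.prod_erase_mul _ _ (Finset.mem_univ k), Function.update_self]
  congr 1
  refine Finset.prod_congr rfl fun i hi => ?_
  rw [Function.update_of_ne (Finset.ne_of_mem_erase hi)]

theorem summable_lieTens_term (hm : -1 / 2 ≤ m) {M : ℝ} {c : (Fin n → PairIdx) → ℂ}
    (hc : TensBound m M c) (z : BeamSpace w) (k : Fin n) :
    Summable fun p : (Fin n → PairIdx) × (PairIdx × (Bool × Bool)) =>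
      c p.1 * (lieCoef m p.2.1 (p.1 k).1 (p.1 k).2 p.2.2 * pairMon z z p.2.1 *
        tensMon z (Function.update p.1 k ((p.1 k).1, p.2.2))) := by
  have hM := hc.nonneg hm
  have h1 := (hasSum_pairIdx (summable_beamRatio_mul_sq hm z)).summable
  have h2 := summable_mul_of_summable_norm (f := fun a : PairIdx => beamRatio m a.1 * ‖z a.1‖ ^ 2)
    (g := fun _ : Bool × Bool => (1 : ℝ)) h1.norm (Summable.of_finite)
  have h3 := summable_mul_of_summable_norm (hasSum_prod_ratio hm z n).summable.norm h2.norm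
  refine Summable.of_norm_bounded
    (h3.mul_left (M * (beamC m / (4 * Real.pi * beamMu m)))) fun p => ?_
  have e : ‖tensMon z (Function.update p.1 k ((p.1 k).1, p.2.2))‖ = ∏ i, ‖z (p.1 i).1‖ ^ 2 := by
    rw [norm_tensMon]
    refine Finset.prod_congr rfl fun i _ => ?_
    by_cases h : i = k
    · subst h; simp
    · simp [h]
  rw [norm_mul, norm_mul, norm_mul, norm_pairMon, e]
  have hl := norm_lieCoef_le hm p.2.1 (p.1 k).1 (p.1 k).2 p.2.2
  have hpr : 0 ≤ ∏ i, ‖z (p.1 i).1‖ ^ 2 := Finset.prod_nonneg fun i _ => by positivity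
  have hq : 0 ≤ M * ∏ i, beamRatio m (p.1 i).1 := (norm_nonneg _).trans (hc p.1)
  calc _ ≤ (M * ∏ i, beamRatio m (p.1 i).1) * (beamRatio m p.2.1.1 *
        (beamC m / (4 * Real.pi * beamMu m)) * (‖z p.2.1.1‖ * ‖z p.2.1.1‖) *
          ∏ i, ‖z (p.1 i).1‖ ^ 2) := by
        gcongr
        exact hc p.1
    _ = _ := by
      rw [Finset.prod_mul_distrib]
      ring

/-- For each slot, both sides sum the same absolutely convergent family over `(q, a, b')`: the left
side groups it by `q`, the right side by the new pair and the family with changed signs, through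
`slotEquiv`. -/
theorem tsum_lieDeriv (hm : -1 / 2 ≤ m) {M : ℝ} {c : (Fin n → PairIdx) → ℂ}
    (hc : TensBound m M c) (z : BeamSpace w) :
    ∑' q, c q * ∑ k, (∏ i ∈ Finset.univ.erase k, pairMon z z (q i)) * pairDeriv m z (q k) =
      tensEval (lieTens m c) z := by
  have hk := fun k => (summable_lieTens_term hm hc z k).hasSum
  have hL : ∀ k, HasSum (fun q => c q * ((∏ i ∈ Finset.univ.erase k, pairMon z z (q i)) *
      pairDeriv m z (q k))) _ := fun k => (hk k).prod_fiberwise fun q => by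
    have := ((hasSum_pairDeriv hm z (q k).1 (q k).2).mul_left
      (∏ i ∈ Finset.univ.erase k, pairMon z z (q i))).mul_left (c q)
    convert! this using 1
    funext p
    rw [tensMon_update]
    ring
  have hR : ∀ k, HasSum (fun q : Fin (n + 1) → PairIdx => (∑ b : Bool × Bool,
      lieCoef m (q 0) (Fin.tail q k).1 b (Fin.tail q k).2 *
        c (Function.update (Fin.tail q) k ((Fin.tail q k).1, b))) * tensMon z q) _ := fun k => by
    have h1 := ((slotEquiv k).symm.hasSum_iff.2 (hk k)).prod_fiberwise fun p => hasSum_fintype _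
    rw [← (Fin.consEquiv fun _ : Fin (n + 1) => PairIdx).hasSum_iff]
    convert! h1 using 1
    funext p
    simp only [Function.comp_apply, Fin.consEquiv, Equiv.coe_fn_mk, Fin.cons_zero, Fin.tail_cons,
      slotEquiv, Equiv.coe_fn_symm_mk, Function.update_self, Function.update_idem, Prod.mk.eta,
      Function.update_eq_self]
    rw [Finset.sum_mul]
    refine Finset.sum_congr rfl fun b _ => ?_
    rw [tensMon, Fin.prod_univ_succ]
    simp only [Fin.cons_zero, Fin.cons_succ, tensMon]
    ring
  have h1 := hasSum_sum fun k (_ : k ∈ Finset.univ) => hL k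
  have h2 := hasSum_sum fun k (_ : k ∈ Finset.univ) => hR k
  simp only [← Finset.mul_sum] at h1
  simp only [← Finset.sum_mul] at h2
  rw [h1.tsum_eq]
  exact h2.tsum_eq.symm

end Tensors

/-! ### Polynomials along the flow -/

section AlongFlow

variable {m : ℝ} {w : BeamWeight} {n : ℕ}

/-- Grönwall's inequality forwards, and backwards by reversing time; the 2 bounds `|t|`. -/
theorem norm_le_exp_mul_of_norm_deriv_le {f f' : ℝ → ℂ} {K : ℝ}
    (hf : ∀ t ∈ Set.Ioo (-1 : ℝ) 2, HasDerivAt f (f' t) t)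
    (hK : ∀ t ∈ Set.Ioo (-1 : ℝ) 2, ‖f' t‖ ≤ K * ‖f t‖) (hK0 : 0 ≤ K)
    {t : ℝ} (ht : t ∈ Set.Ioo (-1 : ℝ) 2) : ‖f t‖ ≤ Real.exp (2 * K) * ‖f 0‖ := by
  have key : ∀ (g g' : ℝ → ℂ) (T : ℝ), 0 ≤ T → T ≤ 2 → (∀ s ∈ Set.Icc 0 T, HasDerivAt g (g' s) s) →
      (∀ s ∈ Set.Icc 0 T, ‖g' s‖ ≤ K * ‖g s‖) → ‖g T‖ ≤ Real.exp (2 * K) * ‖g 0‖ := by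
    intro g g' T hT hT2 hg hg'
    have := norm_le_gronwallBound_of_norm_deriv_right_le (f := g) (f' := g') (δ := ‖g 0‖) (K := K)
      (ε := 0) (a := 0) (b := T) (fun s hs => (hg s hs).continuousAt.continuousWithinAt)
      (fun s hs => (hg s ⟨hs.1, hs.2.le⟩).hasDerivWithinAt) le_rfl
      (fun s hs => by rw [add_zero]; exact hg' s ⟨hs.1, hs.2.le⟩) T ⟨hT, le_rfl⟩
    rw [gronwallBound_ε0, mul_comm, mul_comm K] at this
    refine this.trans (mul_le_mul_of_nonneg_right (Real.exp_le_exp.2 ?_) (norm_nonneg _))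
    rw [sub_zero]
    gcongr
  rcases le_total 0 t with h0 | h0
  · exact key f f' t h0 ht.2.le (fun s hs => hf s ⟨by linarith [hs.1], by linarith [hs.2, ht.2]⟩)
      (fun s hs => hK s ⟨by linarith [hs.1], by linarith [hs.2, ht.2]⟩)
  · have hmem : ∀ s ∈ Set.Icc 0 (-t), -s ∈ Set.Ioo (-1 : ℝ) 2 := fun s hs =>
      ⟨by linarith [hs.2, ht.1], by linarith [hs.1]⟩
    have := key (fun s => f (-s)) (fun s => -f' (-s)) (-t) (by linarith) (by linarith [ht.1])
      (fun s hs => by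
        have := (hf (-s) (hmem s hs)).scomp s (hasDerivAt_neg s)
        rw [neg_smul, one_smul] at this
        exact this)
      (fun s hs => by rw [norm_neg]; exact hK (-s) (hmem s hs))
    simpa using this

section Curve

variable (hm : -1 / 2 ≤ m) {r ρ : ℝ} (hr : 0 < r) {c : ℝ → BeamSpace w}
  (hc : IsFlowCurve (genFieldCLM w hm hr) ρ c)

include hc

theorem hasDerivAt_curve_apply {t : ℝ} (ht : t ∈ Set.Ioo (-1 : ℝ) 2) (j : ℕ+) :
    HasDerivAt (fun t => c t j) (genField m (c t) (c t) (c t) j) t :=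
  ((BeamSpace.coord j).hasFDerivAt.comp_hasDerivAt t (hc t ht).1)

theorem norm_genField_curve_le {t : ℝ} (ht : t ∈ Set.Ioo (-1 : ℝ) 2) (j : ℕ+) :
    ‖genField m (c t) (c t) (c t) j‖ ≤ fieldConst m w r * ρ ^ 2 * ‖c t j‖ := by
  have h1 := norm_genField_le hm hr (c t) (c t) (c t) j
  have h2 := (hc t ht).2
  have h3 := fieldConst_nonneg (w := w) hm r
  calc _ ≤ fieldConst m w r * ‖c t‖ * ‖c t‖ * ‖c t j‖ := h1
    _ = fieldConst m w r * ‖c t‖ ^ 2 * ‖c t j‖ := by ring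
    _ ≤ _ := by gcongr

/-- The constant does not depend on the mode. All series along the trajectory are thus dominated by
series at time 0, for termwise differentiation and for the finiteness of `Λ`. -/
theorem exists_norm_curve_apply_le : ∃ C : ℝ, 0 ≤ C ∧ ∀ t ∈ Set.Ioo (-1 : ℝ) 2, ∀ j,
    ‖c t j‖ ≤ C * ‖c 0 j‖ := by
  have h3 := fieldConst_nonneg (w := w) hm r
  exact ⟨_, (Real.exp_pos _).le, fun t ht j => norm_le_exp_mul_of_norm_deriv_le
    (fun t ht => hasDerivAt_curve_apply hm hr hc ht j)
    (fun t ht => norm_genField_curve_le hm hr hc ht j) (by positivity) ht⟩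

theorem hasDerivAt_zSign_curve {t : ℝ} (ht : t ∈ Set.Ioo (-1 : ℝ) 2) (j : ℕ+) (s : Bool) :
    HasDerivAt (fun t => zSign s (c t j)) (zSign s (genField m (c t) (c t) (c t) j)) t := by
  have h := hasDerivAt_curve_apply hm hr hc ht j
  cases s
  · exact Complex.conjCLE.hasFDerivAt.comp_hasDerivAt t h
  · exact h

theorem hasDerivAt_pairMon_curve {t : ℝ} (ht : t ∈ Set.Ioo (-1 : ℝ) 2) (a : PairIdx) :
    HasDerivAt (fun t => pairMon (c t) (c t) a) (pairDeriv m (c t) a) t :=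
  (hasDerivAt_zSign_curve hm hr hc ht a.1 a.2.1).mul
    (hasDerivAt_zSign_curve hm hr hc ht a.1 a.2.2)

theorem norm_pairDeriv_curve_le {t : ℝ} (ht : t ∈ Set.Ioo (-1 : ℝ) 2) (a : PairIdx) :
    ‖pairDeriv m (c t) a‖ ≤ 2 * (fieldConst m w r * ρ ^ 2) * ‖c t a.1‖ ^ 2 := by
  have h := norm_genField_curve_le hm hr hc ht a.1
  refine (norm_add_le _ _).trans ?_
  simp only [norm_mul, norm_zSign]
  nlinarith [norm_nonneg (c t a.1)]

theorem hasDerivAt_tensMon_curve {t : ℝ} (ht : t ∈ Set.Ioo (-1 : ℝ) 2) (q : Fin n → PairIdx) :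
    HasDerivAt (fun t => tensMon (c t) q)
      (∑ k, (∏ i ∈ Finset.univ.erase k, pairMon (c t) (c t) (q i)) * pairDeriv m (c t) (q k)) t := by
  have := HasDerivAt.fun_finsetProd (u := Finset.univ) (f := fun k s => pairMon (c s) (c s) (q k))
    (f' := fun k => pairDeriv m (c t) (q k)) fun k _ => hasDerivAt_pairMon_curve hm hr hc ht (q k)
  simp only [smul_eq_mul] at this
  exact this

theorem norm_tensMon_deriv_le {t : ℝ} (ht : t ∈ Set.Ioo (-1 : ℝ) 2) (q : Fin n → PairIdx) :
    ‖∑ k, (∏ i ∈ Finset.univ.erase k, pairMon (c t) (c t) (q i)) * pairDeriv m (c t) (q k)‖ ≤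
      n * (2 * (fieldConst m w r * ρ ^ 2)) * ∏ i, ‖c t (q i).1‖ ^ 2 := by
  have hterm : ∀ k ∈ (Finset.univ : Finset (Fin n)),
      ‖(∏ i ∈ Finset.univ.erase k, pairMon (c t) (c t) (q i)) * pairDeriv m (c t) (q k)‖ ≤
        2 * (fieldConst m w r * ρ ^ 2) * ∏ i, ‖c t (q i).1‖ ^ 2 := by
    intro k hk
    rw [norm_mul, norm_prod, ← Finset.prod_erase_mul _ _ hk]
    simp only [norm_pairMon, ← sq]
    rw [mul_left_comm]
    exact mul_le_mul_of_nonneg_left (norm_pairDeriv_curve_le hm hr hc ht (q k))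
      (Finset.prod_nonneg fun _ _ => by positivity)
  refine (norm_sum_le_of_le _ hterm).trans (le_of_eq ?_)
  rw [Finset.sum_const, Finset.card_univ, Fintype.card_fin, nsmul_eq_mul, ← mul_assoc]

theorem hasDerivAt_tensEval_curve {M : ℝ} {a : (Fin n → PairIdx) → ℂ} (ha : TensBound m M a)
    {t : ℝ} (ht : t ∈ Set.Ioo (-1 : ℝ) 2) :
    HasDerivAt (fun t => tensEval a (c t)) (tensEval (lieTens m a) (c t)) t := by
  obtain ⟨C, hC, hgrow⟩ := exists_norm_curve_apply_le hm hr hc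
  have h3 := fieldConst_nonneg (w := w) hm r
  obtain ⟨K, hK⟩ : ∃ K, K = n * (2 * (fieldConst m w r * ρ ^ 2)) := ⟨_, rfl⟩
  have hK0 : 0 ≤ K := by rw [hK]; positivity
  have hbound : ∀ (q : Fin n → PairIdx), ∀ s ∈ Set.Ioo (-1 : ℝ) 2,
      ‖a q * ∑ k, (∏ i ∈ Finset.univ.erase k, pairMon (c s) (c s) (q i)) *
        pairDeriv m (c s) (q k)‖ ≤
      (K * (C ^ 2) ^ n * M) * ∏ k, beamRatio m (q k).1 * ‖c 0 (q k).1‖ ^ 2 := by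
    intro q s hs
    have hprod : ∏ i, ‖c s (q i).1‖ ^ 2 ≤ (C ^ 2) ^ n * ∏ i, ‖c 0 (q i).1‖ ^ 2 := by
      have : (C ^ 2) ^ n * ∏ i, ‖c 0 (q i).1‖ ^ 2 = ∏ i : Fin n, (C * ‖c 0 (q i).1‖) ^ 2 := by
        simp [mul_pow, Finset.prod_mul_distrib]
      rw [this]
      refine Finset.prod_le_prod (fun _ _ => by positivity) fun i _ => ?_
      have := hgrow s hs (q i).1
      gcongr
    have h1 := norm_tensMon_deriv_le hm hr hc hs q
    rw [← hK] at h1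
    rw [norm_mul, Finset.prod_mul_distrib]
    calc _ ≤ (M * ∏ k, beamRatio m (q k).1) * (K * ((C ^ 2) ^ n * ∏ i, ‖c 0 (q i).1‖ ^ 2)) :=
          mul_le_mul (ha q) (h1.trans (mul_le_mul_of_nonneg_left hprod hK0)) (norm_nonneg _)
            ((norm_nonneg _).trans (ha q))
      _ = _ := by ring
  have hsum : Summable fun q : Fin n → PairIdx =>
      (K * (C ^ 2) ^ n * M) * ∏ k, beamRatio m (q k).1 * ‖c 0 (q k).1‖ ^ 2 :=
    (hasSum_prod_ratio hm (c 0) n).summable.mul_left _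
  rw [← tsum_lieDeriv hm ha (c t)]
  exact hasDerivAt_tsum_of_isPreconnected hsum isOpen_Ioo isPreconnected_Ioo
    (fun q s hs => (hasDerivAt_tensMon_curve hm hr hc hs q).const_mul (a q))
    (fun q s hs => hbound q s hs) (by norm_num : (0 : ℝ) ∈ Set.Ioo (-1 : ℝ) 2)
    (ha.summable hm (c 0)) ht

end Curve

end AlongFlow

/-! ### The quartic polynomials -/

section Quartic

variable {m : ℝ} {w : BeamWeight}

/-- The coefficients of `G`. -/
noncomputable def quartTens (m : ℝ) (q : Fin 2 → PairIdx) : ℂ := quarticCoef m (q 0) (q 1)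

/-- The coefficients of `G - Ḡ`. -/
noncomputable def nonresTens (m : ℝ) (q : Fin 2 → PairIdx) : ℂ :=
  if pairFreq m (q 0) + pairFreq m (q 1) = 0 then 0 else quarticCoef m (q 0) (q 1)

theorem tensBound_quartTens (hm : -1 / 2 ≤ m) : TensBound m (1 / (32 * Real.pi)) (quartTens m) := by
  intro q
  rw [quartTens, Complex.norm_real, Real.norm_of_nonneg (quarticCoef_nonneg hm _ _),
    Fin.prod_univ_two, quarticCoef]
  exact le_of_eq (by ring)

theorem tensBound_nonresTens (hm : -1 / 2 ≤ m) :
    TensBound m (1 / (32 * Real.pi)) (nonresTens m) := by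
  intro q
  have h := tensBound_quartTens hm q
  rw [nonresTens]
  split_ifs
  · rw [norm_zero]
    exact (norm_nonneg _).trans h
  · exact h

theorem tensEval_two (f : PairIdx → PairIdx → ℂ) (z : ℕ+ → ℂ) :
    tensEval (fun q : Fin 2 → PairIdx => f (q 0) (q 1)) z =
      ∑' p : PairIdx × PairIdx, f p.1 p.2 * (pairMon z z p.1 * pairMon z z p.2) := by
  rw [tensEval, ← (finTwoArrowEquiv PairIdx).symm.tsum_eq]
  refine tsum_congr fun p => ?_
  simp [tensMon, finTwoArrowEquiv]

theorem hasSum_tensEval_two (hm : -1 / 2 ≤ m) {M : ℝ} {f : PairIdx → PairIdx → ℂ}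
    (hf : TensBound m M (fun q : Fin 2 → PairIdx => f (q 0) (q 1))) (z : BeamSpace w) :
    HasSum (fun p : PairIdx × PairIdx => f p.1 p.2 * (pairMon z z p.1 * pairMon z z p.2))
      (tensEval (fun q : Fin 2 → PairIdx => f (q 0) (q 1)) z) := by
  have := (finTwoArrowEquiv PairIdx).symm.hasSum_iff.2 (hf.summable hm z).hasSum
  refine this.congr_fun fun p => ?_
  simp [tensMon, finTwoArrowEquiv]

theorem tensEval_quartTens (hm : -1 / 2 ≤ m) (z : BeamSpace w) :
    tensEval (quartTens m) z = (beamG m z : ℂ) := by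
  have hs : Summable fun a : PairIdx => (beamRatio m a.1 : ℂ) * pairMon z z a := by
    refine Summable.of_norm_bounded (hasSum_pairIdx (summable_beamRatio_mul_sq hm z)).summable
      fun a => ?_
    rw [norm_mul, norm_pairMon, Complex.norm_real, Real.norm_of_nonneg (beamRatio_pos hm _).le, sq]
  have h1 : ∑' a : PairIdx, (beamRatio m a.1 : ℂ) * pairMon z z a =
      ((∑' j : ℕ+, (j : ℝ) ^ 2 / beamOmega m j * (2 * (z j).re) ^ 2 : ℝ) : ℂ) := by
    rw [← (hasSum_pairIdx_of_hasSum hs).tsum_eq, Complex.ofReal_tsum]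
    refine tsum_congr fun j => ?_
    have hre : ((2 * (z j).re : ℝ) : ℂ) = z j + conj (z j) := by
      rw [Complex.add_conj]
    rw [Complex.ofReal_mul, Complex.ofReal_pow, hre]
    simp only [Fintype.sum_prod_type, Fintype.sum_bool, pairMon, zSign, if_true,
      Bool.false_eq_true, if_false, beamRatio]
    ring
  have h2 := tsum_mul_tsum_of_summable_norm hs.norm hs.norm
  have h3 := tensEval_two (fun a b => (quarticCoef m a b : ℂ)) z
  change tensEval (fun q : Fin 2 → PairIdx => (quarticCoef m (q 0) (q 1) : ℂ)) z = _
  rw [h3, beamG, Complex.ofReal_mul, Complex.ofReal_pow, ← h1, sq, h2, ← tsum_mul_left]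
  refine tsum_congr fun p => ?_
  rw [quarticCoef]
  push_cast
  ring

/-- The resonant monomials with indices `i`, `j`. -/
theorem sum_resonant (hm : -1 / 2 ≤ m) (z : ℕ+ → ℂ) (i j : ℕ+) :
    ∑ b : (Bool × Bool) × (Bool × Bool),
      (if pairFreq m (i, b.1) + pairFreq m (j, b.2) = 0 then
        (quarticCoef m (i, b.1) (j, b.2) : ℂ) else 0) *
          (pairMon z z (i, b.1) * pairMon z z (j, b.2)) =
      ((beamA m i j * ‖z i‖ ^ 2 * ‖z j‖ ^ 2 : ℝ) : ℂ) := by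
  have hi := beamOmega_pos hm i
  have hj := beamOmega_pos hm j
  have hn : ∀ k, ((‖z k‖ ^ 2 : ℝ) : ℂ) = z k * conj (z k) := fun k => by
    rw [Complex.mul_conj, Complex.normSq_eq_norm_sq]
  have hπ : (Real.pi : ℂ) ≠ 0 := Complex.ofReal_ne_zero.2 Real.pi_ne_zero
  have hi' : (beamOmega m i : ℂ) ≠ 0 := Complex.ofReal_ne_zero.2 hi.ne'
  have hj' : (beamOmega m j : ℂ) ≠ 0 := Complex.ofReal_ne_zero.2 hj.ne'
  rw [Complex.ofReal_mul, Complex.ofReal_mul, hn, hn, beamA]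
  have h1 : (1 + 1) * beamOmega m i + (1 + 1) * beamOmega m j ≠ 0 := by positivity
  have h2 : (-1 + -1) * beamOmega m i + (-1 + -1) * beamOmega m j ≠ 0 := by
    intro h; nlinarith
  have h3 : (1 + 1) * beamOmega m i ≠ 0 := by positivity
  have h4 : (1 + 1) * beamOmega m j ≠ 0 := by positivity
  have h5 : (-1 + -1) * beamOmega m i ≠ 0 := by intro h; nlinarith
  have h6 : (-1 + -1) * beamOmega m j ≠ 0 := by intro h; nlinarith
  -- The four products of two mixed pairs are always resonant, whence `4/(32π) = 1/(8π)`. For `i =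
  -- j` the two products of `z z` with `z̄ z̄` join them, whence `6/(32π) = 3/(16π)`.
  by_cases hij : i = j
  · subst hij
    have h7 : (1 + 1) * beamOmega m i + (-1 + -1) * beamOmega m i = 0 := by ring
    have h8 : (-1 + -1) * beamOmega m i + (1 + 1) * beamOmega m i = 0 := by ring
    simp only [Fintype.sum_prod_type, Fintype.sum_bool, pairFreq, signVal, pairMon, zSign, if_true,
      Bool.false_eq_true, if_false, add_neg_cancel, neg_add_cancel, zero_mul, zero_add, add_zero,
      h1, h2, h3, h5, h7, h8, quarticCoef, beamRatio]
    push_cast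
    field_simp
    ring
  · have hne : beamOmega m i ≠ beamOmega m j := fun h => hij (beamOmega_injective hm h)
    have h7 : (1 + 1) * beamOmega m i + (-1 + -1) * beamOmega m j ≠ 0 := by
      intro h; apply hne; linarith
    have h8 : (-1 + -1) * beamOmega m i + (1 + 1) * beamOmega m j ≠ 0 := by
      intro h; apply hne; linarith
    simp only [Fintype.sum_prod_type, Fintype.sum_bool, pairFreq, signVal, pairMon, zSign, if_true,
      Bool.false_eq_true, if_false, add_neg_cancel, neg_add_cancel, zero_mul, zero_add, add_zero,
      h1, h2, h3, h4, h5, h6, h7, h8, quarticCoef, beamRatio, hij]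
    push_cast
    field_simp
    ring

theorem tensEval_nonresTens (hm : -1 / 2 ≤ m) (z : BeamSpace w) :
    tensEval (nonresTens m) z = ((beamG m z - beamGbar m z : ℝ) : ℂ) := by
  have hq := hasSum_tensEval_two hm (f := fun a b => (quarticCoef m a b : ℂ))
    (tensBound_quartTens hm) z
  have hn := hasSum_tensEval_two hm (f := fun a b => if pairFreq m a + pairFreq m b = 0 then 0
    else (quarticCoef m a b : ℂ)) (tensBound_nonresTens hm) z
  have hr := hq.sub hn
  rw [← (Equiv.prodProdProdComm ℕ+ ℕ+ (Bool × Bool) (Bool × Bool)).hasSum_iff] at hr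
  have hf := hr.prod_fiberwise fun p => hasSum_fintype _
  have he : HasSum (fun p : ℕ+ × ℕ+ =>
      ((beamA m p.1 p.2 * ‖z p.1‖ ^ 2 * ‖z p.2‖ ^ 2 : ℝ) : ℂ))
      (tensEval (quartTens m) z - tensEval (nonresTens m) z) := by
    refine hf.congr_fun fun p => ?_
    rw [← sum_resonant hm z p.1 p.2]
    refine Finset.sum_congr rfl fun b _ => ?_
    simp only [Function.comp_apply, Equiv.prodProdProdComm_apply]
    split_ifs <;> ring
  have := he.tsum_eq
  rw [← Complex.ofReal_tsum, tensEval_quartTens hm] at this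
  rw [Complex.ofReal_sub, beamGbar, this]
  ring

end Quartic

/-! ### The quadratic part along the flow -/

section Lambda

variable {m : ℝ} {w : BeamWeight}

/-- The pair `(true, false)` is `|z_j|²`, so this is one term of the derivative of `Λ`. The
contributions of mixed pairs cancel, in accordance with their frequency 0. -/
theorem pairDeriv_mixed (z : ℕ+ → ℂ) (j : ℕ+) :
    (beamOmega m j : ℂ) * pairDeriv m z (j, true, false) = -(2 * Complex.I) *
      ∑ b : Bool × Bool, (pairFreq m (j, b) : ℂ) * (genRow m z z (j, b) * pairMon z z (j, b)) := by
  have hsw : genRow m z z (j, false, true) = genRow m z z (j, true, false) :=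
    genRow_swap z z (j, true, false)
  simp only [pairDeriv, zSign_genField, Fintype.sum_prod_type, Fintype.sum_bool, pairFreq, pairMon,
    signVal, if_true, Bool.false_eq_true, if_false, Bool.not_true, Bool.not_false, hsw]
  push_cast
  ring

/-- The unbounded factor `ω_j` in the frequency is compensated by the finiteness of `Λ`. -/
theorem summable_pairFreq_mul (hm : -1 / 2 ≤ m) (z : BeamSpace w) (hz : LambdaFinite m z) :
    Summable fun p : PairIdx × PairIdx => (pairFreq m p.2 : ℂ) *
      (genCoef m p.1 p.2 * (pairMon z z p.1 * pairMon z z p.2)) := by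
  have h1 := (hasSum_pairIdx (summable_beamRatio_mul_sq hm z)).summable
  have h2 := (hasSum_pairIdx hz).summable
  have hμ := beamMu_pos hm
  have hπ := Real.pi_pos
  refine Summable.of_norm_bounded ((summable_mul_of_summable_norm h1.norm h2.norm).mul_left
    (2 * beamC m / (32 * Real.pi * beamMu m))) fun p => ?_
  have hω := beamOmega_pos hm p.2.1
  have hρ := beamRatio_pos hm p.1.1
  have hs : ∀ s, |signVal s| = 1 := by intro s; cases s <;> simp [signVal]
  have hf : ‖(pairFreq m p.2 : ℂ)‖ ≤ 2 * beamOmega m p.2.1 := by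
    rw [Complex.norm_real, pairFreq, norm_mul, Real.norm_of_nonneg hω.le]
    have := abs_add_le (signVal p.2.2.1) (signVal p.2.2.2)
    rw [hs, hs] at this
    rw [Real.norm_eq_abs]
    gcongr
    linarith
  have hg := norm_genCoef_le hm p.1 p.2
  have hc := beamRatio_le hm p.2.1
  rw [norm_mul, norm_mul, norm_mul, norm_pairMon, norm_pairMon]
  calc _ ≤ (2 * beamOmega m p.2.1) * ((beamRatio m p.1.1 * beamC m / (32 * Real.pi * beamMu m)) *
        (‖z p.1.1‖ * ‖z p.1.1‖ * (‖z p.2.1‖ * ‖z p.2.1‖))) := by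
        gcongr
        exact hg.trans (by gcongr)
    _ = _ := by ring

/-- The homological equation. The derivative of `Λ` is `-2i ∑ f_b s(a,b) z_a z_b`, with `f` the
frequencies and `s` the coefficients `genCoef`. Symmetry of `s` replaces `2 f_b` by `f_a + f_b`,
which cancels the denominator and leaves `(-i)(-i) N = -N`. -/
theorem hasSum_lambda_deriv (hm : -1 / 2 ≤ m) (z : BeamSpace w) (hz : LambdaFinite m z) :
    HasSum (fun j : ℕ+ => (beamOmega m j : ℂ) * pairDeriv m z (j, true, false))
      (-tensEval (nonresTens m) z) := by
  have hs := summable_pairFreq_mul hm z hz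
  have hs' := (Equiv.prodComm PairIdx PairIdx).hasSum_iff.2 hs.hasSum
  have h1 : HasSum (fun p : PairIdx × PairIdx => (pairFreq m p.1 : ℂ) *
      (genCoef m p.1 p.2 * (pairMon z z p.1 * pairMon z z p.2))) (∑' p : PairIdx × PairIdx,
        (pairFreq m p.2 : ℂ) * (genCoef m p.1 p.2 * (pairMon z z p.1 * pairMon z z p.2))) := by
    refine hs'.congr_fun fun p => ?_
    simp only [Function.comp_apply, Equiv.prodComm_apply, Prod.fst_swap, Prod.snd_swap]
    rw [genCoef_symm]
    ring
  have hn := hasSum_tensEval_two hm (f := fun a b => if pairFreq m a + pairFreq m b = 0 then 0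
    else (quarticCoef m a b : ℂ)) (tensBound_nonresTens hm) z
  have h2 := h1.add hs.hasSum
  have h3 := hn.mul_left (-Complex.I)
  have h4 := h2.unique (h3.congr_fun fun p => by
    have := genCoef_mul_freq (m := m) p.1 p.2
    push_cast at this
    linear_combination (pairMon z z p.1 * pairMon z z p.2) * this)
  have h5 : HasSum (fun b : PairIdx => (pairFreq m b : ℂ) *
      (genRow m z z b * pairMon z z b)) (∑' p : PairIdx × PairIdx,
        (pairFreq m p.2 : ℂ) * (genCoef m p.1 p.2 * (pairMon z z p.1 * pairMon z z p.2))) :=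
    hs'.prod_fiberwise fun b => by
      have := (((summable_genRow hm z z b).hasSum.mul_right (pairMon z z b)).mul_left
        (pairFreq m b : ℂ))
      refine this.congr_fun fun a => ?_
      simp only [Function.comp_apply, Equiv.prodComm_apply, Prod.fst_swap, Prod.snd_swap]
      ring
  have h6 := (h5.prod_fiberwise fun j => hasSum_fintype _).mul_left (-(2 * Complex.I))
  have e : -(2 * Complex.I) * (∑' p : PairIdx × PairIdx,
      (pairFreq m p.2 : ℂ) * (genCoef m p.1 p.2 * (pairMon z z p.1 * pairMon z z p.2))) =
      -tensEval (nonresTens m) z := by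
    change _ = -tensEval (fun q : Fin 2 → PairIdx =>
      if pairFreq m (q 0) + pairFreq m (q 1) = 0 then 0 else (quarticCoef m (q 0) (q 1) : ℂ)) z
    linear_combination (-Complex.I) * h4 + tensEval (fun q : Fin 2 → PairIdx =>
      if pairFreq m (q 0) + pairFreq m (q 1) = 0 then 0 else (quarticCoef m (q 0) (q 1) : ℂ)) z *
        Complex.I_sq
  rw [← e]
  refine h6.congr_fun fun j => ?_
  rw [pairDeriv_mixed]

theorem ofReal_beamLambda (z : BeamSpace w) :
    (beamLambda m z : ℂ) = ∑' j : ℕ+, (beamOmega m j : ℂ) * pairMon z z (j, true, false) := by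
  rw [beamLambda, Complex.ofReal_tsum]
  refine tsum_congr fun j => ?_
  rw [Complex.ofReal_mul, pairMon]
  simp only [zSign, if_true, Bool.false_eq_true, if_false]
  rw [Complex.mul_conj, Complex.normSq_eq_norm_sq]

section Curve

variable (hm : -1 / 2 ≤ m) {r ρ : ℝ} (hr : 0 < r) {c : ℝ → BeamSpace w}
  (hc : IsFlowCurve (genFieldCLM w hm hr) ρ c) (h0 : LambdaFinite m (c 0))

include hc h0

theorem exists_beamLambda_curve_le : ∃ B : ℝ, ∀ t ∈ Set.Ioo (-1 : ℝ) 2,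
    LambdaFinite m (c t) ∧ ‖(beamLambda m (c t) : ℂ)‖ ≤ B := by
  obtain ⟨C, hC, hgrow⟩ := exists_norm_curve_apply_le hm hr hc
  refine ⟨C ^ 2 * beamLambda m (c 0), fun t ht => ?_⟩
  have hle : ∀ j, beamOmega m j * ‖c t j‖ ^ 2 ≤ C ^ 2 * (beamOmega m j * ‖c 0 j‖ ^ 2) := by
    intro j
    have := beamOmega_pos hm j
    calc _ ≤ beamOmega m j * (C * ‖c 0 j‖) ^ 2 := by
          have := hgrow t ht j
          gcongr
      _ = _ := by ring
  have hpos : ∀ j, 0 ≤ beamOmega m j * ‖c t j‖ ^ 2 := fun j => by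
    have := beamOmega_pos hm j
    positivity
  have hf : LambdaFinite m (c t) := Summable.of_nonneg_of_le hpos hle (h0.mul_left _)
  refine ⟨hf, ?_⟩
  rw [Complex.norm_real, Real.norm_of_nonneg (show 0 ≤ beamLambda m (c t) from tsum_nonneg hpos),
    beamLambda, beamLambda, ← tsum_mul_left]
  exact hf.tsum_le_tsum hle (h0.mul_left _)

theorem hasDerivAt_beamLambda_curve {t : ℝ} (ht : t ∈ Set.Ioo (-1 : ℝ) 2) :
    HasDerivAt (fun t => (beamLambda m (c t) : ℂ)) (-tensEval (nonresTens m) (c t)) t := by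
  obtain ⟨B, hB⟩ := exists_beamLambda_curve_le hm hr hc h0
  obtain ⟨C, hC, hgrow⟩ := exists_norm_curve_apply_le hm hr hc
  have h3 := fieldConst_nonneg (w := w) hm r
  rw [← (hasSum_lambda_deriv hm (c t) (hB t ht).1).tsum_eq]
  simp only [ofReal_beamLambda]
  have hsum : Summable fun j : ℕ+ => (2 * (fieldConst m w r * ρ ^ 2) * C ^ 2) *
      (beamOmega m j * ‖c 0 j‖ ^ 2) := h0.mul_left _
  refine hasDerivAt_tsum_of_isPreconnected hsum isOpen_Ioo isPreconnected_Ioo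
    (fun j s hs => (hasDerivAt_pairMon_curve hm hr hc hs (j, true, false)).const_mul
      (beamOmega m j : ℂ)) (fun j s hs => ?_) (by norm_num : (0 : ℝ) ∈ Set.Ioo (-1 : ℝ) 2) ?_ ht
  · have hω := beamOmega_pos hm j
    have h1 := norm_pairDeriv_curve_le hm hr hc hs (j, true, false)
    have h2 := hgrow s hs j
    rw [norm_mul, Complex.norm_real, Real.norm_of_nonneg hω.le]
    calc _ ≤ beamOmega m j * (2 * (fieldConst m w r * ρ ^ 2) * (C * ‖c 0 j‖) ^ 2) := by
          gcongr
          exact h1.trans (by dsimp only; gcongr)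
      _ = _ := by ring
  · refine Summable.of_norm_bounded h0 fun j => ?_
    have hω := beamOmega_pos hm j
    rw [norm_mul, Complex.norm_real, Real.norm_of_nonneg hω.le, norm_pairMon, sq]

end Curve

end Lambda

/-! ### The Lie series of the Hamiltonian -/

section LieSeries

variable {m : ℝ} {w : BeamWeight}

/-- The coefficients of the iterated Lie derivatives of a quartic polynomial. -/
noncomputable def lieIter (m : ℝ) (a : (Fin 2 → PairIdx) → ℂ) :
    (k : ℕ) → (Fin (k + 2) → PairIdx) → ℂ
  | 0 => a
  | k + 1 => lieTens m (lieIter m a k)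

/-- The bound of the coefficients of the `k`-th Lie derivative. -/
noncomputable def lieBound (m : ℝ) (k : ℕ) : ℝ :=
  1 / (32 * Real.pi) * (beamC m / (Real.pi * beamMu m)) ^ k * (k + 1).factorial

theorem tensBound_lieIter (hm : -1 / 2 ≤ m) {a : (Fin 2 → PairIdx) → ℂ}
    (ha : TensBound m (1 / (32 * Real.pi)) a) (k : ℕ) :
    TensBound m (lieBound m k) (lieIter m a k) := by
  induction k with
  | zero =>
    have e : lieBound m 0 = 1 / (32 * Real.pi) := by simp [lieBound]
    rw [e]
    exact ha
  | succ k ih =>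
    have h := ih.lieTens hm
    have e : ((k + 2 : ℕ) : ℝ) * (beamC m / (Real.pi * beamMu m)) * lieBound m k =
        lieBound m (k + 1) := by
      rw [lieBound, lieBound, Nat.factorial_succ (k + 1), pow_succ]
      push_cast
      ring
    rw [e] at h
    exact h

/-- Each derivative costs `4 (fieldConst) ρ² ≤ 1/4`. Writing `(k+1)! = (k+1) k!` and using `k + 1 ≤
2^k` leaves the form `k! (1/2)^k` required by `hasSum_taylor_of_bound`. -/
theorem norm_tensEval_lieIter_le (hm : -1 / 2 ≤ m) {a : (Fin 2 → PairIdx) → ℂ}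
    (ha : TensBound m (1 / (32 * Real.pi)) a) {r ρ : ℝ} (hr : 0 < r)
    (h : 16 * (fieldConst m w r * ρ ^ 2) ≤ 1) (k : ℕ) {z : BeamSpace w} (hz : ‖z‖ ≤ ρ) :
    ‖tensEval (lieIter m a k) z‖ ≤
      (1 / (32 * Real.pi) * (4 * ((beamGamma m w r / r) ^ 2 * ρ ^ 2)) ^ 2) * k.factorial *
        (1 / 2) ^ k := by
  have h1 := (tensBound_lieIter hm ha k).norm_tensEval_le hm z
  have hμ := beamMu_pos hm
  have hC := beamC_pos hm
  have hπ := Real.pi_pos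
  have hb : 0 ≤ lieBound m k := by unfold lieBound; positivity
  have h2 : normW0 m z ^ 2 ≤ (beamGamma m w r / r) ^ 2 * ρ ^ 2 :=
    (normW0_sq_le hm hr z).trans (by gcongr)
  set X := 4 * ((beamGamma m w r / r) ^ 2 * ρ ^ 2) with hX
  have hX0 : 0 ≤ X := by positivity
  have hx : beamC m / (Real.pi * beamMu m) * X ≤ 1 / 4 := by
    have : beamC m / (Real.pi * beamMu m) * X = 4 * (fieldConst m w r * ρ ^ 2) := by
      rw [hX, fieldConst]; ring
    rw [this]
    linarith
  have hk : ((k : ℝ) + 1) ≤ 2 ^ k := by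
    have := one_add_mul_le_pow (by norm_num : (-2 : ℝ) ≤ 1) k
    norm_num at this
    linarith
  calc _ ≤ lieBound m k * X ^ (k + 2) := by
        refine h1.trans ?_
        gcongr
        rw [hX]
        gcongr
    _ = (1 / (32 * Real.pi) * X ^ 2) * k.factorial *
        ((beamC m / (Real.pi * beamMu m) * X) ^ k * ((k : ℝ) + 1)) := by
        rw [lieBound, Nat.factorial_succ]
        push_cast
        ring
    _ ≤ (1 / (32 * Real.pi) * X ^ 2) * k.factorial * ((1 / 4) ^ k * 2 ^ k) := by gcongr
    _ = _ := by
        rw [← mul_pow]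
        norm_num

section Curve

variable (hm : -1 / 2 ≤ m) {r ρ : ℝ} (hr : 0 < r) {c : ℝ → BeamSpace w}
  (hc : IsFlowCurve (genFieldCLM w hm hr) ρ c) (h : 16 * (fieldConst m w r * ρ ^ 2) ≤ 1)

include hc h

theorem hasSum_lieSeries {a : (Fin 2 → PairIdx) → ℂ} (ha : TensBound m (1 / (32 * Real.pi)) a) :
    HasSum (fun k : ℕ => ((k.factorial : ℝ)⁻¹) • tensEval (lieIter m a k) (c 0))
      (tensEval a (c 1)) := by
  have hI : ∀ t ∈ Set.Icc (0 : ℝ) 1, t ∈ Set.Ioo (-1 : ℝ) 2 := fun t ht =>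
    ⟨by linarith [ht.1], by linarith [ht.2]⟩
  exact hasSum_taylor_of_bound (f := fun k t => tensEval (lieIter m a k) (c t))
    (by norm_num : (0 : ℝ) ≤ 1 / 2) (by norm_num)
    (fun k t ht => hasDerivAt_tensEval_curve hm hr hc (tensBound_lieIter hm ha k) (hI t ht))
    (fun k t ht => norm_tensEval_lieIter_le hm ha hr h k (hc t (hI t ht)).2)

theorem hasSum_lieSeries_lambda (h0 : LambdaFinite m (c 0)) :
    HasSum (fun k : ℕ => (((k + 1).factorial : ℝ)⁻¹) •
      -tensEval (lieIter m (nonresTens m) k) (c 0))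
      ((beamLambda m (c 1) : ℂ) - (beamLambda m (c 0) : ℂ)) := by
  have hI : ∀ t ∈ Set.Icc (0 : ℝ) 1, t ∈ Set.Ioo (-1 : ℝ) 2 := fun t ht =>
    ⟨by linarith [ht.1], by linarith [ht.2]⟩
  obtain ⟨B, hB⟩ := exists_beamLambda_curve_le hm hr hc h0
  have hπ := Real.pi_pos
  set B' := 1 / (32 * Real.pi) * (4 * ((beamGamma m w r / r) ^ 2 * ρ ^ 2)) ^ 2 with hB'
  have hB'0 : 0 ≤ B' := by positivity
  have hB0 : 0 ≤ B := (norm_nonneg _).trans (hB 0 (by norm_num)).2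
  -- The successive derivatives of `Λ` along the curve are `Λ`, then `-L^k N`. The shift of the
  -- index costs a factor 2 in the geometric bound, whence `2 * B'` below.
  set f : ℕ → ℝ → ℂ := fun k t => Nat.casesOn k (beamLambda m (c t) : ℂ)
    (fun k => -tensEval (lieIter m (nonresTens m) k) (c t)) with hf
  have hs := hasSum_taylor_of_bound (f := f) (B := B + 2 * B')
    (by norm_num : (0 : ℝ) ≤ 1 / 2) (by norm_num) ?_ ?_
  · rw [← hasSum_nat_add_iff' 1] at hs
    simpa [hf] using hs
  · intro k t ht
    cases k with
    | zero => exact hasDerivAt_beamLambda_curve hm hr hc h0 (hI t ht)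
    | succ k =>
      exact (hasDerivAt_tensEval_curve hm hr hc
        (tensBound_lieIter hm (tensBound_nonresTens hm) k) (hI t ht)).neg
  · intro k t ht
    cases k with
    | zero =>
      have := (hB t (hI t ht)).2
      simp only [Nat.factorial_zero, Nat.cast_one, pow_zero, mul_one]
      change ‖(beamLambda m (c t) : ℂ)‖ ≤ _
      linarith
    | succ k =>
      have := norm_tensEval_lieIter_le hm (tensBound_nonresTens hm) hr h k (hc t (hI t ht)).2
      simp only [hf, norm_neg]
      refine this.trans ?_
      have hfac : (k.factorial : ℝ) ≤ (k + 1).factorial := by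
        exact_mod_cast Nat.factorial_le (Nat.le_succ k)
      calc B' * k.factorial * (1 / 2) ^ k ≤ B' * (k + 1).factorial * (1 / 2) ^ k := by gcongr
        _ = (2 * B') * (k + 1).factorial * (1 / 2) ^ (k + 1) := by ring
        _ ≤ _ := by gcongr; linarith

end Curve

end LieSeries

/-! ### Collecting monomials -/

section Gather

variable {X E : Type*} (e : X → E) (c : X → ℂ)

open Classical in
/-- The sum of the coefficients `c x` over the `x` with exponent `e x = p`. -/
noncomputable def gather (p : E) : ℂ := ∑' x, if e x = p then c x else 0

theorem gather_mul (φ : E → ℂ) (p : E) : gather e c p * φ p = ∑' x : e ⁻¹' {p}, c x * φ (e x) := by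
  classical
  rw [gather, ← tsum_mul_right, tsum_subtype (e ⁻¹' {p}) fun x => c x * φ (e x)]
  refine tsum_congr fun x => ?_
  by_cases h : e x = p
  · rw [if_pos h, Set.indicator_of_mem (by exact h), h]
  · rw [if_neg h, Set.indicator_of_notMem (by exact h), zero_mul]

theorem hasSum_gather {φ : E → ℂ} (h : Summable fun x => c x * φ (e x)) :
    (Summable fun p => ‖gather e c p * φ p‖) ∧
      HasSum (fun p => gather e c p * φ p) (∑' x, c x * φ (e x)) := by
  have h1 := (Equiv.sigmaFiberEquiv e).summable_iff.2 h
  have h2 := (Equiv.sigmaFiberEquiv e).summable_iff.2 h.norm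
  constructor
  · refine Summable.of_nonneg_of_le (fun p => norm_nonneg _) (fun p => ?_) h2.sigma
    rw [gather_mul]
    exact norm_tsum_le_tsum_norm (h2.sigma_factor p)
  · have h3 := h1.hasSum.sigma fun p => (h1.sigma_factor p).hasSum
    have h4 := (Equiv.sigmaFiberEquiv e).tsum_eq fun x => c x * φ (e x)
    have h5 : (fun p => gather e c p * φ p) = fun p => ∑' x : e ⁻¹' {p}, c x * φ (e x) :=
      funext fun p => gather_mul e c φ p
    rw [← h4, h5]
    exact h3

/-- Collecting equal monomials can only create cancellations. No summability is needed: a divergent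
fibre has sum 0 by default. -/
theorem tsum_enorm_gather_mul_le (ψ : E → ℝ≥0∞) :
    ∑' p, ‖gather e c p‖ₑ * ψ p ≤ ∑' x, ‖c x‖ₑ * ψ (e x) := by
  classical
  calc ∑' p, ‖gather e c p‖ₑ * ψ p ≤ ∑' p, ∑' x, (if p = e x then ‖c x‖ₑ * ψ (e x) else 0) := by
        refine ENNReal.tsum_le_tsum fun p => ?_
        refine (mul_le_mul_left enorm_tsum_le_tsum_enorm _).trans ?_
        rw [← ENNReal.tsum_mul_right]
        refine ENNReal.tsum_le_tsum fun x => ?_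
        by_cases h : e x = p
        · rw [if_pos h, if_pos h.symm, h]
        · rw [if_neg h]
          simp
    _ = _ := by
        rw [ENNReal.tsum_comm]
        exact tsum_congr fun x => tsum_ite_eq _ _

theorem exists_of_gather_ne_zero {p : E} (h : gather e c p ≠ 0) : ∃ x, e x = p := by
  classical
  by_contra! hx
  refine h ?_
  rw [gather, tsum_congr fun x => if_neg (hx x), tsum_zero]

theorem gather_filter (P : E → Prop) [DecidablePred P] :
    (fun p => if P p then gather e c p else 0) = gather e fun x => if P (e x) then c x else 0 := by
  classical
  funext p
  by_cases h : P p
  · rw [if_pos h]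
    refine tsum_congr fun x => ?_
    by_cases hx : e x = p
    · simp only [if_pos hx]
      rw [if_pos (hx ▸ h)]
    · rw [if_neg hx, if_neg hx]
  · rw [if_neg h]
    refine (Eq.trans (tsum_congr fun x => ?_) tsum_zero).symm
    by_cases hx : e x = p
    · simp only [if_pos hx]
      rw [if_neg (hx ▸ h)]
    · rw [if_neg hx]

end Gather

/-! ### Exponents -/

section Exponents

variable {n : ℕ}

/-- The exponents of `z_i^σ`. -/
noncomputable def signExp (i : ℕ+) (s : Bool) : MIdx × MIdx :=
  if s then (Finsupp.single i 1, 0) else (0, Finsupp.single i 1)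

/-- The exponents of `z_i^σ z_i^σ'`. -/
noncomputable def pairExp (a : PairIdx) : MIdx × MIdx := signExp a.1 a.2.1 + signExp a.1 a.2.2

/-- The exponents of a product of pairs. -/
noncomputable def tensExp (q : Fin n → PairIdx) : MIdx × MIdx := ∑ k, pairExp (q k)

theorem hamMonomial_zero (z : ℕ+ → ℂ) : hamMonomial z 0 0 = 1 := by
  simp [hamMonomial]

theorem hamMonomial_add (z : ℕ+ → ℂ) (p p' : MIdx × MIdx) :
    hamMonomial z (p + p').1 (p + p').2 =
      hamMonomial z p.1 p.2 * hamMonomial z p'.1 p'.2 := by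
  simp only [hamMonomial, Prod.fst_add, Prod.snd_add]
  rw [Finsupp.prod_add_index' (fun _ => pow_zero _) (fun _ _ _ => pow_add _ _ _),
    Finsupp.prod_add_index' (fun _ => pow_zero _) (fun _ _ _ => pow_add _ _ _)]
  ring

theorem hamMonomial_signExp (z : ℕ+ → ℂ) (i : ℕ+) (s : Bool) :
    hamMonomial z (signExp i s).1 (signExp i s).2 = zSign s (z i) := by
  cases s <;> simp [hamMonomial, signExp, zSign]

theorem hamMonomial_tensExp (z : ℕ+ → ℂ) (q : Fin n → PairIdx) :
    hamMonomial z (tensExp q).1 (tensExp q).2 = tensMon z q := by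
  have h : ∀ s : Finset (Fin n), hamMonomial z (∑ k ∈ s, pairExp (q k)).1
      (∑ k ∈ s, pairExp (q k)).2 = ∏ k ∈ s, pairMon z z (q k) := by
    intro s
    induction s using Finset.induction_on with
    | empty => exact hamMonomial_zero z
    | insert k s hk ih =>
      rw [Finset.sum_insert hk, Finset.prod_insert hk, hamMonomial_add, ih, pairExp,
        hamMonomial_add, hamMonomial_signExp, hamMonomial_signExp, pairMon]
  exact h Finset.univ

theorem hamDegree_add (p p' : MIdx × MIdx) : hamDegree (p + p') = hamDegree p + hamDegree p' := by
  simp only [hamDegree, Prod.fst_add, Prod.snd_add]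
  rw [Finsupp.sum_add_index' (fun _ => rfl) (fun _ _ _ => rfl),
    Finsupp.sum_add_index' (fun _ => rfl) (fun _ _ _ => rfl)]
  ring

theorem hamDegree_signExp (i : ℕ+) (s : Bool) : hamDegree (signExp i s) = 1 := by
  cases s <;> simp [hamDegree, signExp]

theorem hamDegree_tensExp (q : Fin n → PairIdx) : hamDegree (tensExp q) = 2 * n := by
  have h : ∀ s : Finset (Fin n), hamDegree (∑ k ∈ s, pairExp (q k)) = 2 * s.card := by
    intro s
    induction s using Finset.induction_on with
    | empty => simp [hamDegree]
    | insert k s hk ih =>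
      rw [Finset.sum_insert hk, Finset.card_insert_of_notMem hk, hamDegree_add, ih, pairExp,
        hamDegree_add, hamDegree_signExp, hamDegree_signExp]
      ring
  have := h Finset.univ
  rwa [Finset.card_univ, Fintype.card_fin] at this

theorem tensExp_fst (q : Fin n → PairIdx) (j : ℕ+) :
    (tensExp q).1 j = ∑ k, (pairExp (q k)).1 j := by
  rw [tensExp, Prod.fst_sum, Finsupp.finsetSum_apply]

theorem tensExp_snd (q : Fin n → PairIdx) (j : ℕ+) :
    (tensExp q).2 j = ∑ k, (pairExp (q k)).2 j := by
  rw [tensExp, Prod.snd_sum, Finsupp.finsetSum_apply]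

theorem signExp_add (i : ℕ+) (s : Bool) (j : ℕ+) :
    (signExp i s).1 j + (signExp i s).2 j = if i = j then 1 else 0 := by
  cases s <;> simp [signExp, Finsupp.single_apply]

theorem pairExp_add (a : PairIdx) (j : ℕ+) :
    (pairExp a).1 j + (pairExp a).2 j = if a.1 = j then 2 else 0 := by
  have h1 := signExp_add a.1 a.2.1 j
  have h2 := signExp_add a.1 a.2.2 j
  simp only [pairExp, Prod.fst_add, Prod.snd_add, Finsupp.add_apply]
  split_ifs at * <;> omega

theorem even_tensExp (q : Fin n → PairIdx) (j : ℕ+) :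
    Even ((tensExp q).1 j + (tensExp q).2 j) := by
  rw [tensExp_fst, tensExp_snd, ← Finset.sum_add_distrib]
  refine Finset.even_sum _ fun k _ => ?_
  rw [pairExp_add]
  split_ifs <;> simp

theorem tensExp_snd_le (q : Fin n → PairIdx) (j : ℕ+) :
    (tensExp q).2 j ≤ ∑ k, if (q k).1 = j then 2 else 0 := by
  rw [tensExp_snd]
  refine Finset.sum_le_sum fun k _ => ?_
  rw [← pairExp_add]
  omega

theorem signExp_not (i : ℕ+) (s : Bool) : signExp i (!s) = (signExp i s).swap := by
  cases s <;> rfl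

theorem tensExp_bar (q : Fin n → PairIdx) :
    tensExp (fun k => (q k).bar) = (tensExp q).swap := by
  have h : ∀ a : PairIdx, pairExp a.bar = (pairExp a).swap := fun a => by
    change signExp a.1 (!a.2.1) + signExp a.1 (!a.2.2) = _
    rw [signExp_not, signExp_not]
    rfl
  simp only [tensExp, h]
  exact Prod.ext (by simp [Prod.fst_sum, Prod.snd_sum]) (by simp [Prod.fst_sum, Prod.snd_sum])

end Exponents

/-! ### Series of even homogeneous polynomials -/

section HamOf

variable {m : ℝ} {w : BeamWeight} {t : (k : ℕ) → (Fin (k + 3) → PairIdx) → ℂ} {M : ℕ → ℝ}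

/-- The power series `∑_k ∑_q t_k(q) z_q` with `q` in `(ℕ × {±} × {±})^{k+3}`. -/
noncomputable def hamOf (t : (k : ℕ) → (Fin (k + 3) → PairIdx) → ℂ) : HamSeries :=
  gather (fun x : Σ k : ℕ, Fin (k + 3) → PairIdx => tensExp x.2) fun x => t x.1 x.2

theorem exists_of_hamOf_ne_zero {p : MIdx × MIdx} (h : hamOf t p ≠ 0) :
    (∃ n : ℕ, 3 ≤ n ∧ hamDegree p = 2 * n) ∧ ∀ j : ℕ+, Even (p.1 j + p.2 j) := by
  obtain ⟨x, rfl⟩ := exists_of_gather_ne_zero _ _ h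
  exact ⟨⟨x.1 + 3, by omega, hamDegree_tensExp x.2⟩, even_tensExp x.2⟩

theorem hamOf_filter (P : ℕ → Prop) [DecidablePred P] :
    (fun p => if P (hamDegree p) then hamOf t p else 0) =
      hamOf fun k q => if P (2 * (k + 3)) then t k q else 0 := by
  have h := gather_filter (fun x : Σ k : ℕ, Fin (k + 3) → PairIdx => tensExp x.2)
    (fun x => t x.1 x.2) fun p => P (hamDegree p)
  simp only [hamDegree_tensExp] at h
  exact h

theorem homPart_hamOf (k₀ : ℕ) :
    homPart (2 * (k₀ + 3)) (hamOf t) = hamOf fun k q => if k = k₀ then t k q else 0 := by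
  have h := hamOf_filter (t := t) fun d => d = 2 * (k₀ + 3)
  refine h.trans (congrArg hamOf ?_)
  funext k q
  exact if_congr (by omega) rfl rfl

theorem hamOf_sub_homPart :
    hamOf t - homPart 6 (hamOf t) = hamOf fun k q => if k ≠ 0 then t k q else 0 := by
  have h := hamOf_filter (t := t) fun d => d ≠ 6
  refine Eq.trans ?_ (h.trans (congrArg hamOf ?_))
  · funext p
    rw [Pi.sub_apply, homPart]
    by_cases hp : hamDegree p = 6 <;> simp [hp]
  · funext k q
    exact if_congr (by omega) rfl rfl

theorem hamOf_real (ht : ∀ k q, t k (fun i => (q i).bar) = conj (t k q)) (α β : MIdx) :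
    hamOf t (α, β) = conj (hamOf t (β, α)) := by
  classical
  rw [hamOf, gather, gather, Complex.conj_tsum,
    ← (Equiv.sigmaCongrRight fun k : ℕ =>
      (Equiv.refl (Fin (k + 3))).arrowCongr PairIdx.bar).tsum_eq]
  refine tsum_congr fun x => ?_
  have hiff : tensExp (fun i => (x.2 i).bar) = (α, β) ↔ tensExp x.2 = (β, α) := by
    rw [tensExp_bar, ← Prod.swap_inj]
    rfl
  by_cases h : tensExp x.2 = (β, α)
  · exact (if_pos (hiff.2 h)).trans ((ht x.1 x.2).trans (congrArg _ (if_pos h).symm))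
  · exact (if_neg (hiff.not.2 h)).trans ((map_zero _).symm.trans (congrArg _ (if_neg h).symm))

theorem summable_hamOf_terms (hm : -1 / 2 ≤ m) (ht : ∀ k, TensBound m (M k) (t k))
    (z : BeamSpace w) (hM : Summable fun k => M k * (4 * normW0 m z ^ 2) ^ (k + 3)) :
    Summable fun x : Σ k : ℕ, Fin (k + 3) → PairIdx => t x.1 x.2 * tensMon z x.2 := by
  have h0 : ∀ k, 0 ≤ M k := fun k => (ht k).nonneg hm
  have hb : Summable fun x : Σ k : ℕ, Fin (k + 3) → PairIdx =>
      M x.1 * ∏ i, beamRatio m (x.2 i).1 * ‖z (x.2 i).1‖ ^ 2 := by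
    have hk := fun k => (hasSum_prod_ratio hm z (k + 3)).mul_left (M k)
    refine (summable_sigma_of_nonneg fun x => ?_).2 ⟨fun k => (hk k).summable, ?_⟩
    · exact mul_nonneg (h0 _) (Finset.prod_nonneg fun i _ =>
        mul_nonneg (beamRatio_pos hm _).le (sq_nonneg _))
    · exact hM.congr fun k => (hk k).tsum_eq.symm
  exact Summable.of_norm_bounded hb fun x => (ht x.1).norm_mul_tensMon_le z x.2

theorem hasSum_hamOf (hm : -1 / 2 ≤ m) (ht : ∀ k, TensBound m (M k) (t k))
    (z : BeamSpace w) (hM : Summable fun k => M k * (4 * normW0 m z ^ 2) ^ (k + 3)) :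
    (Summable fun p : MIdx × MIdx => ‖hamOf t p * hamMonomial z p.1 p.2‖) ∧
      HasSum (fun k => tensEval (t k) z) (hamEval (hamOf t) z) := by
  have hs := summable_hamOf_terms hm ht z hM
  have hg := hasSum_gather (fun x : Σ k : ℕ, Fin (k + 3) → PairIdx => tensExp x.2)
    (fun x => t x.1 x.2) (φ := fun p => hamMonomial z p.1 p.2)
    (hs.congr fun x => by rw [hamMonomial_tensExp])
  refine ⟨hg.1, ?_⟩
  have he : hamEval (hamOf t) z = ∑' x : Σ k : ℕ, Fin (k + 3) → PairIdx,
      t x.1 x.2 * tensMon z x.2 := by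
    refine hg.2.tsum_eq.trans (tsum_congr fun x => ?_)
    rw [hamMonomial_tensExp]
  rw [he]
  exact hs.hasSum.sigma fun k => ((ht k).summable hm z).hasSum

theorem memHam_hamOf (hm : -1 / 2 ≤ m) (ht : ∀ k, TensBound m (M k) (t k)) {r : ℝ}
    (htr : ∀ k q, t k (fun i => (q i).bar) = conj (t k q))
    (hM : ∀ z : BeamSpace w, ‖z‖ ≤ r → Summable fun k => M k * (4 * normW0 m z ^ 2) ^ (k + 3))
    (hn : hamNorm w r (hamOf t) < ∞) : MemHam w r (hamOf t) where
  real := hamOf_real htr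
  zero := by
    by_contra h
    obtain ⟨⟨n, hn, hd⟩, -⟩ := exists_of_hamOf_ne_zero h
    simp [hamDegree] at hd
    omega
  summable z hz := (hasSum_hamOf hm ht z (hM z (mem_closedBall_zero_iff.1 hz))).1
  finite := hn

/-! ### The norm of the vector field of the majorant -/

/-- Fixing the mode of slot `k` replaces its factor in the product of sums by the four sign pairs of
mode `j`. -/
theorem hasSum_prod_ratio_eq (hm : -1 / 2 ≤ m) (u : BeamSpace w) {n : ℕ} (k : Fin (n + 1))
    (j : ℕ+) :
    HasSum (fun q : Fin (n + 1) → PairIdx => if (q k).1 = j then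
        ∏ i, beamRatio m (q i).1 * ‖u (q i).1‖ ^ 2 else 0)
      (4 * (beamRatio m j * ‖u j‖ ^ 2) * (4 * normW0 m u ^ 2) ^ n) := by
  have h1 := hasSum_pairIdx (summable_beamRatio_mul_sq hm u)
  rw [← normW0_sq hm] at h1
  have h2 := hasSum_pairIdx
    (hasSum_ite_eq j (beamRatio m j * ‖u j‖ ^ 2)).summable
  rw [tsum_ite_eq] at h2
  have hnn : ∀ i, 0 ≤ beamRatio m i * ‖u i‖ ^ 2 := fun i =>
    mul_nonneg (beamRatio_pos hm i).le (sq_nonneg _)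
  have h := hasSum_prod_pi
    (fun i (a : PairIdx) => if i = k then (if a.1 = j then beamRatio m j * ‖u j‖ ^ 2 else 0)
      else beamRatio m a.1 * ‖u a.1‖ ^ 2)
    (fun i a => by split_ifs <;> first | exact hnn _ | exact le_rfl)
    (fun i => by
      by_cases hi : i = k
      · simp only [if_pos hi]
        exact h2.summable
      · simp only [if_neg hi]
        exact h1.summable)
  convert! h using 1
  · funext q
    rw [← Finset.mul_prod_erase _ _ (Finset.mem_univ k),
      ← Finset.mul_prod_erase Finset.univ (fun i => if i = k then _ else _) (Finset.mem_univ k),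
      if_pos rfl, Finset.prod_congr rfl fun i hi => if_neg (Finset.ne_of_mem_erase hi)]
    by_cases hq : (q k).1 = j
    · rw [if_pos hq, if_pos hq, hq]
    · rw [if_neg hq, if_neg hq, zero_mul]
  · rw [← Finset.mul_prod_erase _ _ (Finset.mem_univ k),
      Finset.prod_congr rfl fun i hi => (tsum_congr fun a => if_neg (Finset.ne_of_mem_erase hi))]
    simp only [if_true]
    rw [h2.tsum_eq, h1.tsum_eq, Finset.prod_const, Finset.card_erase_of_mem (Finset.mem_univ k),
      Finset.card_univ, Fintype.card_fin, Nat.add_sub_cancel]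

/-- The exponent `β_j` is at most 2 for every slot of mode `j`; the `n + 1` slots and the four sign
pairs of mode `j` then give `8𝔠 (n + 1)`. -/
theorem tsum_enorm_snd_tensMon_le (hm : -1 / 2 ≤ m) (u : BeamSpace w) {n : ℕ} {A : ℝ}
    {c : (Fin (n + 1) → PairIdx) → ℂ} (hc : TensBound m A c) (j : ℕ+) :
    ∑' q, ‖c q‖ₑ * (((tensExp q).2 j : ℝ≥0∞) * ‖tensMon u q‖ₑ) ≤
      ENNReal.ofReal (A * (n + 1) * (8 * beamC m) * (4 * normW0 m u ^ 2) ^ n * ‖u j‖ ^ 2) := by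
  have hA := hc.nonneg hm
  have hs : HasSum (fun q : Fin (n + 1) → PairIdx => A * ∑ k, 2 * (if (q k).1 = j then
        ∏ i, beamRatio m (q i).1 * ‖u (q i).1‖ ^ 2 else 0))
      (A * ∑ _k : Fin (n + 1), 2 * (4 * (beamRatio m j * ‖u j‖ ^ 2) * (4 * normW0 m u ^ 2) ^ n)) :=
    (hasSum_sum fun k _ => (hasSum_prod_ratio_eq hm u k j).mul_left 2).mul_left A
  have hp : ∀ q : Fin (n + 1) → PairIdx, 0 ≤ ∏ i, beamRatio m (q i).1 * ‖u (q i).1‖ ^ 2 :=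
    fun q => Finset.prod_nonneg fun i _ => mul_nonneg (beamRatio_pos hm _).le (sq_nonneg _)
  have hnn : ∀ q : Fin (n + 1) → PairIdx, 0 ≤ A * ∑ k, 2 * (if (q k).1 = j then
        ∏ i, beamRatio m (q i).1 * ‖u (q i).1‖ ^ 2 else 0) := fun q =>
    mul_nonneg hA (Finset.sum_nonneg fun k _ => by
      split_ifs
      · exact mul_nonneg zero_le_two (hp q)
      · simp)
  calc ∑' q, ‖c q‖ₑ * (((tensExp q).2 j : ℝ≥0∞) * ‖tensMon u q‖ₑ)
      ≤ ∑' q : Fin (n + 1) → PairIdx, ENNReal.ofReal (A * ∑ k, 2 * (if (q k).1 = j then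
        ∏ i, beamRatio m (q i).1 * ‖u (q i).1‖ ^ 2 else 0)) := by
        refine ENNReal.tsum_le_tsum fun q => ?_
        have h1 := hc.norm_mul_tensMon_le u q
        have h2 : ((tensExp q).2 j : ℝ) ≤ ∑ k, if (q k).1 = j then (2 : ℝ) else 0 := by
          have := tensExp_snd_le q j
          calc ((tensExp q).2 j : ℝ) ≤ ((∑ k, if (q k).1 = j then 2 else 0 : ℕ) : ℝ) := by
                exact_mod_cast this
            _ = _ := by push_cast; rfl
        rw [mul_left_comm, ← enorm_mul, ← ofReal_norm, ← ENNReal.ofReal_natCast,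
          ← ENNReal.ofReal_mul (Nat.cast_nonneg _)]
        refine ENNReal.ofReal_le_ofReal ?_
        calc ((tensExp q).2 j : ℝ) * ‖c q * tensMon u q‖
            ≤ (∑ k, if (q k).1 = j then (2 : ℝ) else 0) *
              (A * ∏ i, beamRatio m (q i).1 * ‖u (q i).1‖ ^ 2) :=
              mul_le_mul h2 h1 (norm_nonneg _) ((Nat.cast_nonneg _).trans h2)
          _ = _ := by
              rw [mul_left_comm, Finset.sum_mul]
              congr 1
              refine Finset.sum_congr rfl fun k _ => ?_
              split_ifs <;> simp
    _ = ENNReal.ofReal (∑' q : Fin (n + 1) → PairIdx, A * ∑ k, 2 * (if (q k).1 = j then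
        ∏ i, beamRatio m (q i).1 * ‖u (q i).1‖ ^ 2 else 0)) :=
        (ENNReal.ofReal_tsum_of_nonneg hnn hs.summable).symm
    _ ≤ _ := by
        rw [hs.tsum_eq]
        refine ENNReal.ofReal_le_ofReal ?_
        rw [Finset.sum_const, Finset.card_univ, Fintype.card_fin, nsmul_eq_mul]
        have hj := beamRatio_le hm j
        have h4 : 0 ≤ (4 * normW0 m u ^ 2) ^ n := by positivity
        calc A * (((n + 1 : ℕ) : ℝ) *
              (2 * (4 * (beamRatio m j * ‖u j‖ ^ 2) * (4 * normW0 m u ^ 2) ^ n)))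
            = A * (n + 1) * (8 * beamRatio m j) * (4 * normW0 m u ^ 2) ^ n * ‖u j‖ ^ 2 := by
              push_cast; ring
          _ ≤ _ := by gcongr

theorem hamMonomial_sub_single_mul (u : ℕ+ → ℂ) (p : MIdx × MIdx) (j : ℕ+) (h : p.2 j ≠ 0) :
    hamMonomial u p.1 (p.2 - Finsupp.single j 1) * conj (u j) = hamMonomial u p.1 p.2 := by
  have e : p = (p.1, p.2 - Finsupp.single j 1) + signExp j false := by
    refine Prod.ext (by simp [signExp]) ?_
    change p.2 = p.2 - Finsupp.single j 1 + Finsupp.single j 1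
    refine (tsub_add_cancel_of_le ?_).symm
    rw [Finsupp.single_le_iff]
    omega
  conv_rhs => rw [e, hamMonomial_add, hamMonomial_signExp]
  rfl

/-- By evenness, a monomial with `β_j > 0` still contains `z_j` or `z̄_j` after one `z̄_j` is
removed. -/
theorem majorantField_eq_zero {F : HamSeries}
    (hF : ∀ p, F p ≠ 0 → ∀ j : ℕ+, Even (p.1 j + p.2 j)) (u : ℕ+ → ℂ) (j : ℕ+) (hu : u j = 0) :
    majorantField F u j = 0 := by
  rw [majorantField, ENNReal.tsum_eq_zero]
  intro p
  by_cases h : F p = 0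
  · simp [h]
  have he := hF p h j
  by_cases h2 : p.2 j = 0
  · simp [h2]
  have hz : hamMonomial u p.1 (p.2 - Finsupp.single j 1) = 0 := by
    by_cases h1 : p.1 j = 0
    · have h3 : (p.2 - Finsupp.single j 1 : MIdx) j ≠ 0 := by
        rw [Finsupp.tsub_apply, Finsupp.single_eq_same]
        rw [h1, zero_add] at he
        obtain ⟨a, ha⟩ := he
        omega
      rw [hamMonomial, Finsupp.prod, Finsupp.prod]
      rw [Finset.prod_eq_zero (s := (p.2 - Finsupp.single j 1 : MIdx).support)
        (Finsupp.mem_support_iff.2 h3), mul_zero]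
      rw [hu, map_zero, zero_pow h3]
    · rw [hamMonomial, Finsupp.prod, Finset.prod_eq_zero (Finsupp.mem_support_iff.2 h1), zero_mul]
      rw [hu, zero_pow h1]
  rw [hz, enorm_zero, mul_zero]

/-- Multiplication by `|u_j|` restores the factor removed by the derivative and gives a series of
full monomials, bounded by a multiple of `|u_j|²`; one `|u_j|` is then cancelled. When `u_j = 0`
this is impossible, and evenness is used instead. -/
theorem majorantField_hamOf_le (hm : -1 / 2 ≤ m) (ht : ∀ k, TensBound m (M k) (t k))
    {g : ℝ} (u : BeamSpace w) (hu : normW0 m u ^ 2 ≤ g)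
    (hM : Summable fun k : ℕ => M k * (k + 3) * (8 * beamC m) * (4 * g) ^ (k + 2)) (j : ℕ+) :
    majorantField (hamOf t) u j ≤
      ENNReal.ofReal (∑' k : ℕ, M k * (k + 3) * (8 * beamC m) * (4 * g) ^ (k + 2)) * ‖u j‖ₑ := by
  have hM0 : ∀ k, 0 ≤ M k := fun k => (ht k).nonneg hm
  have hg : 0 ≤ g := (sq_nonneg _).trans hu
  have hcm := beamC_pos hm
  by_cases huj : u j = 0
  · rw [majorantField_eq_zero (fun p hp => (exists_of_hamOf_ne_zero hp).2) u j huj]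
    exact zero_le
  have hne : ‖u j‖ₑ ≠ 0 := enorm_ne_zero.2 huj
  rw [← ENNReal.mul_le_mul_iff_left hne enorm_ne_top]
  calc majorantField (hamOf t) u j * ‖u j‖ₑ
      = ∑' p : MIdx × MIdx, ‖hamOf t p‖ₑ * ((p.2 j : ℝ≥0∞) * ‖hamMonomial u p.1 p.2‖ₑ) := by
        rw [majorantField, ← ENNReal.tsum_mul_right]
        refine tsum_congr fun p => ?_
        by_cases h : p.2 j = 0
        · simp [h]
        · rw [← hamMonomial_sub_single_mul u p j h, enorm_mul (hamMonomial _ _ _),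
            RCLike.enorm_conj]
          ring
    _ ≤ ∑' x : Σ k : ℕ, Fin (k + 3) → PairIdx, ‖t x.1 x.2‖ₑ *
          (((tensExp x.2).2 j : ℝ≥0∞) * ‖tensMon u x.2‖ₑ) := by
        refine (tsum_enorm_gather_mul_le _ _ _).trans (le_of_eq (tsum_congr fun x => ?_))
        rw [hamMonomial_tensExp]
    _ = ∑' k : ℕ, ∑' q : Fin (k + 3) → PairIdx, ‖t k q‖ₑ *
          (((tensExp q).2 j : ℝ≥0∞) * ‖tensMon u q‖ₑ) :=
        ENNReal.tsum_sigma fun k (q : Fin (k + 3) → PairIdx) => ‖t k q‖ₑ *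
          (((tensExp q).2 j : ℝ≥0∞) * ‖tensMon u q‖ₑ)
    _ ≤ ∑' k : ℕ, ENNReal.ofReal
          (M k * (k + 3) * (8 * beamC m) * (4 * g) ^ (k + 2) * ‖u j‖ ^ 2) := by
        refine ENNReal.tsum_le_tsum fun k => ?_
        refine (tsum_enorm_snd_tensMon_le hm u (ht k) j).trans (ENNReal.ofReal_le_ofReal ?_)
        have := hM0 k
        push_cast
        rw [show (k : ℝ) + 2 + 1 = k + 3 by ring]
        gcongr
    _ = ENNReal.ofReal (∑' k : ℕ, M k * (k + 3) * (8 * beamC m) * (4 * g) ^ (k + 2)) *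
          ENNReal.ofReal (‖u j‖ ^ 2) := by
        have hnn : ∀ k : ℕ, 0 ≤ M k * (k + 3) * (8 * beamC m) * (4 * g) ^ (k + 2) := fun k => by
          have := hM0 k
          positivity
        rw [← ENNReal.ofReal_mul (tsum_nonneg hnn), ← tsum_mul_right,
          ENNReal.ofReal_tsum_of_nonneg (fun k => mul_nonneg (hnn k) (sq_nonneg _))
            (hM.mul_right _)]
    _ = _ := by
        rw [ENNReal.ofReal_pow (norm_nonneg _), ofReal_norm, sq, mul_assoc]

/-- A domination of each component by `|u_j|` passes to the norm of any weight. -/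
theorem hamNorm_le_of_majorantField_le {r : ℝ} (hr : 0 < r) {F : HamSeries} {K : ℝ}
    (hF : ∀ u : BeamSpace w, ‖u‖ ≤ r → ∀ j, majorantField F u j ≤ ENNReal.ofReal K * ‖u j‖ₑ) :
    hamNorm w r F ≤ ENNReal.ofReal K := by
  have hr0 : ENNReal.ofReal r ≠ 0 := by simpa using hr
  refine ENNReal.div_le_of_le_mul (iSup₂_le fun u hu => ?_)
  have hu' : ‖u‖ ≤ r := mem_closedBall_zero_iff.1 hu
  have hsum : ∑' j : ℕ+, ENNReal.ofReal (w.val j) ^ 2 * majorantField F u j ^ 2 ≤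
      (ENNReal.ofReal K * ENNReal.ofReal ‖u‖) ^ 2 := by
    calc _ ≤ ∑' j : ℕ+, ENNReal.ofReal K ^ 2 * ENNReal.ofReal (w.val j ^ 2 * ‖u j‖ ^ 2) := by
          refine ENNReal.tsum_le_tsum fun j => ?_
          calc _ ≤ ENNReal.ofReal (w.val j) ^ 2 * (ENNReal.ofReal K * ‖u j‖ₑ) ^ 2 := by
                gcongr
                exact hF u hu' j
            _ = _ := by
                rw [ENNReal.ofReal_mul (sq_nonneg _), ENNReal.ofReal_pow (w.pos j).le,
                  ENNReal.ofReal_pow (norm_nonneg _), ofReal_norm]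
                ring
      _ = _ := by
          rw [ENNReal.tsum_mul_left, ← ENNReal.ofReal_tsum_of_nonneg (fun j => by positivity)
            u.summable, ← BeamSpace.norm_sq, ENNReal.ofReal_pow (norm_nonneg _), mul_pow]
  calc _ ≤ ((ENNReal.ofReal K * ENNReal.ofReal ‖u‖) ^ 2) ^ (1 / 2 : ℝ) :=
        ENNReal.rpow_le_rpow hsum (by norm_num)
    _ = ENNReal.ofReal K * ENNReal.ofReal ‖u‖ := by
        rw [← ENNReal.rpow_natCast, ← ENNReal.rpow_mul]
        norm_num
    _ ≤ _ := by gcongr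

end HamOf

/-! ### Reality -/

section Reality

variable {m : ℝ} {n : ℕ}

/-- The polynomial with coefficients `c` is real. -/
def TensReal (c : (Fin n → PairIdx) → ℂ) : Prop := ∀ q, c (fun i => (q i).bar) = conj (c q)

theorem tensReal_quartTens : TensReal (quartTens m) := fun q => by
  rw [quartTens, quartTens, Complex.conj_ofReal]
  rfl

theorem tensReal_nonresTens : TensReal (nonresTens m) := fun q => by
  rw [nonresTens, nonresTens, apply_ite (starRingEnd ℂ), map_zero, Complex.conj_ofReal,
    pairFreq_bar, pairFreq_bar]
  refine if_congr ?_ rfl rfl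
  rw [← neg_add, neg_eq_zero]

theorem TensReal.lieTens {c : (Fin n → PairIdx) → ℂ} (hc : TensReal c) :
    TensReal (lieTens m c) := fun q => by
  rw [_root_.lieTens, _root_.lieTens, map_sum]
  refine Finset.sum_congr rfl fun k _ => ?_
  rw [map_sum, ← (Equiv.prodCongr Equiv.boolNot Equiv.boolNot).sum_comp]
  refine Finset.sum_congr rfl fun b _ => ?_
  rw [map_mul, ← lieCoef_bar, ← hc]
  congr 2
  funext i
  by_cases hi : i = k
  · subst hi
    simp only [Function.update_self]
    rfl
  · simp only [Function.update_of_ne hi]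
    rfl

theorem tensReal_lieIter {a : (Fin 2 → PairIdx) → ℂ} (ha : TensReal a) (k : ℕ) :
    TensReal (lieIter m a k) := by
  induction k with
  | zero => exact ha
  | succ k ih => exact ih.lieTens

end Reality

/-! ### The remainder -/

section Remainder

variable {m : ℝ} {w : BeamWeight}

/-- The coefficients of the terms of degree `2 (k + 3)` of the remainder. -/
noncomputable def remTens (m : ℝ) (k : ℕ) (q : Fin (k + 3) → PairIdx) : ℂ :=
  (((k + 1).factorial : ℝ)⁻¹ : ℝ) * lieIter m (quartTens m) (k + 1) q -
    (((k + 2).factorial : ℝ)⁻¹ : ℝ) * lieIter m (nonresTens m) (k + 1) q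

/-- The bound of the coefficients `remTens`. -/
noncomputable def remBound (m : ℝ) (k : ℕ) : ℝ :=
  1 / (16 * Real.pi) * (beamC m / (Real.pi * beamMu m)) ^ (k + 1) * (k + 2)

theorem remBound_nonneg (hm : -1 / 2 ≤ m) (k : ℕ) : 0 ≤ remBound m k := by
  have := beamMu_pos hm
  have := beamC_pos hm
  have := Real.pi_pos
  unfold remBound
  positivity

/-- Since `(k+2)!⁻¹ ≤ (k+1)!⁻¹`, both terms have the bound of the first, which doubles `1/(32π)`;
the factor `k + 2` is `(k+2)!/(k+1)!`. -/
theorem tensBound_remTens (hm : -1 / 2 ≤ m) (k : ℕ) :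
    TensBound m (remBound m k) (remTens m k) := by
  intro q
  have h1 := tensBound_lieIter hm (tensBound_quartTens hm) (k + 1) q
  have h2 := tensBound_lieIter hm (tensBound_nonresTens hm) (k + 1) q
  have hf : ((k + 2).factorial : ℝ)⁻¹ ≤ ((k + 1).factorial : ℝ)⁻¹ := by
    refine inv_anti₀ (by positivity) ?_
    exact_mod_cast Nat.factorial_le (Nat.le_succ (k + 1))
  have e : remBound m k = ((k + 1).factorial : ℝ)⁻¹ * lieBound m (k + 1) +
      ((k + 1).factorial : ℝ)⁻¹ * lieBound m (k + 1) := by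
    have h : ((k + 1 + 1).factorial : ℝ) = (k + 2) * (k + 1).factorial := by
      rw [Nat.factorial_succ]; push_cast; ring
    have h0 : ((k + 1).factorial : ℝ) ≠ 0 := by positivity
    rw [lieBound, remBound, h]
    field_simp
    ring
  have h3 := norm_nonneg (lieIter m (nonresTens m) (k + 1) q)
  rw [e, add_mul, mul_assoc, remTens]
  refine (norm_sub_le _ _).trans ?_
  rw [norm_mul, norm_mul, Complex.norm_real, Complex.norm_real,
    Real.norm_of_nonneg (by positivity), Real.norm_of_nonneg (by positivity)]
  exact add_le_add (mul_le_mul_of_nonneg_left h1 (by positivity))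
    (mul_le_mul hf h2 h3 (by positivity))

theorem tensReal_remTens (k : ℕ) : TensReal (remTens m k) := fun q => by
  rw [remTens, remTens, map_sub, map_mul, map_mul, Complex.conj_ofReal, Complex.conj_ofReal,
    tensReal_lieIter tensReal_quartTens, tensReal_lieIter tensReal_nonresTens]

theorem TensBound.ite {M : ℕ → ℝ} {t : (k : ℕ) → (Fin (k + 3) → PairIdx) → ℂ}
    (ht : ∀ k, TensBound m (M k) (t k)) (P : ℕ → Prop) [DecidablePred P] (k : ℕ) :
    TensBound m (if P k then M k else 0) fun q => if P k then t k q else 0 := by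
  intro q
  by_cases h : P k
  · simpa [h] using ht k q
  · simp [h]

theorem summable_ite_mul {M x : ℕ → ℝ} (h : Summable fun k => M k * x k) (P : ℕ → Prop)
    [DecidablePred P] : Summable fun k => (if P k then M k else 0) * x k := by
  refine (h.indicator {k | P k}).congr fun k => ?_
  by_cases hk : P k
  · rw [Set.indicator_of_mem (by exact hk), if_pos hk]
  · rw [Set.indicator_of_notMem (by exact hk), if_neg hk, zero_mul]

theorem tensEval_remTens (hm : -1 / 2 ≤ m) (k : ℕ) (z : BeamSpace w) :
    tensEval (remTens m k) z =
      (((k + 1).factorial : ℝ)⁻¹) • tensEval (lieIter m (quartTens m) (k + 1)) z +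
      (((k + 2).factorial : ℝ)⁻¹) • -tensEval (lieIter m (nonresTens m) (k + 1)) z := by
  have h1 := ((tensBound_lieIter hm (tensBound_quartTens hm) (k + 1)).summable hm z).hasSum.mul_left
    ((((k + 1).factorial : ℝ)⁻¹ : ℝ) : ℂ)
  have h2 := ((tensBound_lieIter hm (tensBound_nonresTens hm) (k + 1)).summable hm z).hasSum.mul_left
    ((((k + 2).factorial : ℝ)⁻¹ : ℝ) : ℂ)
  rw [Complex.real_smul, Complex.real_smul, mul_neg, ← sub_eq_add_neg]
  refine Eq.trans (tsum_congr fun q => ?_) (h1.sub h2).tsum_eq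
  rw [remTens]
  ring

/-- The terms of degree at least six of the transformed Hamiltonian. -/
theorem hasSum_tensEval_remTens (hm : -1 / 2 ≤ m) {r ρ : ℝ} (hr : 0 < r) {c : ℝ → BeamSpace w}
    (hc : IsFlowCurve (genFieldCLM w hm hr) ρ c) (h : 16 * (fieldConst m w r * ρ ^ 2) ≤ 1)
    (h0 : LambdaFinite m (c 0)) :
    HasSum (fun k => tensEval (remTens m k) (c 0))
      ((beamH m (c 1) - (beamLambda m (c 0) + beamGbar m (c 0)) : ℝ) : ℂ) := by
  have h1 := hasSum_lieSeries hm hr hc h (tensBound_quartTens hm)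
  have h2 := hasSum_lieSeries_lambda hm hr hc h h0
  -- The terms `k = 0` are `G` and `-N`, whose sum is `Ḡ`; all the others belong to the remainder.
  rw [← hasSum_nat_add_iff' 1] at h1 h2
  have h3 := h1.add h2
  rw [tensEval_quartTens hm] at h3
  have e0 : tensEval (lieIter m (quartTens m) 0) (c 0) = (beamG m (c 0) : ℂ) :=
    tensEval_quartTens hm (c 0)
  have e1 : tensEval (lieIter m (nonresTens m) 0) (c 0) =
      ((beamG m (c 0) - beamGbar m (c 0) : ℝ) : ℂ) := tensEval_nonresTens hm (c 0)
  rw [Finset.sum_range_one, Finset.sum_range_one] at h3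
  convert! h3 using 1
  · funext k
    exact tensEval_remTens hm k (c 0)
  · rw [e0, e1, beamH]
    simp
    ring

end Remainder

/-! ### Numerical estimates -/

section Estimates

variable {m : ℝ} {w : BeamWeight} {r : ℝ}

/-- The terms of the series of the norm of the remainder. -/
noncomputable def remTerm (m : ℝ) (w : BeamWeight) (r : ℝ) (k : ℕ) : ℝ :=
  remBound m k * (k + 3) * (8 * beamC m) * (4 * beamGamma m w r ^ 2) ^ (k + 2)

/-- An equality at `k = 0`. It trades the polynomial factor of the remainder for a doubling of the
geometric ratio. -/
theorem add_two_mul_add_three_le (k : ℕ) : ((k : ℝ) + 2) * (k + 3) ≤ 3 * 2 ^ (k + 1) := by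
  induction k with
  | zero => norm_num
  | succ k ih =>
    have : (0 : ℝ) ≤ k := k.cast_nonneg
    rw [pow_succ]
    push_cast
    nlinarith

theorem remTerm_nonneg (hm : -1 / 2 ≤ m) (k : ℕ) : 0 ≤ remTerm m w r k := by
  have := remBound_nonneg hm k
  have := beamC_pos hm
  unfold remTerm
  positivity

theorem remTerm_le (hm : -1 / 2 ≤ m) (k : ℕ) :
    remTerm m w r k ≤ 6 * (beamC m * beamGamma m w r ^ 2 / Real.pi) *
      (8 * (beamC m / (Real.pi * beamMu m) * beamGamma m w r ^ 2)) ^ (k + 1) := by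
  have hμ := beamMu_pos hm
  have hC := beamC_pos hm
  have hπ := Real.pi_pos
  have e : remTerm m w r k = 2 * (beamC m * beamGamma m w r ^ 2 / Real.pi) *
      (4 * (beamC m / (Real.pi * beamMu m) * beamGamma m w r ^ 2)) ^ (k + 1) *
        (((k : ℝ) + 2) * (k + 3)) := by
    rw [remTerm, remBound, pow_succ (4 * beamGamma m w r ^ 2) (k + 1), mul_pow 4 _ (k + 1),
      mul_pow 4 _ (k + 1), mul_pow (beamC m / _) _ (k + 1)]
    field_simp
    ring
  rw [e]
  calc _ ≤ 2 * (beamC m * beamGamma m w r ^ 2 / Real.pi) *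
      (4 * (beamC m / (Real.pi * beamMu m) * beamGamma m w r ^ 2)) ^ (k + 1) *
        (3 * 2 ^ (k + 1)) := by
        refine mul_le_mul_of_nonneg_left (add_two_mul_add_three_le k) (by positivity)
    _ = _ := by
        rw [show (8 : ℝ) = 4 * 2 by norm_num, mul_assoc 4 2, mul_left_comm 4 2,
          mul_pow 2 _ (k + 1)]
        ring

/-- The smallness condition on `γ_r`. -/
theorem exp_mul_gamma_sq_le (hm : -1 / 2 ≤ m) (hγ0 : 0 < beamGamma m w r)
    (hγ : beamGamma m w r ≤ 5 / 11 * √(Real.pi * beamMu m / (22 * Real.exp 1 * beamC m))) :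
    Real.exp 1 * (beamC m / (Real.pi * beamMu m) * beamGamma m w r ^ 2) ≤ 25 / 2662 := by
  have hμ := beamMu_pos hm
  have hC := beamC_pos hm
  have hπ := Real.pi_pos
  have he := Real.exp_pos 1
  -- The constant of the conclusion is `25/2662 = (5/11)²/22`.
  have h1 : beamGamma m w r ^ 2 ≤
      (5 / 11) ^ 2 * (Real.pi * beamMu m / (22 * Real.exp 1 * beamC m)) := by
    calc _ ≤ (5 / 11 * √(Real.pi * beamMu m / (22 * Real.exp 1 * beamC m))) ^ 2 := by gcongr
      _ = _ := by rw [mul_pow, Real.sq_sqrt (by positivity)]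
  calc _ ≤ Real.exp 1 * (beamC m / (Real.pi * beamMu m) *
        ((5 / 11) ^ 2 * (Real.pi * beamMu m / (22 * Real.exp 1 * beamC m)))) := by gcongr
    _ = _ := by field_simp; norm_num

theorem summable_remTerm (hm : -1 / 2 ≤ m)
    (hs : 8 * (beamC m / (Real.pi * beamMu m) * beamGamma m w r ^ 2) < 1) :
    Summable (remTerm m w r) := by
  have hμ := beamMu_pos hm
  have hC := beamC_pos hm
  have hπ := Real.pi_pos
  refine Summable.of_nonneg_of_le (remTerm_nonneg hm) (remTerm_le hm) (Summable.mul_left _ ?_)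
  exact (summable_nat_add_iff 1).2 (summable_geometric_of_lt_one (by positivity) hs)

theorem tsum_remTerm_shift_le (hm : -1 / 2 ≤ m)
    (hs : 8 * (beamC m / (Real.pi * beamMu m) * beamGamma m w r ^ 2) < 1) (n : ℕ) :
    ∑' k, remTerm m w r (k + n) ≤ 6 * (beamC m * beamGamma m w r ^ 2 / Real.pi) *
      ((8 * (beamC m / (Real.pi * beamMu m) * beamGamma m w r ^ 2)) ^ (n + 1) /
        (1 - 8 * (beamC m / (Real.pi * beamMu m) * beamGamma m w r ^ 2))) := by
  have hμ := beamMu_pos hm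
  have hC := beamC_pos hm
  have hπ := Real.pi_pos
  set x := 8 * (beamC m / (Real.pi * beamMu m) * beamGamma m w r ^ 2) with hx
  have hx0 : 0 ≤ x := by positivity
  have hg := ((hasSum_geometric_of_lt_one hx0 hs).mul_left (x ^ (n + 1))).mul_left
    (6 * (beamC m * beamGamma m w r ^ 2 / Real.pi))
  rw [← div_eq_mul_inv] at hg
  refine le_trans (Summable.tsum_le_tsum (fun k => ?_)
    ((summable_nat_add_iff n).2 (summable_remTerm hm hs)) hg.summable) hg.tsum_eq.le
  refine (remTerm_le hm (k + n)).trans (le_of_eq ?_)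
  rw [← hx]
  ring

/-- Let `s = 𝔠γ²/(πμ)` and `G = 𝔠γ²/π`. The geometric series gives `48 G s/(1 - 8s)`, while `C_r =
96.6306 G s/(1 - η)` with `η = 53.24 e s`; here `53.24 = 44 (11/10)²` and `96.6306 = (3/2)(11/10)² ·
53.24`. Moreover `8s ≤ η ≤ 53.24 · 25/2662 = 1/2`. -/
theorem tsum_remTerm_le (hm : -1 / 2 ≤ m)
    (hs : Real.exp 1 * (beamC m / (Real.pi * beamMu m) * beamGamma m w r ^ 2) ≤ 25 / 2662) :
    ∑' k, remTerm m w r k ≤ beamCr m w r := by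
  have hμ := beamMu_pos hm
  have hC := beamC_pos hm
  have hπ := Real.pi_pos
  have he := Real.exp_one_gt_d9
  have heta : beamEta m w r = 53.24 *
      (Real.exp 1 * (beamC m / (Real.pi * beamMu m) * beamGamma m w r ^ 2)) := by
    rw [beamEta]
    ring
  have hCr : beamCr m w r = 96.6306 * (beamC m * beamGamma m w r ^ 2 / Real.pi) *
      (beamC m / (Real.pi * beamMu m) * beamGamma m w r ^ 2) / (1 - beamEta m w r) := by
    rw [beamCr]
    nth_rewrite 1 [heta]
    field_simp
    ring
  have hs0 : 0 ≤ beamC m / (Real.pi * beamMu m) * beamGamma m w r ^ 2 := by positivity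
  have hG : 0 ≤ beamC m * beamGamma m w r ^ 2 / Real.pi := by positivity
  set s := beamC m / (Real.pi * beamMu m) * beamGamma m w r ^ 2
  set G := beamC m * beamGamma m w r ^ 2 / Real.pi
  have h8 : 8 * s ≤ beamEta m w r := by rw [heta]; nlinarith
  have h1 : beamEta m w r ≤ 1 / 2 := by rw [heta]; linarith
  have h := tsum_remTerm_shift_le (m := m) (w := w) (r := r) hm (by change 8 * s < 1; linarith) 0
  refine h.trans ?_
  rw [hCr]
  change 6 * G * ((8 * s) ^ (0 + 1) / (1 - 8 * s)) ≤ _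
  calc _ = 48 * G * s / (1 - 8 * s) := by ring
    _ ≤ 96.6306 * G * s / (1 - beamEta m w r) := by
        gcongr
        · linarith
        · norm_num

/-- With `s = 𝔠γ²/(πμ)` and `G = 𝔠γ²/π`, the series started at `k = 1` is at most `384 G s²/(1 - 8s)
≤ 768 G s²`, well within the stated constant. -/
theorem tsum_remTerm_ite_le (hm : -1 / 2 ≤ m)
    (hs : Real.exp 1 * (beamC m / (Real.pi * beamMu m) * beamGamma m w r ^ 2) ≤ 25 / 2662) :
    ∑' k, (if k ≠ 0 then remTerm m w r k else 0) ≤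
      16 * 44 ^ 2 * (11 / 10) ^ 6 / 3 * (beamC m ^ 3 / Real.pi ^ 3) *
          (beamGamma m w r ^ 6 / beamMu m ^ 2) := by
  have hμ := beamMu_pos hm
  have hC := beamC_pos hm
  have hπ := Real.pi_pos
  have he := Real.exp_one_gt_d9
  have hs0 : 0 ≤ beamC m / (Real.pi * beamMu m) * beamGamma m w r ^ 2 := by positivity
  have hG : 0 ≤ beamC m * beamGamma m w r ^ 2 / Real.pi := by positivity
  have e : (16 * 44 ^ 2 * (11 / 10) ^ 6 / 3 * (beamC m ^ 3 / Real.pi ^ 3) *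
      (beamGamma m w r ^ 6 / beamMu m ^ 2) : ℝ) = 16 * 44 ^ 2 * (11 / 10) ^ 6 / 3 *
      (beamC m * beamGamma m w r ^ 2 / Real.pi *
        (beamC m / (Real.pi * beamMu m) * beamGamma m w r ^ 2) ^ 2) := by
    field_simp
  have h16 : 8 * (beamC m / (Real.pi * beamMu m) * beamGamma m w r ^ 2) ≤ 1 / 2 := by nlinarith
  have hsum : Summable fun k => if k ≠ 0 then remTerm m w r k else 0 :=
    Summable.of_nonneg_of_le (fun k => ite_nonneg (remTerm_nonneg hm k) le_rfl)
      (fun k => by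
        by_cases hk : k ≠ 0
        · rw [if_pos hk]
        · rw [if_neg hk]
          exact remTerm_nonneg hm k) (summable_remTerm hm (by linarith))
  rw [hsum.tsum_eq_zero_add, if_neg (by simp), zero_add,
    tsum_congr fun k => if_pos (Nat.succ_ne_zero k), e]
  refine (tsum_remTerm_shift_le hm (by linarith) 1).trans ?_
  set s := beamC m / (Real.pi * beamMu m) * beamGamma m w r ^ 2
  set G := beamC m * beamGamma m w r ^ 2 / Real.pi
  have hGs : 0 ≤ G * s ^ 2 := by positivity
  calc 6 * G * ((8 * s) ^ (1 + 1) / (1 - 8 * s)) = 384 * (G * s ^ 2) / (1 - 8 * s) := by ring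
    _ ≤ 384 * (G * s ^ 2) / (1 / 2) := by
        gcongr
        linarith
    _ ≤ _ := by
        rw [div_div_eq_mul_div, div_one, mul_right_comm]
        refine mul_le_mul_of_nonneg_right (by norm_num) hGs

theorem summable_remBound_mul (hm : -1 / 2 ≤ m)
    (hs : 8 * (beamC m / (Real.pi * beamMu m) * beamGamma m w r ^ 2) < 1) {g : ℝ} (hg0 : 0 ≤ g)
    (hg : g ≤ beamGamma m w r ^ 2) : Summable fun k => remBound m k * (4 * g) ^ (k + 3) := by
  have hC := beamC_pos hm
  refine Summable.of_nonneg_of_le (fun k => ?_) (fun k => ?_)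
    ((summable_remTerm hm hs).mul_left (beamGamma m w r ^ 2 / (2 * beamC m)))
  · have := remBound_nonneg hm k
    positivity
  · have h := remBound_nonneg hm k
    have hk : (1 : ℝ) ≤ k + 3 := by have : (0 : ℝ) ≤ k := k.cast_nonneg; linarith
    calc remBound m k * (4 * g) ^ (k + 3)
        ≤ remBound m k * (4 * beamGamma m w r ^ 2) ^ (k + 3) * 1 := by rw [mul_one]; gcongr
      _ ≤ remBound m k * (4 * beamGamma m w r ^ 2) ^ (k + 3) * (k + 3) := by gcongr
      _ = _ := by
          rw [remTerm, pow_succ _ (k + 2)]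
          field_simp
          ring

end Estimates

/-! ### The normal form -/

section NormalForm

variable {m : ℝ} {w : BeamWeight} {r : ℝ}

theorem normW0_sq_le_gamma_sq (hm : -1 / 2 ≤ m) (hr : 0 < r) {z : BeamSpace w} (hz : ‖z‖ ≤ r) :
    normW0 m z ^ 2 ≤ beamGamma m w r ^ 2 := by
  calc _ ≤ (beamGamma m w r / r) ^ 2 * ‖z‖ ^ 2 := normW0_sq_le hm hr z
    _ ≤ (beamGamma m w r / r) ^ 2 * r ^ 2 := by gcongr
    _ = _ := by field_simp

theorem hasSum_hamOf_rem_ite (hm : -1 / 2 ≤ m) (hr : 0 < r)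
    (hs : 8 * (beamC m / (Real.pi * beamMu m) * beamGamma m w r ^ 2) < 1) (P : ℕ → Prop)
    [DecidablePred P] {z : BeamSpace w} (hz : ‖z‖ ≤ r) :
    HasSum (fun k => tensEval (fun q => if P k then remTens m k q else 0) z)
      (hamEval (hamOf fun k q => if P k then remTens m k q else 0) z) :=
  (hasSum_hamOf hm (TensBound.ite (tensBound_remTens hm) P) z
    (summable_ite_mul (summable_remBound_mul hm hs (sq_nonneg _)
      (normW0_sq_le_gamma_sq hm hr hz)) P)).2

theorem hamEval_homPart_rem (hm : -1 / 2 ≤ m) (hr : 0 < r)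
    (hs : 8 * (beamC m / (Real.pi * beamMu m) * beamGamma m w r ^ 2) < 1) (k : ℕ)
    {z : BeamSpace w} (hz : ‖z‖ ≤ r) :
    hamEval (homPart (2 * (k + 3)) (hamOf (remTens m))) z = tensEval (remTens m k) z := by
  rw [homPart_hamOf]
  refine (hasSum_hamOf_rem_ite hm hr hs (fun l => l = k) hz).unique ?_
  convert! hasSum_single k fun l hl => ?_
  · simp
  · simp [hl, tensEval]

theorem hamNorm_rem_ite_le (hm : -1 / 2 ≤ m) (hr : 0 < r)
    (hs : 8 * (beamC m / (Real.pi * beamMu m) * beamGamma m w r ^ 2) < 1) (P : ℕ → Prop)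
    [DecidablePred P] :
    hamNorm w r (hamOf fun k q => if P k then remTens m k q else 0) ≤
      ENNReal.ofReal (∑' k, if P k then remTerm m w r k else 0) := by
  have e : ∀ k : ℕ, (if P k then remTerm m w r k else 0) =
      (if P k then remBound m k else 0) * (k + 3) * (8 * beamC m) *
        (4 * beamGamma m w r ^ 2) ^ (k + 2) := fun k => by
    by_cases h : P k
    · rw [if_pos h, if_pos h, remTerm]
    · rw [if_neg h, if_neg h]
      ring
  have hsum : Summable fun k => remTerm m w r k := summable_remTerm hm hs
  simp only [remTerm, mul_assoc] at hsum
  have hsum2 := summable_ite_mul hsum P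
  simp only [e]
  refine hamNorm_le_of_majorantField_le hr fun u hu j => ?_
  refine majorantField_hamOf_le hm (TensBound.ite (tensBound_remTens hm) P) u
    (normW0_sq_le_gamma_sq hm hr hu) ?_ j
  simpa only [mul_assoc] using hsum2

theorem hamNorm_rem_le (hm : -1 / 2 ≤ m) (hr : 0 < r)
    (hs : 8 * (beamC m / (Real.pi * beamMu m) * beamGamma m w r ^ 2) < 1) :
    hamNorm w r (hamOf (remTens m)) ≤ ENNReal.ofReal (∑' k, remTerm m w r k) := by
  simpa using hamNorm_rem_ite_le (w := w) hm hr hs fun _ => True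

/-- A family of `n` pairs as a triple of families. -/
def pairFamilyEquiv (n : ℕ) :
    (Fin n → ℕ+) × (Fin n → Bool) × (Fin n → Bool) ≃ (Fin n → PairIdx) where
  toFun p k := (p.1 k, p.2.1 k, p.2.2 k)
  invFun q := (fun k => (q k).1, fun k => (q k).2.1, fun k => (q k).2.2)
  left_inv _ := rfl
  right_inv _ := rfl

theorem hasSum_pairFamily (hm : -1 / 2 ≤ m) {n : ℕ} {A : ℝ} {c : (Fin n → PairIdx) → ℂ}
    (hc : TensBound m A c) (z : BeamSpace w) :
    HasSum (fun q : (Fin n → ℕ+) × (Fin n → Bool) × (Fin n → Bool) =>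
      c (pairFamilyEquiv n q) *
        ∏ k : Fin n, zSign (q.2.1 k) (z (q.1 k)) * zSign (q.2.2 k) (z (q.1 k)))
      (tensEval c z) := by
  have h : HasSum (fun q => c q * tensMon z q) (tensEval c z) := (hc.summable hm z).hasSum
  refine HasSum.congr_fun ((pairFamilyEquiv n).hasSum_iff.2 h) fun q => ?_
  rw [Function.comp_apply, tensMon]
  rfl

set_option maxSynthPendingDepth 3 in
theorem flowMap_genFieldCLM (hm : -1 / 2 ≤ m) (hr : 0 < r)
    (h : fieldConst m w r * r ^ 2 ≤ 1 / 108) :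
    IsSymplTransf (Metric.closedBall 0 r) (flowMap (genFieldCLM w hm hr)) ∧
    IsSymplTransf (Metric.closedBall 0 r) (flowMap (-genFieldCLM w hm hr)) ∧
    ∀ z : BeamSpace w, ‖z‖ ≤ r →
      ‖flowMap (genFieldCLM w hm hr) z - z‖ ≤ fieldConst m w r * (11 / 10 * r) ^ 3 ∧
      ‖flowMap (-genFieldCLM w hm hr) z - z‖ ≤ fieldConst m w r * (11 / 10 * r) ^ 3 ∧
      flowMap (genFieldCLM w hm hr) (flowMap (-genFieldCLM w hm hr) z) = z ∧
      flowMap (-genFieldCLM w hm hr) (flowMap (genFieldCLM w hm hr) z) = z ∧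
      ∃ c : ℝ → BeamSpace w, c 0 = z ∧ c 1 = flowMap (genFieldCLM w hm hr) z ∧
        IsFlowCurve (genFieldCLM w hm hr) (11 / 10 * r) c := by
  have hT := norm_genFieldCLM_le (w := w) hm hr
  have hTr : ‖genFieldCLM w hm hr‖ * r ^ 2 ≤ 1 / 108 :=
    (mul_le_mul_of_nonneg_right hT (sq_nonneg r)).trans h
  have hT108 : 108 * ‖genFieldCLM w hm hr‖ * r ^ 2 ≤ 1 := by linarith
  have hT27 : 27 * ‖genFieldCLM w hm hr‖ * r ^ 2 ≤ 1 := by linarith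
  have hN27 : 27 * ‖-genFieldCLM w hm hr‖ * r ^ 2 ≤ 1 := by rwa [norm_neg]
  have hT3 : ‖genFieldCLM w hm hr‖ * (11 / 10 * r) ^ 3 ≤ fieldConst m w r * (11 / 10 * r) ^ 3 := by
    gcongr
  have hsymp := symplForm_fderiv_genField (w := w) hm hr
  refine ⟨isSymplTransf_flowMap hsymp hr hT108,
    isSymplTransf_flowMap (fun z u v => ?_) hr (by rwa [norm_neg]), fun z hz =>
    ⟨(norm_flowMap_sub_le hr hT27 hz).trans hT3, (norm_flowMap_sub_le hr hN27 hz).trans ?_, ?_,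
      flowMap_neg_flowMap hr hT27 hz, exists_isFlowCurve_flowMap hr hT27 hz⟩⟩
  · have e : ∀ u : BeamSpace w, (-genFieldCLM w hm hr) u z z + (-genFieldCLM w hm hr) z u z +
        (-genFieldCLM w hm hr) z z u = (-1 : ℝ) • (genFieldCLM w hm hr u z z +
          genFieldCLM w hm hr z u z + genFieldCLM w hm hr z z u) := fun u => by
      simp only [neg_apply, neg_smul, one_smul]
      abel
    rw [e, e, symplForm_swap _ u, symplForm_smul_left, symplForm_smul_left, ← smul_neg,
      ← symplForm_swap _ u, ← smul_add, hsymp, smul_zero]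
  · rwa [norm_neg]
  · have h := flowMap_neg_flowMap hr hN27 hz
    rwa [neg_neg] at h

end NormalForm

theorem mainTheorem3 (m : ℝ) (hm : -1 / 2 ≤ m) (w : BeamWeight) (r : ℝ) (hr : 0 < r)
    (hγ0 : 0 < beamGamma m w r)
    (hγ : beamGamma m w r ≤
      5 / 11 * √(Real.pi * beamMu m / (22 * Real.exp 1 * beamC m))) :
    ∃ (Ψ Ψinv : BeamSpace w → BeamSpace w) (R : HamSeries),
      -- invertible symplectic transformations on the closed ball of radius `r`
      IsSymplTransf (Metric.closedBall 0 r) Ψ ∧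
      IsSymplTransf (Metric.closedBall 0 r) Ψinv ∧
      -- closeness to the identity
      (∀ z : BeamSpace w, ‖z‖ ≤ r →
        ‖Ψ z - z‖ ≤
          11 ^ 3 * beamC m / (10 ^ 3 * Real.pi * beamMu m) * beamGamma m w r ^ 2 * r ∧
        ‖Ψinv z - z‖ ≤
          11 ^ 3 * beamC m / (10 ^ 3 * Real.pi * beamMu m) * beamGamma m w r ^ 2 * r) ∧
      11 ^ 3 * beamC m / (10 ^ 3 * Real.pi * beamMu m) * beamGamma m w r ^ 2 * r ≤
        1 / (80 * Real.exp 1) * r ∧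
      -- mutually inverse on a smaller ball
      (∀ z : BeamSpace w, ‖z‖ ≤ (1 - 1 / (80 * Real.exp 1)) * r →
        Ψ (Ψinv z) = z ∧ Ψinv (Ψ z) = z) ∧
      -- the normal form, at every point of the ball where `Λ` is finite
      MemHam w r R ∧
      (∀ z : BeamSpace w, ‖z‖ ≤ r → LambdaFinite m z →
        LambdaFinite m (Ψ z) ∧
        ((beamH m (Ψ z) : ℝ) : ℂ) =
          ((beamLambda m z + beamGbar m z : ℝ) : ℂ) + hamEval R z) ∧
      hamNorm w r R ≤ ENNReal.ofReal (beamCr m w r) ∧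
      -- `R` is a series of homogeneous polynomials of degrees `6, 8, 10, …` in which
      -- every index occurs to an even total power
      (∀ p : MIdx × MIdx, R p ≠ 0 →
        (∃ n : ℕ, 3 ≤ n ∧ hamDegree p = 2 * n) ∧ ∀ j : ℕ+, Even (p.1 j + p.2 j)) ∧
      (∀ z : BeamSpace w, ‖z‖ ≤ r →
        HasSum (fun n : ℕ => hamEval (homPart (2 * (n + 3)) R) z) (hamEval R z)) ∧
      (∀ n : ℕ, 3 ≤ n →
        ∃ c : (Fin n → ℕ+) × (Fin n → Bool) × (Fin n → Bool) → ℂ,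
          ∀ z : BeamSpace w, ‖z‖ ≤ r →
            HasSum
              (fun q : (Fin n → ℕ+) × (Fin n → Bool) × (Fin n → Bool) =>
                c q * ∏ k : Fin n, zSign (q.2.1 k) (z (q.1 k)) * zSign (q.2.2 k) (z (q.1 k)))
              (hamEval (homPart (2 * n) R) z)) ∧
      -- the part of degree at least `8`
      hamNorm w r (R - homPart 6 R) ≤
        ENNReal.ofReal (16 * 44 ^ 2 * (11 / 10) ^ 6 / 3 * (beamC m ^ 3 / Real.pi ^ 3) *
          (beamGamma m w r ^ 6 / beamMu m ^ 2)) := by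
  have hμ := beamMu_pos hm
  have hC := beamC_pos hm
  have hπ := Real.pi_pos
  have he := Real.exp_one_gt_d9
  have hse := exp_mul_gamma_sq_le hm hγ0 hγ
  have hs0 : 0 ≤ beamC m / (Real.pi * beamMu m) * beamGamma m w r ^ 2 := by positivity
  -- From `25/(2662 e) < 1/280`. This is enough for the threshold `1/108` of the flow and for the
  -- condition `h16` of the Lie series.
  have hs280 : beamC m / (Real.pi * beamMu m) * beamGamma m w r ^ 2 ≤ 1 / 280 := by nlinarith
  have hs8 : 8 * (beamC m / (Real.pi * beamMu m) * beamGamma m w r ^ 2) < 1 := by linarith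
  have hK : fieldConst m w r * r ^ 2 = beamC m / (Real.pi * beamMu m) * beamGamma m w r ^ 2 := by
    rw [fieldConst]
    field_simp
  obtain ⟨hΨ, hΨinv, hflow⟩ := flowMap_genFieldCLM hm hr (hK.trans_le (hs280.trans (by norm_num)))
  have hclose : fieldConst m w r * (11 / 10 * r) ^ 3 =
      11 ^ 3 * beamC m / (10 ^ 3 * Real.pi * beamMu m) * beamGamma m w r ^ 2 * r := by
    calc _ = (11 / 10) ^ 3 * (fieldConst m w r * r ^ 2) * r := by ring
      _ = _ := by rw [hK]; field_simp
  have hsmall : (1 - 1 / (80 * Real.exp 1)) * r ≤ r := by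
    have : 0 ≤ 1 / (80 * Real.exp 1) := by positivity
    nlinarith
  refine ⟨flowMap (genFieldCLM w hm hr), flowMap (-genFieldCLM w hm hr), hamOf (remTens m),
    hΨ, hΨinv, fun z hz => ⟨(hflow z hz).1.trans_eq hclose, (hflow z hz).2.1.trans_eq hclose⟩, ?_,
    -- The two maps are in fact mutually inverse on the whole ball of radius `r`.
    fun z hz => ⟨(hflow z (hz.trans hsmall)).2.2.1, (hflow z (hz.trans hsmall)).2.2.2.1⟩, ?_,
    fun z hz hΛ => ?_, ?_, fun p hp => exists_of_hamOf_ne_zero hp,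
    fun z hz => ?_, fun n hn => ?_, ?_⟩
  -- The bound on `γ_r` is just sufficient here: `80 · (11/10)³ · 25/2662 = 1`.
  · refine mul_le_mul_of_nonneg_right ?_ hr.le
    rw [le_div_iff₀ (by positivity)]
    calc _ = 80 * (11 / 10) ^ 3 *
          (Real.exp 1 * (beamC m / (Real.pi * beamMu m) * beamGamma m w r ^ 2)) := by
          field_simp
      _ ≤ _ := by linarith
  · exact memHam_hamOf hm (tensBound_remTens hm) tensReal_remTens
      (fun z hz => summable_remBound_mul hm hs8 (sq_nonneg _) (normW0_sq_le_gamma_sq hm hr hz))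
      ((hamNorm_rem_le hm hr hs8).trans_lt ENNReal.ofReal_lt_top)
  · obtain ⟨c, hc0, hc1, hc⟩ := (hflow z hz).2.2.2.2
    rw [← hc1]
    rw [← hc0] at hΛ
    obtain ⟨B, hB⟩ := exists_beamLambda_curve_le hm hr hc hΛ
    refine ⟨(hB 1 ⟨by norm_num, by norm_num⟩).1, ?_⟩
    have h16 : 16 * (fieldConst m w r * (11 / 10 * r) ^ 2) ≤ 1 := by
      rw [mul_pow, mul_left_comm (fieldConst m w r), hK]
      linarith
    have h1 := hasSum_tensEval_remTens hm hr hc h16 hΛ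
    have h2 := (hasSum_hamOf hm (tensBound_remTens hm) z
      (summable_remBound_mul hm hs8 (sq_nonneg _) (normW0_sq_le_gamma_sq hm hr hz))).2
    rw [hc0] at h1
    rw [← h1.unique h2]
    push_cast
    ring
  · exact (hamNorm_rem_le hm hr hs8).trans (ENNReal.ofReal_le_ofReal (tsum_remTerm_le hm hse))
  · have h2 := (hasSum_hamOf hm (tensBound_remTens hm) z
      (summable_remBound_mul hm hs8 (sq_nonneg _) (normW0_sq_le_gamma_sq hm hr hz))).2
    simpa only [hamEval_homPart_rem hm hr hs8 _ hz] using h2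
  · obtain ⟨k, rfl⟩ := Nat.exists_eq_add_of_le' hn
    refine ⟨fun q => remTens m k (pairFamilyEquiv (k + 3) q), fun z hz => ?_⟩
    rw [hamEval_homPart_rem hm hr hs8 k hz]
    exact hasSum_pairFamily hm (tensBound_remTens hm k) z
  · rw [hamOf_sub_homPart]
    exact (hamNorm_rem_ite_le hm hr hs8 fun k => k ≠ 0).trans
      (ENNReal.ofReal_le_ofReal (tsum_remTerm_ite_le hm hse))
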